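/- Let $F_o$ be a non-archimedean locally compact field of residual characteristic not $2$, $F/F_o$ a Galois extension of degree at most $2$, $\sigma_F$ a generator of $\mathrm{Gal}(F/F_o)$, and $v$ the valuation of $F$ with $v(F_o^\times)=\mathbb Z$. Let $\epsilon=\pm1$, let $V$ be a finite-dimensional $F$-vector space with a non-degenerate $\epsilon$-hermitian form $h$ relative to $\sigma_F$ ($h(\lambda x,\mu y)=\lambda^{\sigma_F}\mu\,h(x,y)$ and $h(y,x)=\epsilon h(x,y)^{\sigma_F}$), let $\sigma$ be the adjoint involution of $\mathrm{End}_F(V)$, let $G$ be the isometry group of $h$ and $\mathfrak g=\{a:\ a+a^\sigma=0\}$. Let $\beta\in\mathfrak g$ be such that $F[\beta]=\bigoplus_{i}E_i$ is a direct sum of fields, and let $H$ be the centralizer of $\beta$ in $G$. Label the summands so that $\sigma(E_i)=E_{-i}$; let $J_o$ be the set of $i$ with $-i=i$, let $J$ be the set of the other indices, and let $J_+\subset J$ contain exactly one of $i,-i$ for each $i\in J$. Let $1_i$ be the unit of $E_i$, let $V_i=1_iV$, so that $V=\bigoplus_i V_i$, and let $v_i$ be the extension of $v$ to $E_i$. For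 $i\in J_o$ put $\sigma_i=\sigma|_{E_i}$, and let $E_i^o$ be the fixed field of $\sigma_i$. Choose a nonzero $F$-linear form $\lambda_i:E_i\to F$ with $\lambda_i\circ\sigma_i=\sigma_F\circ\lambda_i$ and such that the form $\lambda_i^o:E_i^o\to F_o$ given by $\lambda_i^o\circ\mathrm{Tr}_{E_i/E_i^o}=\mathrm{Tr}_{F/F_o}\circ\lambda_i$ satisfies $\{a\in E_i^o:\ \lambda_i^o(a\,\mathfrak o_{E_i^o})\subset\mathfrak p_{F_o}\}=\mathfrak p_{E_i^o}$. Let $h_i$ be the $\epsilon$-hermitian form on the $E_i$-space $V_i$ relative to $\sigma_i$ with $h=\lambda_i\circ h_i$ on $V_i$, and let $H_i$ be its isometry group. For $i\in J_+$ let $H_i=\mathrm{Aut}_{E_i}(V_i)$. Then $H\simeq\prod_{i\in J_o\cup J_+}H_i$ by restriction to the $V_i$. Let $I$ be the Bruhat–Tits building of the standard valuated root datum of $G$. For $i\in J_o$ let $I^1_i$ be the corresponding building of $H_i$, and for $i\in J_+$ let $I^1_i$ be the enlarged Bruhat–Tits building of $H_i$. Put $I^1_\beta=\prod_{i\in J_o\cup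 J_+}I^1_i$. A lattice function in a finite-dimensional vector space $W$ over a finite extension $K$ of $F$, where $v$ also denotes the extension of $v$ to $K$, is a decreasing left-continuous map $\Lambda$ from $\mathbb R$ to the $\mathfrak o_K$-lattices of $W$ with $\Lambda(r+v(c))=c\Lambda(r)$ for all $c\in K^\times$. Write $\Lambda(s+)=\bigcup_{s'>s}\Lambda(s')$. For a form $f$ on $W$, $\Lambda$ is self-dual for $f$ if $\Lambda(r)=\{x:\ f(x,\Lambda((-r)+))\subset\mathfrak p_K\}$ for all $r$. Let $j_h$ be the affine $G$-equivariant bijection from $I$ onto the set of self-dual lattice functions of $(V,h)$; for $i\in J_o$ let $j_{h_i}$ be the analogous $H_i$-equivariant bijection for $(V_i,h_i)$; and for $i\in J_+$ let $j_i$ be any affine $H_i$-equivariant bijection from $I_i^1$ onto the set of $\mathfrak o_{E_i}$-lattice functions in $V_i$. Given $\{j_i\}_{i\in J_+}$, define $j_\beta:I^1_\beta\to I$ by $$j_h(j_\beta(x))=\bigoplus_{i\in J_o\cup J}\Lambda_i,$$ where $\Lambda_i=j_{h_i}(x_i)$ for $i\in J_o$, and for $i\in J_+$ one puts $\Lambda_i=j_i(x_i)$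 and $\Lambda_{-i}(r)=\{y\in V_{-i}:\ h(y,\Lambda_i((-r)+))\subset\mathfrak p_F\}$. Theorem. Such maps $j_\beta$ exist, and each of them is injective and $H$-equivariant. The set of these maps, as $\{j_i\}_{i\in J_+}$ varies, depends only on the involution $\sigma$: if $h'$ is another non-degenerate $\epsilon$-hermitian form on $V$ relative to $\sigma_F$ with adjoint involution $\sigma$, and the $h_i'$ ($i\in J_o$) are forms attached to $h'$ as above, for any choice of the linear forms, then $h',(h'_i)$ and $h,(h_i)$ give the same set of maps $I^1_\beta\to I$. In particular, if $J=\emptyset$, there is a unique map $j_\beta$, and it depends only on $\sigma$. -/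

import Mathlib

open scoped ValuativeRel

noncomputable section

namespace ClassicalBuildings

/-! ### Valued fields, lattice functions -/

section Lattice

variable {K : Type*} [Field K] (v : AddValuation K (WithTop ℝ))

/-- The ring of integers `{x | 0 ≤ v x}`. Its maximal ideal is `{x | 0 < v x}`. -/
def integerRing : Subring K where
  carrier := {x | 0 ≤ v x}
  mul_mem' {a b} ha hb := by
    have h1 : 0 ≤ v a := ha
    have h2 : 0 ≤ v b := hb
    change 0 ≤ v (a * b)
    rw [v.map_mul]
    exact add_nonneg h1 h2
  one_mem' := by
    change 0 ≤ v 1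
    rw [v.map_one]
  add_mem' {a b} ha hb := v.map_le_add ha hb
  zero_mem' := by
    change 0 ≤ v 0
    rw [v.map_zero]
    exact le_top
  neg_mem' {a} ha := by
    change 0 ≤ v (-a)
    rw [v.map_neg]
    exact ha

/-- The valuation of a nonzero scalar, as a real number (it is only used at nonzero scalars). -/
def val (c : K) : ℝ := (v c).untopD 0

variable (W : Type*) [AddCommGroup W] [Module K W]

/-- A lattice function in `W`: a decreasing, left-continuous map from `ℝ` to the lattices of `W`
(finitely generated submodules over the ring of integers which span `W`) with
`Λ (r + v c) = c Λ r` for all nonzero scalars `c` (equivalently, for one uniformizer `c`). -/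
@[ext]
structure LatticeFunction where
  toFun : ℝ → Submodule (integerRing v) W
  isLattice : ∀ r, Submodule.IsLattice K (toFun r)
  anti : ∀ r s, s ≤ r → toFun r ≤ toFun s
  periodic : ∀ (c : K) (t : ℝ), v c = (t : WithTop ℝ) →
    ∀ (r : ℝ) (x : W), x ∈ toFun (r + t) ↔ ∃ y ∈ toFun r, x = c • y
  leftCont : ∀ (r : ℝ) (x : W), (∀ s < r, x ∈ toFun s) → x ∈ toFun r

variable {v W}

/-- `Λ r = ⨁ₖ {c | r + l k ≤ v c} bₖ` for all `r`: the basis `b` splits `Λ`, with constants `l`. -/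
def SplitBy {n : ℕ} (b : Module.Basis (Fin n) K W) (l : Fin n → ℝ) (L : LatticeFunction v W) :
    Prop :=
  ∀ (r : ℝ) (x : W), x ∈ L.toFun r ↔ ∀ k, ((r + l k : ℝ) : WithTop ℝ) ≤ v (b.repr x k)

/-- `P` is the barycenter `t L + (1 - t) M`, computed in a basis that splits both `L` and `M`. -/
def IsBarycenter (t : ℝ) (L M P : LatticeFunction v W) : Prop :=
  ∃ (n : ℕ) (b : Module.Basis (Fin n) K W) (l m : Fin n → ℝ),
    SplitBy b l L ∧ SplitBy b m M ∧ SplitBy b (fun k => t * l k + (1 - t) * m k) P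

end Lattice

/-! ### Gluing apartments

`GlueSpace move U` is the quotient of `G × A` by the Bruhat-Tits relation: `(g, x) ∼ (g', y)` if
there is `n ∈ N` with `y = ν(n) x` and `g⁻¹ g' n ∈ U_x`. Here `move n x y` says that
`n ∈ N` and `y = ν(n) x`. -/

section Glue

variable {G A : Type*} [Group G] (move : G → A → A → Prop) (U : A → Subgroup G)

def GlueRel (p q : G × A) : Prop :=
  ∃ n : G, move n p.2 q.2 ∧ p.1⁻¹ * q.1 * n ∈ U p.2

def GlueSpace : Type _ := Quot (GlueRel move U)

/-- The class of `(g, x)`, i.e. the point `g x` of the building. For fixed `g` these points form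
the apartment `g A`. -/
def GlueSpace.mk (g : G) (x : A) : GlueSpace move U := Quot.mk _ (g, x)

/-- `G` acts by left translation. -/
instance : MulAction G (GlueSpace move U) where
  smul g := Quot.map (fun p => (g * p.1, p.2)) (by
    rintro ⟨a, x⟩ ⟨b, y⟩ ⟨n, hn, hu⟩
    refine ⟨n, hn, ?_⟩
    have e : (g * a)⁻¹ * (g * b) * n = a⁻¹ * b * n := by group
    change (g * a)⁻¹ * (g * b) * n ∈ U x
    rw [e]
    exact hu)
  one_smul := by
    rintro ⟨a, x⟩
    change Quot.mk _ (1 * a, x) = Quot.mk _ (a, x)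
    rw [one_mul]
  mul_smul := by
    rintro g g' ⟨a, x⟩
    change Quot.mk _ (g * g' * a, x) = Quot.mk _ (g * (g' * a), x)
    rw [mul_assoc]

end Glue

/-! ### Hermitian forms and the building of a classical group -/

section Classical

variable {K : Type*} [Field K] {τ : K →+* K} {W : Type*} [AddCommGroup W] [Module K W]

/-- `h (y, x) = ε h (x, y)^τ`. -/
def IsEpsHermitian (ε : ℤˣ) (h : W →ₛₗ[τ] W →ₗ[K] K) : Prop :=
  ∀ x y, h y x = ((ε : ℤ) : K) * τ (h x y)

/-- The group of isometries of `h`. -/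
def isometryGroup (h : W →ₛₗ[τ] W →ₗ[K] K) : Subgroup (W ≃ₗ[K] W) where
  carrier := {g | ∀ x y, h (g x) (g y) = h x y}
  mul_mem' {a b} ha hb x y := (ha (b x) (b y)).trans (hb x y)
  one_mem' _ _ := rfl
  inv_mem' {a} ha x y := by
    have := ha (a⁻¹ x) (a⁻¹ y)
    rw [← this]
    change h (a (a.symm x)) (a (a.symm y)) = _
    rw [a.apply_symm_apply, a.apply_symm_apply]

/-- A lattice function is self-dual if `Λ r = {x | h (x, Λ((-r)+)) ⊆ 𝔭}` for all `r`, where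
`Λ(s+)` is the union of the `Λ s'`, `s' > s`. -/
def IsSelfDual {v : AddValuation K (WithTop ℝ)} (h : W →ₛₗ[τ] W →ₗ[K] K)
    (L : LatticeFunction v W) : Prop :=
  ∀ (r : ℝ) (x : W), x ∈ L.toFun r ↔ ∀ s > -r, ∀ y ∈ L.toFun s, 0 < v (h x y)

/-- A Witt decomposition. The index set `{±1, …, ±r}` is `Fin r × {±1}`. The vectors
`e (k, 1)` and `e (k, -1)` span totally isotropic subspaces `V₊` and `V₋` in duality, and the
orthogonal `V₀` of `V₊ + V₋` is anisotropic. -/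
structure WittFrame (h : W →ₛₗ[τ] W →ₗ[K] K) where
  rank : ℕ
  e : Fin rank × ℤˣ → W
  orth : ∀ i j, j ≠ (i.1, -i.2) → h (e i) (e j) = 0
  pair : ∀ k, h (e (k, 1)) (e (k, -1)) = 1
  aniso : ∀ x, (∀ i, h (e i) x = 0) → h x x = 0 → x = 0

namespace WittFrame

variable {h : W →ₛₗ[τ] W →ₗ[K] K} (w : WittFrame h) (v : AddValuation K (WithTop ℝ))

/-- `i ↦ -i` on the index set. -/
def opp (i : Fin w.rank × ℤˣ) : Fin w.rank × ℤˣ := (i.1, -i.2)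

/-- The anisotropic part `V₀ = (V₊ + V₋)^⊥`. -/
def InAniso (y : W) : Prop := ∀ i, h (w.e i) y = 0

/-- The apartment is `X_*(S) ⊗ ℝ`, with the coordinates dual to the characters `a₁, …, a_r`
of the split torus; `coord x i` is the value at `x` of the character `a_i`, `a_{-i} = -a_i`. -/
def coord (x : Fin w.rank → ℝ) (i : Fin w.rank × ℤˣ) : ℝ := ((i.2 : ℤ) : ℝ) * x i.1

/-- `n` permutes the lines `K e_i` (i.e. `n` lies in `N`), and `y = ν(n) x`. The centralizer `Z` of
the torus acts through the translations with `a_i (ν(z)) = - v (a_i (z))`, and the elements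
of `N` which permute the `±e_i` act linearly. -/
def move (n : isometryGroup h) (x y : Fin w.rank → ℝ) : Prop :=
  (∀ i, ∃ j, ∃ c : K, n.1 (w.e i) = c • w.e j) ∧
    ∀ i j, ∀ c : K, n.1 (w.e i) = c • w.e j → w.coord y j = w.coord x i - val v c

/-- `u` belongs to the root group of `a_i + a_j` (`i ≠ ± j`), with parameter `c`; the valuation of
`u` in the standard valuation of the root datum is `v c`. -/
def IsShortPair (u : isometryGroup h) (i j : Fin w.rank × ℤˣ) (c : K) : Prop :=
  i.1 ≠ j.1 ∧ u.1 (w.e (w.opp i)) = w.e (w.opp i) + c • w.e j ∧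
    (∃ c' : K, u.1 (w.e (w.opp j)) = w.e (w.opp j) + c' • w.e i) ∧
    (∀ l, l ≠ w.opp i → l ≠ w.opp j → u.1 (w.e l) = w.e l) ∧
    ∀ y, w.InAniso y → u.1 y = y

/-- `u` belongs to the root group of `a_i` (of `2 a_i` if `z = 0`), with parameters `z ∈ V₀` and
`k`; the valuation of `u` in the standard valuation of the root datum is `v k / 2`
(respectively `v k`). -/
def IsSingle (u : isometryGroup h) (i : Fin w.rank × ℤˣ) (z : W) (k : K) : Prop :=
  w.InAniso z ∧ u.1 (w.e (w.opp i)) = w.e (w.opp i) + z + k • w.e i ∧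
    (∀ l, l ≠ w.opp i → u.1 (w.e l) = w.e l) ∧
    ∀ y, w.InAniso y → ∃ m : K, u.1 y = y + m • w.e i

/-- `U_x`, generated by the subgroups `U_{a, x} = {u ∈ U_a | φ_a(u) ≥ - a(x)}` for all roots `a`. -/
def unip (x : Fin w.rank → ℝ) : Subgroup (isometryGroup h) :=
  Subgroup.closure
    {u | (∃ i j c, w.IsShortPair u i j c ∧
            ((-(w.coord x i + w.coord x j) : ℝ) : WithTop ℝ) ≤ v c) ∨
         (∃ i z k, w.IsSingle u i z k ∧ ((-(2 * w.coord x i) : ℝ) : WithTop ℝ) ≤ v k)}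

end WittFrame

/-- The Bruhat-Tits building of the isometry group of `h`, glued from the apartment attached to the
Witt decomposition `w`. -/
abbrev ClassicalBuilding (v : AddValuation K (WithTop ℝ)) {h : W →ₛₗ[τ] W →ₗ[K] K}
    (w : WittFrame h) : Type _ :=
  GlueSpace (w.move v) (w.unip v)

/-- `j` is an affine equivariant bijection from the building onto the set of lattice functions which
are self-dual for `h'`. Here `h'` is a form with the same isometry group as `h`. A map is affine if
it is so on each apartment. -/
def IsClassicalIdent {v : AddValuation K (WithTop ℝ)} {h : W →ₛₗ[τ] W →ₗ[K] K} (w : WittFrame h)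
    (h' : W →ₛₗ[τ] W →ₗ[K] K) (j : ClassicalBuilding v w → LatticeFunction v W) : Prop :=
  Set.BijOn j Set.univ {L | IsSelfDual h' L} ∧
  (∀ (g : isometryGroup h) (p : ClassicalBuilding v w) (r : ℝ) (y : W),
    g.1 y ∈ (j (g • p)).toFun r ↔ y ∈ (j p).toFun r) ∧
  ∀ (g : isometryGroup h) (x y : Fin w.rank → ℝ), ∀ t ∈ Set.Icc (0 : ℝ) 1,
    IsBarycenter t (j (GlueSpace.mk _ _ g x)) (j (GlueSpace.mk _ _ g y))
      (j (GlueSpace.mk _ _ g (t • x + (1 - t) • y)))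

end Classical

/-! ### The enlarged building of a general linear group -/

section Linear

variable {K : Type*} [Field K] {W : Type*} [AddCommGroup W] [Module K W] {n : ℕ}

/-- `g` is monomial in the basis `b`, and `y = ν(g) x`; the apartment is `ℝⁿ = X_*(S) ⊗ ℝ` for the
full diagonal torus `S`. -/
def linearMove (v : AddValuation K (WithTop ℝ)) (b : Module.Basis (Fin n) K W)
    (g : W ≃ₗ[K] W) (x y : Fin n → ℝ) : Prop :=
  (∀ i, ∃ j, ∃ c : K, g (b i) = c • b j) ∧
    ∀ i j, ∀ c : K, g (b i) = c • b j → y j = x i - val v c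

/-- The group generated by the elementary matrices `1 + c E_{ij}` with `v c ≥ -(a_i - a_j)(x)`. -/
def linearUnip (v : AddValuation K (WithTop ℝ)) (b : Module.Basis (Fin n) K W)
    (x : Fin n → ℝ) : Subgroup (W ≃ₗ[K] W) :=
  Subgroup.closure
    {u | ∃ i j, ∃ c : K, i ≠ j ∧ u (b j) = b j + c • b i ∧ (∀ l, l ≠ j → u (b l) = b l) ∧
      ((-(x i - x j) : ℝ) : WithTop ℝ) ≤ v c}

/-- The enlarged Bruhat-Tits building of `GL(W)`. -/
abbrev LinearBuilding (v : AddValuation K (WithTop ℝ)) (b : Module.Basis (Fin n) K W) : Type _ :=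
  GlueSpace (linearMove v b) (linearUnip v b)

/-- `j` is an affine equivariant bijection from the enlarged building onto the set of lattice
functions. -/
def IsLinearIdent {v : AddValuation K (WithTop ℝ)} (b : Module.Basis (Fin n) K W)
    (j : LinearBuilding v b → LatticeFunction v W) : Prop :=
  Function.Bijective j ∧
  (∀ (g : W ≃ₗ[K] W) (p : LinearBuilding v b) (r : ℝ) (y : W),
    g y ∈ (j (g • p)).toFun r ↔ y ∈ (j p).toFun r) ∧
  ∀ (g : W ≃ₗ[K] W) (x y : Fin n → ℝ), ∀ t ∈ Set.Icc (0 : ℝ) 1,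
    IsBarycenter t (j (GlueSpace.mk _ _ g x)) (j (GlueSpace.mk _ _ g y))
      (j (GlueSpace.mk _ _ g (t • x + (1 - t) • y)))

end Linear

/-! ### The decomposition of `V` given by `F[β]` -/

section Blocks

variable {F : Type*} [Field F] {V : Type*} [AddCommGroup V] [Module F V]
  {β : Module.End F V} {ι : Type*} [DecidableEq ι] {E : ι → Type*}
  [∀ i, Field (E i)] [∀ i, Algebra F (E i)]
  (e : Algebra.adjoin F {β} ≃ₐ[F] (∀ i, E i))

/-- The inclusion of the summand `E i` of `F[β]` into `End_F(V)`. -/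
def emb (i : ι) (x : E i) : Module.End F V := (e.symm (Pi.single i x)).1

theorem emb_mul (i : ι) (x y : E i) : emb e i (x * y) = emb e i x * emb e i y := by
  unfold emb
  rw [Pi.single_mul, map_mul]
  rfl

theorem emb_add (i : ι) (x y : E i) : emb e i (x + y) = emb e i x + emb e i y := by
  unfold emb
  rw [Pi.single_add, map_add]
  rfl

theorem emb_zero (i : ι) : emb e i 0 = 0 := by
  unfold emb
  rw [Pi.single_zero, map_zero]
  rfl

/-- `V_i`, the image of the idempotent `1_i` of `F[β]`. -/
def block (i : ι) : Submodule F V := LinearMap.range (emb e i 1)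

theorem emb_one_apply {i : ι} {x : V} (hx : x ∈ block e i) : emb e i 1 x = x := by
  obtain ⟨y, rfl⟩ := hx
  rw [← Module.End.mul_apply, ← emb_mul, one_mul]

/-- `V_i` is a vector space over `E i`. -/
instance blockModule (i : ι) : Module (E i) (block e i) where
  smul x u := ⟨emb e i x u.1, emb e i x u.1, by
    rw [← Module.End.mul_apply, ← emb_mul, one_mul]⟩
  one_smul u := Subtype.ext (emb_one_apply e u.2)
  mul_smul x y u := Subtype.ext (by
    change emb e i (x * y) u.1 = emb e i x (emb e i y u.1)
    rw [emb_mul]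
    rfl)
  smul_zero x := Subtype.ext (map_zero (emb e i x))
  smul_add x u u' := Subtype.ext (map_add (emb e i x) u.1 u'.1)
  add_smul x y u := Subtype.ext (by
    change emb e i (x + y) u.1 = emb e i x u.1 + emb e i y u.1
    rw [emb_add]
    rfl)
  zero_smul u := Subtype.ext (by
    change emb e i 0 u.1 = 0
    rw [emb_zero]
    rfl)

/-- The component of `x` in `V_i`. -/
def comp (i : ι) (x : V) : block e i := ⟨emb e i 1 x, x, rfl⟩

/-- `L = ⨁ᵢ Λᵢ`, i.e. `L r = ⨁ᵢ Λᵢ r` for all `r`. -/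
def IsDirectSum {v : AddValuation F (WithTop ℝ)} {vE : ∀ i, AddValuation (E i) (WithTop ℝ)}
    (Λ : ∀ i, LatticeFunction (vE i) (block e i)) (L : LatticeFunction v V) : Prop :=
  ∀ (r : ℝ) (x : V), x ∈ L.toFun r ↔ ∀ i, comp e i x ∈ (Λ i).toFun r

/-- For lattice functions `L` in `V_i` and `M` in `V_k` (`k = -i`):
`M r = {x ∈ V_k | h (x, L((-r)+)) ⊆ 𝔭_F}` for all `r`. -/
def IsDualPair {τ : F →+* F} (v : AddValuation F (WithTop ℝ))
    {vE : ∀ i, AddValuation (E i) (WithTop ℝ)} (h : V →ₛₗ[τ] V →ₗ[F] F) {i k : ι}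
    (L : LatticeFunction (vE i) (block e i)) (M : LatticeFunction (vE k) (block e k)) : Prop :=
  ∀ (r : ℝ) (x : block e k), x ∈ M.toFun r ↔
    ∀ s > -r, ∀ y ∈ L.toFun s, 0 < v (h (x : V) (y : V))

/-- The forms `h_i` attached to `h`: `h_i` is an `ε`-hermitian form on `V_i` relative to the
automorphism `τE` of `E i`, and `h = λ ∘ h_i` on `V_i`, for a nonzero `F`-linear form
`λ : E i → F` which commutes with the involutions and is normalized as follows: let `Eᵒ` be
the fixed field of `τE` and `λᵒ : Eᵒ → Fₒ` the form with
`λᵒ ∘ Tr_{E/Eᵒ} = Tr_{F/Fₒ} ∘ λ`; then `{a ∈ Eᵒ | λᵒ (a 𝔬_{Eᵒ}) ⊆ 𝔭_{Fₒ}} = 𝔭_{Eᵒ}`. -/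
def IsAdmissibleForm (Fo : Type*) [Field Fo] [Algebra Fo F] (ε : ℤˣ) {τ : F →+* F}
    (v : AddValuation F (WithTop ℝ)) (h : V →ₛₗ[τ] V →ₗ[F] F) (i : ι)
    (vEi : AddValuation (E i) (WithTop ℝ)) (τE : E i →+* E i)
    (hi : block e i →ₛₗ[τE] block e i →ₗ[E i] E i) : Prop :=
  IsEpsHermitian ε hi ∧
  ∃ lam : E i →ₗ[F] F, lam ≠ 0 ∧ (∀ a, lam (τE a) = τ (lam a)) ∧
    (∃ lamo : τE.eqLocusField (RingHom.id (E i)) → Fo,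
      (∀ a : E i, lamo (Algebra.trace (τE.eqLocusField (RingHom.id (E i))) (E i) a) =
        Algebra.trace Fo F (lam a)) ∧
      ∀ a : τE.eqLocusField (RingHom.id (E i)),
        (∀ b : τE.eqLocusField (RingHom.id (E i)), 0 ≤ vEi b →
          0 < v (algebraMap Fo F (lamo (a * b)))) ↔ 0 < vEi a) ∧
    ∀ x y : block e i, h (x : V) (y : V) = lam (hi x y)

/-- `I¹_β`: the product of the buildings of the `H_i`; `i` runs over the indices with `-i = i`
(classical groups over `E i`) and over `J₊` (general linear groups over `E i`). -/
abbrev ProductBuilding (vE : ∀ i, AddValuation (E i) (WithTop ℝ)) (neg : ι → ι) (Jp : Set ι)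
    {τE : ∀ i : {i // neg i = i}, E i.1 →+* E i.1}
    {hE : ∀ i : {i // neg i = i}, block e i.1 →ₛₗ[τE i] block e i.1 →ₗ[E i.1] E i.1}
    (wE : ∀ i, WittFrame (hE i)) {n : Jp → ℕ}
    (bE : ∀ i : Jp, Module.Basis (Fin (n i)) (E i.1) (block e i.1)) : Type _ :=
  (∀ i : {i // neg i = i}, ClassicalBuilding (vE i.1) (wE i)) ×
    (∀ i : Jp, LinearBuilding (vE i.1) (bE i))

/-- The set of the maps `j_β : I¹_β → I` attached to the forms `h'` and `h'_i`, as the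
identifications for the linear factors vary. The buildings themselves are fixed; they
are built from Witt decompositions for `h` and the `h_i`. The point `j_β x` corresponds to the
lattice function `⨁ᵢ Λᵢ`, where `Λᵢ` corresponds to `xᵢ` if `-i = i` or `i ∈ J₊`, and
`Λ₋ᵢ` is the dual of `Λᵢ` with respect to `h'` for `i ∈ J₊`. -/
def jSet {v : AddValuation F (WithTop ℝ)} (vE : ∀ i, AddValuation (E i) (WithTop ℝ))
    (neg : ι → ι) (Jp : Set ι)
    {τ : F →+* F} {h : V →ₛₗ[τ] V →ₗ[F] F} (w : WittFrame h)
    {τE : ∀ i : {i // neg i = i}, E i.1 →+* E i.1}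
    {hE : ∀ i : {i // neg i = i}, block e i.1 →ₛₗ[τE i] block e i.1 →ₗ[E i.1] E i.1}
    (wE : ∀ i, WittFrame (hE i)) {n : Jp → ℕ}
    (bE : ∀ i : Jp, Module.Basis (Fin (n i)) (E i.1) (block e i.1))
    (h' : V →ₛₗ[τ] V →ₗ[F] F)
    (hE' : ∀ i : {i // neg i = i}, block e i.1 →ₛₗ[τE i] block e i.1 →ₗ[E i.1] E i.1) :
    Set (ProductBuilding e vE neg Jp wE bE → ClassicalBuilding v w) :=
  {f | ∃ (j : ClassicalBuilding v w → LatticeFunction v V)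
        (jo : ∀ i : {i // neg i = i}, ClassicalBuilding (vE i.1) (wE i) →
          LatticeFunction (vE i.1) (block e i.1))
        (jp : ∀ i : Jp, LinearBuilding (vE i.1) (bE i) →
          LatticeFunction (vE i.1) (block e i.1)),
      IsClassicalIdent w h' j ∧ (∀ i, IsClassicalIdent (wE i) (hE' i) (jo i)) ∧
      (∀ i, IsLinearIdent (bE i) (jp i)) ∧
      ∀ x, ∃ Λ : ∀ i, LatticeFunction (vE i) (block e i),
        (∀ i : {i // neg i = i}, Λ i.1 = jo i (x.1 i)) ∧
        (∀ i : Jp, Λ i.1 = jp i (x.2 i)) ∧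
        (∀ i : Jp, IsDualPair e v h' (Λ i.1) (Λ (neg i.1))) ∧
        IsDirectSum e Λ (j (f x))}

/-- `f` is equivariant for the centralizer `H` of `β` in the isometry group of `h`: each `g ∈ H`
restricts to an isometry of `(V_i, h_i)` if `-i = i` and to an `E i`-linear automorphism of `V_i` if
`i ∈ J₊`; it acts on `I¹_β` through these restrictions. -/
def IsCentralizerEquivariant {v : AddValuation F (WithTop ℝ)}
    {vE : ∀ i, AddValuation (E i) (WithTop ℝ)} {neg : ι → ι} {Jp : Set ι}
    {τ : F →+* F} {h : V →ₛₗ[τ] V →ₗ[F] F} {w : WittFrame h}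
    {τE : ∀ i : {i // neg i = i}, E i.1 →+* E i.1}
    {hE : ∀ i : {i // neg i = i}, block e i.1 →ₛₗ[τE i] block e i.1 →ₗ[E i.1] E i.1}
    {wE : ∀ i, WittFrame (hE i)} {n : Jp → ℕ}
    {bE : ∀ i : Jp, Module.Basis (Fin (n i)) (E i.1) (block e i.1)}
    (f : ProductBuilding e vE neg Jp wE bE → ClassicalBuilding v w) : Prop :=
  ∀ g : isometryGroup h, (∀ x, g.1 (β x) = β (g.1 x)) →
    ∃ (go : ∀ i : {i // neg i = i}, isometryGroup (hE i))
      (gp : ∀ i : Jp, block e i.1 ≃ₗ[E i.1] block e i.1),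
      (∀ (i : {i // neg i = i}) (x : block e i.1), (((go i).1 x : block e i.1) : V) = g.1 (x : V)) ∧
      (∀ (i : Jp) (x : block e i.1), ((gp i x : block e i.1) : V) = g.1 (x : V)) ∧
      ∀ x : ProductBuilding e vE neg Jp wE bE,
        f (fun i => go i • x.1 i, fun i => gp i • x.2 i) = g • f x

end Blocks

end ClassicalBuildings

end

/-!
The maps `j_β` are described by lattice functions, so the theorem reduces to two facts about a
single building and to the linear algebra of the decomposition of `V` into blocks.

*Existence and uniqueness of the identifications.* Both buildings are quotients of `G × A`, with `A`
the standard apartment, and a map to lattice functions is given by a compatible family of standard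
lattice functions on `A` (`GlueSpace.exists_map`). For `GL(W)` these are the functions split by the
given basis; injectivity is Gaussian elimination, surjectivity is the existence of splitting bases
(`exists_isLinearIdent`). For a hermitian form, the standard functions are split by the isotropic
vectors of the Witt decomposition and carry the norm `z ↦ v (h z z) / 2` on the anisotropic part;
this is a norm by the Cauchy-Schwarz inequality, a consequence of Hensel's lemma as `2` is a unit.
Injectivity is a reduction of hyperbolic families to the lines of the frame by Eichler
transformations from `U_x` (`exists_hyperbolic_reduction`), which for the trivial valuation also
yields the conjugacy of Witt decompositions. Surjectivity holds since a self-dual lattice function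
is standard for a hyperbolic family which is maximal among those whose dual vectors lie in opposite
steps (`exists_isClassicalIdent`).

For uniqueness, the norm of an isotropic frame vector at a point of the apartment differs from its
standard value by a function which is concave, as the map is affine, and periodic, by equivariance
under the torus, hence constant. The constants for `e_i` and `e_{-i}` agree by the reflection which
exchanges them, and self-duality excludes negative ones. A self-dual lattice function in which the
frame vectors have at least their standard norms is the standard one (`IsClassicalIdent.unique`).

*The blocks.* The involution exchanges the idempotents `1_i` and `1_{-i}`, so `V_i` is orthogonal to
all `V_k` with `k ≠ -i`, and a direct sum of lattice functions is self-dual as soon as the summands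
are dual in pairs. For `-i = i` the normalization of `λ_i` says that self-duality for `h_i` over
`E i` is self-duality for `h` over `F` (`forall_pos_form_iff`, where traces are controlled since the
degrees are at most `2`). This gives the maps `j_β`; they are injective since the summands of a
lattice function are determined by the sum, and equivariant since the centralizer of `β` preserves
the blocks and the forms `h_i`.

*Dependence on `σ`.* Two forms with the same adjoint involution differ by a scalar `μ`, and the
forms on the blocks then differ by scalars of the same valuation as `μ`, because normalized linear
forms differ by units. Hence all the lattice functions are shifted by the same constant `v(μ) / 2`,
which does not affect the maps between the buildings (`jSet_subset_of_smul`).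
-/

open scoped ValuativeRel

noncomputable section

namespace ClassicalBuildings

/-! ### Real-valued additive valuations -/

section Values

variable {K : Type*} [Field K] {v : AddValuation K (WithTop ℝ)}

theorem coe_val {x : K} (hx : x ≠ 0) : ((val v x : ℝ) : WithTop ℝ) = v x := by
  have h : v x ≠ ⊤ := (AddValuation.ne_top_iff v).2 hx
  obtain ⟨t, ht⟩ := WithTop.ne_top_iff_exists.1 h
  simp [val, ← ht]

theorem val_eq_of {x : K} {t : ℝ} (h : v x = (t : WithTop ℝ)) : val v x = t := by
  simp [val, h]

theorem ne_zero_of_coe {x : K} {t : ℝ} (h : v x = (t : WithTop ℝ)) : x ≠ 0 := by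
  rintro rfl
  rw [v.map_zero] at h
  exact WithTop.top_ne_coe h

theorem val_mul {x y : K} (hx : x ≠ 0) (hy : y ≠ 0) : val v (x * y) = val v x + val v y := by
  apply val_eq_of
  rw [v.map_mul, WithTop.coe_add, coe_val hx, coe_val hy]

theorem val_one : val v (1 : K) = 0 := val_eq_of (by rw [v.map_one]; rfl)

theorem val_inv {x : K} (hx : x ≠ 0) : val v x⁻¹ = -val v x := by
  have h := val_mul (v := v) hx (inv_ne_zero hx)
  rw [mul_inv_cancel₀ hx, val_one] at h
  linarith

theorem le_iff_val {r : ℝ} {x : K} (hx : x ≠ 0) : (r : WithTop ℝ) ≤ v x ↔ r ≤ val v x := by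
  rw [← coe_val hx, WithTop.coe_le_coe]

theorem lt_iff_val {r : ℝ} {x : K} (hx : x ≠ 0) : (r : WithTop ℝ) < v x ↔ r < val v x := by
  rw [← coe_val hx, WithTop.coe_lt_coe]

theorem le_zero_val (r : ℝ) : (r : WithTop ℝ) ≤ v (0 : K) := by
  rw [v.map_zero]; exact le_top

theorem le_mul_val {r s : ℝ} {x y : K} (hx : (r : WithTop ℝ) ≤ v x) (hy : (s : WithTop ℝ) ≤ v y) :
    ((r + s : ℝ) : WithTop ℝ) ≤ v (x * y) := by
  rw [v.map_mul, WithTop.coe_add]; exact add_le_add hx hy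

theorem le_of_le_val {r s : ℝ} {x : K} (h : s ≤ r) (hx : (r : WithTop ℝ) ≤ v x) :
    (s : WithTop ℝ) ≤ v x := le_trans (WithTop.coe_le_coe.2 h) hx

theorem pos_of_le_val {r : ℝ} {x : K} (h : 0 < r) (hx : (r : WithTop ℝ) ≤ v x) : 0 < v x :=
  lt_of_lt_of_le (by exact_mod_cast h) hx

theorem pos_iff_val {x : K} (hx : x ≠ 0) : 0 < v x ↔ 0 < val v x := lt_iff_val (r := 0) hx

theorem map_neg_one : v (-1 : K) = ((0 : ℝ) : WithTop ℝ) := by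
  rw [v.map_neg, v.map_one]; rfl

theorem val_pow {x : K} (hx : x ≠ 0) (n : ℕ) : val v (x ^ n) = n * val v x := by
  induction n with
  | zero => simp [val_one]
  | succ n ih => rw [pow_succ, val_mul (pow_ne_zero _ hx) hx, ih]; push_cast; ring

theorem val_zpow {x : K} (hx : x ≠ 0) (n : ℤ) : val v (x ^ n) = n * val v x := by
  cases n with
  | ofNat n => simpa using val_pow hx n
  | negSucc n =>
    rw [zpow_negSucc, val_inv (pow_ne_zero _ hx), val_pow hx]; push_cast; ring

variable (v)

/-- The value group of `v` is a nonzero subgroup of some `δ ℤ`. -/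
structure DiscreteValues : Prop where
  values : ∃ δ : ℝ, 0 < δ ∧ ∀ x : K, x ≠ 0 → ∃ m : ℤ, val v x = m * δ
  nontrivial : ∃ π : K, π ≠ 0 ∧ 0 < val v π

/-- Completeness, stated for sequences whose steps have linearly growing valuations. -/
def CompleteVal : Prop :=
  ∀ δ : ℝ, 0 < δ → ∀ a : ℕ → K, (∀ n : ℕ, ((n * δ : ℝ) : WithTop ℝ) ≤ v (a (n + 1) - a n)) →
    ∃ l, ∀ n : ℕ, ((n * δ : ℝ) : WithTop ℝ) ≤ v (l - a n)

variable {v}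

theorem DiscreteValues.exists_scalar (hd : DiscreteValues v) (M : ℝ) :
    ∃ c : K, c ≠ 0 ∧ M ≤ val v c := by
  obtain ⟨π, h0, hπ⟩ := hd.nontrivial
  obtain ⟨n, hn⟩ := exists_nat_ge (M / val v π)
  refine ⟨π ^ n, pow_ne_zero _ h0, ?_⟩
  rw [val_pow h0]
  rwa [div_le_iff₀ hπ] at hn

/-- Among the scalars of valuation at least `s` there is one of minimal valuation. -/
theorem DiscreteValues.exists_min (hd : DiscreteValues v) (s : ℝ) :
    ∃ c : K, c ≠ 0 ∧ s ≤ val v c ∧ ∀ d : K, d ≠ 0 → s ≤ val v d → val v c ≤ val v d := by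
  obtain ⟨δ, hδ, hval⟩ := hd.values
  choose! m hm using hval
  let S : Set ℤ := {k | ∃ c : K, c ≠ 0 ∧ s ≤ val v c ∧ m c = k}
  obtain ⟨c0, hc0, hs0⟩ := hd.exists_scalar s
  have hne : S.Nonempty := ⟨m c0, c0, hc0, hs0, rfl⟩
  have hbd : ∀ k : ℤ, k ∈ S → ⌊s / δ⌋ ≤ k := by
    rintro k ⟨c, hc, hsc, rfl⟩
    rw [hm c hc] at hsc
    have : s / δ ≤ m c := by rwa [div_le_iff₀ hδ]
    exact Int.floor_le_iff.2 (by linarith)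
  obtain ⟨k, ⟨c, hc, hsc, rfl⟩, hk⟩ := Int.exists_least_of_bdd ⟨_, hbd⟩ hne
  refine ⟨c, hc, hsc, fun d hd' hsd => ?_⟩
  rw [hm c hc, hm d hd']
  have := hk (m d) ⟨d, hd', hsd, rfl⟩
  have : (m c : ℝ) ≤ m d := by exact_mod_cast this
  nlinarith

end Values

/-! ### Filtrations and splitting bases -/

section Filtration

variable {K : Type*} [Field K] (v : AddValuation K (WithTop ℝ))
  {W : Type*} [AddCommGroup W] [Module K W]

/-- A decreasing, left-continuous, exhaustive filtration of `W` by subgroups which is compatible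
with the valuation. A lattice function is such a filtration whose steps are lattices. -/
structure IsFiltration (P : ℝ → W → Prop) : Prop where
  zero : ∀ r, P r 0
  add : ∀ {r x y}, P r x → P r y → P r (x + y)
  smul : ∀ {c : K} {t r : ℝ} {x}, (t : WithTop ℝ) ≤ v c → P r x → P (r + t) (c • x)
  anti : ∀ {r s x}, s ≤ r → P r x → P s x
  left : ∀ {r x}, (∀ s < r, P s x) → P r x
  exh : ∀ x, ∃ r, P r x

/-- Linear forms are bounded with respect to the filtration. -/
def BoundedForms (P : ℝ → W → Prop) : Prop :=
  ∀ φ : W →ₗ[K] K, ∃ M : ℝ, ∀ r x, P r x → ((r - M : ℝ) : WithTop ℝ) ≤ v (φ x)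

/-- No nonzero vector lies in all the steps of the filtration. -/
def Separated (P : ℝ → W → Prop) : Prop := ∀ x, x ≠ 0 → ∃ r, ¬ P r x

/-- The norm of a nonzero vector: the last step of the filtration which contains it. -/
def nrm (P : ℝ → W → Prop) (x : W) : ℝ := sSup {r | P r x}

variable {v} {P : ℝ → W → Prop}

theorem IsFiltration.neg (hP : IsFiltration v P) {r : ℝ} {x : W} (hx : P r x) : P r (-x) := by
  have := hP.smul (c := -1) (t := 0) map_neg_one.ge hx
  simpa using this

theorem IsFiltration.sub (hP : IsFiltration v P) {r : ℝ} {x y : W} (hx : P r x) (hy : P r y) :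
    P r (x - y) := by
  rw [sub_eq_add_neg]; exact hP.add hx (hP.neg hy)

theorem IsFiltration.sum (hP : IsFiltration v P) {ι : Type*} (s : Finset ι) (f : ι → W) {r : ℝ}
    (h : ∀ i ∈ s, P r (f i)) : P r (∑ i ∈ s, f i) := by
  classical
  induction s using Finset.induction_on with
  | empty => simpa using hP.zero r
  | insert a s ha ih =>
    rw [Finset.sum_insert ha]
    exact hP.add (h a (by simp)) (ih fun i hi => h i (by simp [hi]))

theorem IsFiltration.smul_iff (hP : IsFiltration v P) {c : K} (hc : c ≠ 0) {r : ℝ} {x : W} :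
    P r (c • x) ↔ P (r - val v c) x := by
  constructor
  · intro h
    have := hP.smul (c := c⁻¹) (t := val v c⁻¹) (coe_val (inv_ne_zero hc)).le h
    rwa [smul_smul, inv_mul_cancel₀ hc, one_smul, val_inv hc, ← sub_eq_add_neg] at this
  · intro h
    simpa using hP.smul (coe_val hc).le h

theorem separated_of_boundedForms (hb : BoundedForms v P) : Separated P := by
  intro x hx
  have : ∃ φ : W →ₗ[K] K, φ x ≠ 0 := by
    by_contra! h
    exact hx ((Module.forall_dual_apply_eq_zero_iff K x).1 h)
  obtain ⟨φ, hφ⟩ := this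
  obtain ⟨M, hM⟩ := hb φ
  refine ⟨val v (φ x) + M + 1, fun h => ?_⟩
  have := (le_iff_val hφ).1 (hM _ _ h)
  linarith

theorem IsFiltration.le_nrm_iff (hP : IsFiltration v P) (hs : Separated P) {x : W} (hx : x ≠ 0)
    {r : ℝ} : P r x ↔ r ≤ nrm P x := by
  obtain ⟨r0, hr0⟩ := hs x hx
  have hbdd : BddAbove {r | P r x} :=
    ⟨r0, fun r hr => le_of_lt (lt_of_not_ge fun h => hr0 (hP.anti h hr))⟩
  constructor
  · exact fun h => le_csSup hbdd h
  · intro h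
    refine hP.left fun s hsr => ?_
    obtain ⟨t, ht, hst⟩ := exists_lt_of_lt_csSup (hP.exh x) (lt_of_lt_of_le hsr h)
    exact hP.anti hst.le ht

theorem IsFiltration.nrm_mem (hP : IsFiltration v P) (hs : Separated P) {x : W} (hx : x ≠ 0) :
    P (nrm P x) x := (hP.le_nrm_iff hs hx).2 le_rfl

theorem IsFiltration.nrm_smul (hP : IsFiltration v P) (hs : Separated P) {x : W} (hx : x ≠ 0)
    {c : K} (hc : c ≠ 0) : nrm P (c • x) = nrm P x + val v c := by
  have h : ∀ r, r ≤ nrm P (c • x) ↔ r ≤ nrm P x + val v c := fun r => by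
    rw [← hP.le_nrm_iff hs (smul_ne_zero hc hx), hP.smul_iff hc, hP.le_nrm_iff hs hx,
      sub_le_iff_le_add]
  exact le_antisymm ((h _).1 le_rfl) ((h _).2 le_rfl)

/-- Vectors whose norms are distinct modulo the value group are linearly independent. -/
theorem IsFiltration.linearIndependent (hP : IsFiltration v P) (hs : Separated P) {ι : Type*}
    (w : ι → W) (h0 : ∀ i, w i ≠ 0)
    (hw : ∀ i j, i ≠ j → ∀ c : K, c ≠ 0 → nrm P (w i) ≠ nrm P (w j) + val v c) :
    LinearIndependent K w := by
  classical
  rw [linearIndependent_iff']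
  intro s g hg
  by_contra! hne
  obtain ⟨i1, hi1, hgi1⟩ := hne
  let T := s.filter fun i => g i ≠ 0
  have hT : ∑ i ∈ T, g i • w i = 0 := by
    rw [Finset.sum_filter_of_ne, hg]
    intro i _ h h'
    exact h (by rw [h', zero_smul])
  obtain ⟨i0, hi0, hmin⟩ := T.exists_min_image (fun i => nrm P (g i • w i))
    ⟨i1, by simp [T, hi1, hgi1]⟩
  have hg0 : ∀ i ∈ T, g i ≠ 0 := fun i hi => (Finset.mem_filter.1 hi).2
  have hlt : ∀ i ∈ T.erase i0, nrm P (g i0 • w i0) < nrm P (g i • w i) := by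
    intro i hi
    obtain ⟨hne, hi⟩ := Finset.mem_erase.1 hi
    refine lt_of_le_of_ne (hmin i hi) fun heq => ?_
    rw [hP.nrm_smul hs (h0 _) (hg0 _ hi0), hP.nrm_smul hs (h0 _) (hg0 _ hi)] at heq
    refine hw i0 i hne.symm (g i * (g i0)⁻¹) (mul_ne_zero (hg0 _ hi) (inv_ne_zero (hg0 _ hi0))) ?_
    rw [val_mul (hg0 _ hi) (inv_ne_zero (hg0 _ hi0)), val_inv (hg0 _ hi0)]
    linarith
  have hsum : g i0 • w i0 = -∑ i ∈ T.erase i0, g i • w i := by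
    rw [← Finset.add_sum_erase T _ hi0] at hT
    exact eq_neg_of_add_eq_zero_left hT
  have hne0 : g i0 • w i0 ≠ 0 := smul_ne_zero (hg0 _ hi0) (h0 _)
  have hE : (T.erase i0).Nonempty := by
    rw [Finset.nonempty_iff_ne_empty]
    intro h
    rw [h] at hsum
    exact hne0 (by simpa using hsum)
  obtain ⟨i2, hi2, hmin2⟩ := (T.erase i0).exists_min_image (fun i => nrm P (g i • w i)) hE
  have : P (nrm P (g i2 • w i2)) (g i0 • w i0) := by
    rw [hsum]
    refine hP.neg (hP.sum _ _ fun i hi => ?_)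
    refine (hP.le_nrm_iff hs (smul_ne_zero (hg0 _ (Finset.mem_of_mem_erase hi)) (h0 _))).2
      (hmin2 i hi)
  exact absurd ((hP.le_nrm_iff hs hne0).1 this) (not_le.2 (hlt i2 hi2))

/-- On the affine hyperplane `φ = 1` the norm attains its maximum: its values there are bounded,
and lie in finitely many cosets of a discrete subgroup. -/
theorem IsFiltration.exists_max [FiniteDimensional K W] (hd : DiscreteValues v)
    (hP : IsFiltration v P) (hb : BoundedForms v P) (φ : W →ₗ[K] K) (hφ : φ ≠ 0) :
    ∃ x0, φ x0 = 1 ∧ ∀ x, φ x = 1 → nrm P x ≤ nrm P x0 := by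
  have hs := separated_of_boundedForms hb
  obtain ⟨M, hM⟩ := hb φ
  have hne0 : ∀ x, φ x = 1 → x ≠ 0 := by
    rintro x hx rfl
    simp at hx
  let S : Set ℝ := {r | ∃ x, φ x = 1 ∧ nrm P x = r}
  have hSne : S.Nonempty := by
    obtain ⟨x, hx⟩ : ∃ x, φ x ≠ 0 := by
      by_contra! h
      exact hφ (LinearMap.ext h)
    exact ⟨_, (φ x)⁻¹ • x, by simp [hx], rfl⟩
  have hSb : BddAbove S := by
    refine ⟨M, ?_⟩
    rintro _ ⟨x, hx, rfl⟩
    have := hM _ _ (hP.nrm_mem hs (hne0 x hx))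
    rw [hx, le_iff_val one_ne_zero, val_one] at this
    linarith
  have hlub := isLUB_csSup hSne hSb
  by_cases hmem : sSup S ∈ S
  · obtain ⟨x0, hx0, hx0'⟩ := hmem
    exact ⟨x0, hx0, fun x hx => hx0' ▸ hlub.1 ⟨x, hx, rfl⟩⟩
  · exfalso
    obtain ⟨δ, hδ, hval⟩ := hd.values
    obtain ⟨u, hmono, hlt, htend, hu⟩ := hlub.exists_seq_strictMono_tendsto_of_notMem hmem hSne
    obtain ⟨N, hN⟩ :=
      (htend.eventually (lt_mem_nhds (show sSup S - δ < sSup S by linarith))).exists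
    choose w hw1 hw2 using hu
    -- infinitely many norms in an interval of length `δ` are distinct modulo `δ ℤ`
    have hli : LinearIndependent K fun n : ℕ => w (N + n) := by
      refine hP.linearIndependent hs _ (fun i => hne0 _ (hw1 _)) fun i j hij c hc h => ?_
      obtain ⟨m, hm⟩ := hval c hc
      rw [hw2, hw2, hm] at h
      have hbound : ∀ k, sSup S - δ < u (N + k) ∧ u (N + k) < sSup S := fun k =>
        ⟨lt_of_lt_of_le hN (hmono.monotone (Nat.le_add_right _ _)), hlt _⟩
      have h1 := hbound i
      have h2 := hbound j
      have hm1 : (m : ℝ) < 1 := by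
        by_contra! hc
        nlinarith
      have hm2 : (-1 : ℝ) < m := by
        by_contra! hc
        nlinarith
      have hm3 : m < 1 := by exact_mod_cast hm1
      have hm4 : -1 < m := by exact_mod_cast hm2
      obtain rfl : m = 0 := by omega
      refine hij ?_
      have := hmono.injective (a₁ := N + i) (a₂ := N + j) (by simpa using h)
      omega
    exact Set.infinite_univ (α := ℕ) (Set.finite_univ_iff.2 (hli.finite))

/-- A filtration with bounded linear forms has a splitting basis. -/
theorem IsFiltration.exists_split (hd : DiscreteValues v) : ∀ (n : ℕ) {W : Type*} [AddCommGroup W]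
    [Module K W] [FiniteDimensional K W] {P : ℝ → W → Prop}, Module.finrank K W = n →
    IsFiltration v P → BoundedForms v P →
    ∃ (b : Module.Basis (Fin n) K W) (l : Fin n → ℝ),
      ∀ r x, P r x ↔ ∀ k, ((r + l k : ℝ) : WithTop ℝ) ≤ v (b.repr x k) := by
  intro n
  induction n with
  | zero =>
    intro W _ _ _ P hn hP hb
    have := Module.finrank_zero_iff.1 hn
    refine ⟨Module.Basis.empty W, fun _ => 0, fun r x => ?_⟩
    rw [Subsingleton.elim x 0]
    simp [hP.zero]
  | succ n ih =>
    intro W _ _ _ P hn hP hb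
    have hs := separated_of_boundedForms hb
    have : Nontrivial W := Module.nontrivial_of_finrank_pos (R := K) (by omega)
    obtain ⟨x1, hx1⟩ := exists_ne (0 : W)
    obtain ⟨φ, hφ⟩ : ∃ φ : W →ₗ[K] K, φ ≠ 0 := by
      by_contra! h
      exact hx1 ((Module.forall_dual_apply_eq_zero_iff K x1).1 fun f => by rw [h f]; rfl)
    obtain ⟨x0, hx0, hmax⟩ := hP.exists_max hd hb φ hφ
    have hx00 : x0 ≠ 0 := by
      rintro rfl
      simp at hx0
    let H := LinearMap.ker φ
    have hH : Module.finrank K H = n := by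
      have h1 := LinearMap.finrank_range_add_finrank_ker φ
      have h2 : LinearMap.range φ = ⊤ := LinearMap.range_eq_top.2 fun c => ⟨c • x0, by simp [hx0]⟩
      rw [h2, finrank_top, Module.finrank_self] at h1
      change Module.finrank K (LinearMap.ker φ) = n
      omega
    have hPH : IsFiltration v fun r (y : H) => P r y :=
      { zero := fun r => hP.zero r
        add := fun h1 h2 => hP.add h1 h2
        smul := fun h1 h2 => hP.smul h1 h2
        anti := fun h1 h2 => hP.anti h1 h2
        left := fun h => hP.left h
        exh := fun x => hP.exh x }
    have hbH : BoundedForms v fun r (y : H) => P r y := by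
      intro ψ
      obtain ⟨ψ', hψ'⟩ := LinearMap.exists_extend ψ
      obtain ⟨M, hM⟩ := hb ψ'
      refine ⟨M, fun r x hx => ?_⟩
      have := hM r x hx
      rwa [show ψ' x = ψ x by rw [← hψ']; rfl] at this
    obtain ⟨b', l', hb'⟩ := ih hH hPH hbH
    have hφH : ∀ y : H, φ y = 0 := fun y => y.2
    let b : Module.Basis (Fin (n + 1)) K W := Module.Basis.mkFinCons x0 b'
      (fun c x hx h => by
        have := congrArg φ h
        rw [map_add, map_smul, hx0, hφH ⟨x, hx⟩, map_zero] at this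
        simpa using this)
      (fun z => ⟨-φ z, by simp [H, hx0]⟩)
    have hbc : ⇑b = Fin.cons x0 (Subtype.val ∘ b') := Module.Basis.coe_mkFinCons _ _ _ _
    -- the coordinates of `c x₀ + y`
    have hrepr : ∀ (c : K) (y : H), ⇑(b.repr (c • x0 + y)) = Fin.cons c (b'.repr y) := by
      intro c y
      have h1 : c • x0 + (y : W) = ∑ i, (Fin.cons c (b'.repr y) : Fin (n + 1) → K) i • b i := by
        rw [Fin.sum_univ_succ, hbc]
        simp only [Fin.cons_zero, Fin.cons_succ, Function.comp]
        congr 1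
        have h2 := congrArg H.subtype (b'.sum_repr y)
        rw [map_sum] at h2
        exact h2.symm
      rw [h1, Module.Basis.repr_sum_self]
    have hdec : ∀ x : W, ∃ y : H, x = φ x • x0 + y := fun x =>
      ⟨⟨x - φ x • x0, by simp [H, hx0]⟩, by simp⟩
    -- maximality of `x₀` makes the line through it an orthogonal complement of the hyperplane
    have hsplit : ∀ r x, P r x → P r (φ x • x0) := by
      intro r x hx
      by_cases hc : φ x = 0
      · rw [hc, zero_smul]; exact hP.zero r
      have hx' : x ≠ 0 := by
        rintro rfl
        simp at hc
      rw [hP.smul_iff hc, hP.le_nrm_iff hs hx00]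
      refine le_trans ?_ (hmax ((φ x)⁻¹ • x) (by simp [hc]))
      rw [hP.nrm_smul hs hx' (inv_ne_zero hc), val_inv hc]
      have := (hP.le_nrm_iff hs hx').1 hx
      linarith
    refine ⟨b, Fin.cons (-nrm P x0) l', fun r x => ?_⟩
    obtain ⟨y, hy⟩ := hdec x
    have key : P r x ↔ P r (φ x • x0) ∧ P r (y : W) := by
      constructor
      · intro h
        refine ⟨hsplit r x h, ?_⟩
        have := hP.sub h (hsplit r x h)
        rwa [show x - φ x • x0 = y by rw [hy]; simp [hx0, hφH]] at this
      · rintro ⟨h1, h2⟩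
        rw [hy]; exact hP.add h1 h2
    have h1 : P r (φ x • x0) ↔ ((r + -nrm P x0 : ℝ) : WithTop ℝ) ≤ v (φ x) := by
      by_cases hc : φ x = 0
      · rw [hc, zero_smul]
        exact ⟨fun _ => le_zero_val _, fun _ => hP.zero r⟩
      rw [hP.smul_iff hc, hP.le_nrm_iff hs hx00, le_iff_val hc]
      constructor <;> intro h <;> linarith
    have h3 : ⇑(b.repr x) = Fin.cons (φ x) (b'.repr y) := by
      conv_lhs => rw [hy]
      exact hrepr _ _
    rw [key, h1, hb' r y, Fin.forall_fin_succ, h3]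
    simp

end Filtration

/-! ### Lattice functions -/

section LatticeFunctions

variable {K : Type*} [Field K] {v : AddValuation K (WithTop ℝ)}
  {W : Type*} [AddCommGroup W] [Module K W]

theorem LatticeFunction.ext_mem {L M : LatticeFunction v W}
    (h : ∀ r x, x ∈ L.toFun r ↔ x ∈ M.toFun r) : L = M :=
  LatticeFunction.ext (funext fun r => Submodule.ext (h r))

theorem SplitBy.eq {n : ℕ} {b : Module.Basis (Fin n) K W} {l : Fin n → ℝ}
    {L M : LatticeFunction v W} (hL : SplitBy b l L) (hM : SplitBy b l M) : L = M :=
  LatticeFunction.ext_mem fun r x => (hL r x).trans (hM r x).symm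

/-- The lattice function split by a given basis, with given constants. -/
def LatticeFunction.ofBasis (hd : DiscreteValues v) {n : ℕ} (b : Module.Basis (Fin n) K W)
    (l : Fin n → ℝ) : LatticeFunction v W where
  toFun r :=
    { carrier := {x | ∀ k, ((r + l k : ℝ) : WithTop ℝ) ≤ v (b.repr x k)}
      add_mem' := fun {x y} hx hy k => by
        rw [map_add, Finsupp.add_apply]
        exact v.map_le_add (hx k) (hy k)
      zero_mem' := fun k => by
        rw [map_zero]
        exact le_zero_val _
      smul_mem' := fun c x hx k => by
        change _ ≤ v (b.repr ((c : K) • x) k)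
        rw [map_smul, Finsupp.smul_apply, smul_eq_mul]
        simpa using le_mul_val (r := 0) (show _ ≤ v (c : K) from c.2) (hx k) }
  isLattice r := by
    classical
    choose c hc0 hc hmin using fun k => hd.exists_min (r + l k)
    refine ⟨⟨Finset.univ.image fun k => c k • b k, le_antisymm ?_ ?_⟩, ?_⟩
    · rw [Submodule.span_le]
      intro x hx
      simp only [Finset.coe_image, Finset.coe_univ, Set.image_univ, Set.mem_range] at hx
      obtain ⟨k, rfl⟩ := hx
      intro i
      rw [map_smul, b.repr_self, Finsupp.smul_apply, Finsupp.single_apply]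
      split_ifs with h
      · subst h
        rw [smul_eq_mul, mul_one]
        exact (le_iff_val (hc0 k)).2 (hc k)
      · simp
    · intro x hx
      rw [← b.sum_repr x]
      refine Submodule.sum_mem _ fun k _ => ?_
      by_cases h : b.repr x k = 0
      · rw [h, zero_smul]
        exact Submodule.zero_mem _
      have h1 : 0 ≤ v (b.repr x k * (c k)⁻¹) := by
        have := hmin k _ h ((le_iff_val h).1 (hx k))
        have h2 : ((0 : ℝ) : WithTop ℝ) ≤ v (b.repr x k * (c k)⁻¹) := by
          rw [le_iff_val (mul_ne_zero h (inv_ne_zero (hc0 k))),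
            val_mul h (inv_ne_zero (hc0 k)), val_inv (hc0 k)]
          linarith
        exact h2
      have h3 : b.repr x k • b k = (⟨_, h1⟩ : integerRing v) • (c k • b k) := by
        change _ = (b.repr x k * (c k)⁻¹) • (c k • b k)
        rw [smul_smul, mul_assoc, inv_mul_cancel₀ (hc0 k), mul_one]
      rw [h3]
      exact Submodule.smul_mem _ _ (Submodule.subset_span (by simp))
    · rw [eq_top_iff, ← b.span_eq, Submodule.span_le]
      rintro _ ⟨k, rfl⟩
      have h1 : c k • b k ∈ Submodule.span K {x | ∀ k, ((r + l k : ℝ) : WithTop ℝ) ≤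
          v (b.repr x k)} := by
        refine Submodule.subset_span fun i => ?_
        rw [map_smul, b.repr_self, Finsupp.smul_apply, Finsupp.single_apply]
        split_ifs with h
        · subst h
          rw [smul_eq_mul, mul_one]
          exact (le_iff_val (hc0 k)).2 (hc k)
        · simp
      have := Submodule.smul_mem _ (c k)⁻¹ h1
      rwa [smul_smul, inv_mul_cancel₀ (hc0 k), one_smul] at this
  anti r s hsr x hx k := le_of_le_val (by linarith) (hx k)
  periodic c t hct r x := by
    have hc := ne_zero_of_coe hct
    constructor
    · intro hx
      refine ⟨c⁻¹ • x, fun k => ?_, by rw [smul_smul, mul_inv_cancel₀ hc, one_smul]⟩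
      have h2 : ((-t : ℝ) : WithTop ℝ) ≤ v c⁻¹ := by
        rw [le_iff_val (inv_ne_zero hc), val_inv hc, val_eq_of hct]
      rw [map_smul, Finsupp.smul_apply, smul_eq_mul]
      exact le_of_le_val (by linarith) (le_mul_val h2 (hx k))
    · rintro ⟨y, hy, rfl⟩ k
      rw [map_smul, Finsupp.smul_apply, smul_eq_mul]
      exact le_of_le_val (by linarith) (le_mul_val hct.ge (hy k))
  leftCont r x hx k := by
    by_cases h : b.repr x k = 0
    · rw [h]; exact le_zero_val _
    rw [le_iff_val h]
    refine le_of_forall_lt fun s hs => ?_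
    obtain ⟨s', h1, h2⟩ := exists_between hs
    have := (le_iff_val h).1 (hx (s' - l k) (by linarith) k)
    linarith

theorem LatticeFunction.splitBy_ofBasis (hd : DiscreteValues v) {n : ℕ}
    (b : Module.Basis (Fin n) K W) (l : Fin n → ℝ) :
    SplitBy b l (LatticeFunction.ofBasis hd b l) := fun _ _ => Iff.rfl

theorem LatticeFunction.smul_mem_iff (L : LatticeFunction v W) {c : K} (hc : c ≠ 0) {r : ℝ}
    {x : W} : c • x ∈ L.toFun (r + val v c) ↔ x ∈ L.toFun r := by
  rw [L.periodic c _ (coe_val hc).symm]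
  constructor
  · rintro ⟨y, hy, h⟩
    rwa [smul_right_injective W hc h]
  · exact fun h => ⟨x, h, rfl⟩

theorem LatticeFunction.isFiltration (L : LatticeFunction v W) :
    IsFiltration v fun r x => x ∈ L.toFun r where
  zero _ := Submodule.zero_mem _
  add := Submodule.add_mem _
  smul {c t r x} hc hx := by
    by_cases h : c = 0
    · rw [h, zero_smul]; exact Submodule.zero_mem _
    · refine L.anti _ _ ?_ ((L.smul_mem_iff h).2 hx)
      linarith [(le_iff_val h).1 hc]
  anti h hx := L.anti _ _ h hx
  left h := L.leftCont _ _ h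
  exh x := by
    have hx : x ∈ Submodule.span K (L.toFun 0 : Set W) := by
      rw [(L.isLattice 0).span_eq_top]; trivial
    induction hx using Submodule.span_induction with
    | mem x hx => exact ⟨0, hx⟩
    | zero => exact ⟨0, Submodule.zero_mem _⟩
    | add x y _ _ hx hy =>
      obtain ⟨r, hr⟩ := hx
      obtain ⟨s, hs⟩ := hy
      exact ⟨min r s, Submodule.add_mem _ (L.anti _ _ (min_le_left _ _) hr)
        (L.anti _ _ (min_le_right _ _) hs)⟩
    | smul c x _ hx =>
      obtain ⟨r, hr⟩ := hx
      by_cases h : c = 0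
      · exact ⟨0, by rw [h, zero_smul]; exact Submodule.zero_mem _⟩
      · exact ⟨_, (L.smul_mem_iff h).2 hr⟩

theorem LatticeFunction.boundedForms (hd : DiscreteValues v) (L : LatticeFunction v W) :
    BoundedForms v fun r x => x ∈ L.toFun r := by
  intro φ
  obtain ⟨S, hS⟩ := (L.isLattice 0).fg
  obtain ⟨M0, hM0⟩ : ∃ M : ℝ, ∀ x ∈ S, ((-M : ℝ) : WithTop ℝ) ≤ v (φ x) := by
    classical
    obtain ⟨M, hM⟩ := (S.image fun x => -val v (φ x)).exists_le
    refine ⟨M, fun x hx => ?_⟩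
    by_cases h : φ x = 0
    · rw [h]; exact le_zero_val _
    · rw [le_iff_val h]
      linarith [hM _ (Finset.mem_image_of_mem _ hx)]
  have hM1 : ∀ x ∈ L.toFun 0, ((-M0 : ℝ) : WithTop ℝ) ≤ v (φ x) := by
    intro x hx
    rw [← hS] at hx
    induction hx using Submodule.span_induction with
    | mem x hx => exact hM0 x hx
    | zero => rw [map_zero]; exact le_zero_val _
    | add x y _ _ hx hy => rw [map_add]; exact v.map_le_add hx hy
    | smul c x _ hx =>
      change _ ≤ v (φ ((c : K) • x))
      rw [map_smul, smul_eq_mul]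
      simpa using le_mul_val (r := 0) (show _ ≤ v (c : K) from c.2) hx
  obtain ⟨π, h0, hπ⟩ := hd.nontrivial
  refine ⟨M0 + val v π, fun r x hx => ?_⟩
  let m : ℤ := ⌊r / val v π⌋
  have h1 : m * val v π ≤ r := by
    have := Int.floor_le (r / val v π)
    rwa [le_div_iff₀ hπ] at this
  have h2 : r - val v π < m * val v π := by
    have := Int.lt_floor_add_one (r / val v π)
    rw [div_lt_iff₀ hπ] at this
    change r < (m + 1) * _ at this
    linarith
  have hz : π ^ (-m) ≠ 0 := zpow_ne_zero _ h0
  have h3 : π ^ (-m) • x ∈ L.toFun 0 := by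
    have := (L.smul_mem_iff hz).2 hx
    refine L.anti _ _ ?_ this
    rw [val_zpow h0]; push_cast; linarith
  have h4 := hM1 _ h3
  by_cases hx0 : φ x = 0
  · rw [hx0]; exact le_zero_val _
  rw [map_smul, smul_eq_mul, le_iff_val (mul_ne_zero hz hx0), val_mul hz hx0, val_zpow h0] at h4
  rw [le_iff_val hx0]
  push_cast at h4
  linarith

theorem LatticeFunction.exists_splitBy [FiniteDimensional K W] (hd : DiscreteValues v) {n : ℕ}
    (hn : Module.finrank K W = n) (L : LatticeFunction v W) :
    ∃ (b : Module.Basis (Fin n) K W) (l : Fin n → ℝ), SplitBy b l L :=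
  (L.isFiltration).exists_split hd n hn (L.boundedForms hd)

theorem IsFiltration.exists_latticeFunction [FiniteDimensional K W] (hd : DiscreteValues v)
    {P : ℝ → W → Prop} (hP : IsFiltration v P) (hb : BoundedForms v P) :
    ∃ L : LatticeFunction v W, ∀ r x, x ∈ L.toFun r ↔ P r x := by
  obtain ⟨b, l, h⟩ := hP.exists_split hd _ rfl hb
  exact ⟨LatticeFunction.ofBasis hd b l, fun r x => (h r x).symm⟩

/-- The image of a lattice function under a linear automorphism. -/
def LatticeFunction.map (g : W ≃ₗ[K] W) (L : LatticeFunction v W) : LatticeFunction v W where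
  toFun r := (L.toFun r).map (g.toLinearMap.restrictScalars (integerRing v))
  isLattice r := by
    refine ⟨(L.isLattice r).fg.map _, ?_⟩
    rw [eq_top_iff]
    intro x _
    have h1 : g.symm x ∈ Submodule.span K (L.toFun r : Set W) := by
      rw [(L.isLattice r).span_eq_top]; trivial
    have h2 := Submodule.mem_map_of_mem (f := g.toLinearMap) h1
    rw [Submodule.map_span] at h2
    simpa using h2
  anti r s h := Submodule.map_mono (L.anti r s h)
  periodic c t hct r x := by
    constructor
    · rintro ⟨y, hy, rfl⟩
      obtain ⟨z, hz, rfl⟩ := (L.periodic c t hct r y).1 hy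
      exact ⟨g z, ⟨z, hz, rfl⟩, map_smul g c z⟩
    · rintro ⟨_, ⟨z, hz, rfl⟩, rfl⟩
      exact ⟨c • z, (L.periodic c t hct r _).2 ⟨z, hz, rfl⟩, map_smul g c z⟩
  leftCont r x h := by
    refine ⟨g.symm x, L.leftCont r _ fun s hs => ?_, g.apply_symm_apply x⟩
    obtain ⟨y, hy, rfl⟩ := h s hs
    change g.symm (g y) ∈ _
    rwa [g.symm_apply_apply]

theorem LatticeFunction.mem_map {g : W ≃ₗ[K] W} {L : LatticeFunction v W} {r : ℝ} {x : W} :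
    x ∈ (L.map g).toFun r ↔ g.symm x ∈ L.toFun r := by
  constructor
  · rintro ⟨y, hy, rfl⟩
    change g.symm (g y) ∈ _
    rwa [g.symm_apply_apply]
  · exact fun h => ⟨_, h, g.apply_symm_apply x⟩

theorem LatticeFunction.apply_mem_map {g : W ≃ₗ[K] W} {L : LatticeFunction v W} {r : ℝ} {x : W} :
    g x ∈ (L.map g).toFun r ↔ x ∈ L.toFun r := by
  rw [LatticeFunction.mem_map, g.symm_apply_apply]

theorem LatticeFunction.map_mul (g g' : W ≃ₗ[K] W) (L : LatticeFunction v W) :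
    L.map (g * g') = (L.map g').map g :=
  LatticeFunction.ext_mem fun r x => by
    rw [mem_map, mem_map, mem_map]
    rfl

theorem LatticeFunction.map_one (L : LatticeFunction v W) : L.map 1 = L :=
  LatticeFunction.ext_mem fun r x => by
    rw [mem_map]
    rfl

theorem SplitBy.map {n : ℕ} {b : Module.Basis (Fin n) K W} {l : Fin n → ℝ}
    {L : LatticeFunction v W} (h : SplitBy b l L) (g : W ≃ₗ[K] W) :
    SplitBy (b.map g) l (L.map g) := fun r x => by
  rw [LatticeFunction.mem_map, h]
  rfl

theorem IsBarycenter.map {t : ℝ} {L M P : LatticeFunction v W} (h : IsBarycenter t L M P)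
    (g : W ≃ₗ[K] W) : IsBarycenter t (L.map g) (M.map g) (P.map g) := by
  obtain ⟨n, b, l, m, h1, h2, h3⟩ := h
  exact ⟨n, b.map g, l, m, h1.map g, h2.map g, h3.map g⟩

/-- The lattice function `r ↦ Λ (r + s)`. -/
def LatticeFunction.shift (s : ℝ) (L : LatticeFunction v W) : LatticeFunction v W where
  toFun r := L.toFun (r + s)
  isLattice r := L.isLattice _
  anti r s' h := L.anti _ _ (by linarith)
  periodic c t hct r x := by
    rw [show r + t + s = r + s + t by ring]
    exact L.periodic c t hct (r + s) x
  leftCont r x h := L.leftCont _ _ fun s' hs' => by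
    have := h (s' - s) (by linarith)
    rwa [sub_add_cancel] at this

theorem LatticeFunction.mem_shift {s r : ℝ} {L : LatticeFunction v W} {x : W} :
    x ∈ (L.shift s).toFun r ↔ x ∈ L.toFun (r + s) := Iff.rfl

theorem LatticeFunction.shift_shift (s : ℝ) (L : LatticeFunction v W) :
    (L.shift s).shift (-s) = L :=
  LatticeFunction.ext_mem fun r x => by
    rw [mem_shift, mem_shift, add_assoc, neg_add_cancel, add_zero]

theorem IsBarycenter.shift {t : ℝ} {L M P : LatticeFunction v W} (h : IsBarycenter t L M P)
    (s : ℝ) : IsBarycenter t (L.shift s) (M.shift s) (P.shift s) := by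
  obtain ⟨n, b, l, m, h1, h2, h3⟩ := h
  refine ⟨n, b, fun k => l k + s, fun k => m k + s, fun r x => ?_, fun r x => ?_, fun r x => ?_⟩
  · rw [LatticeFunction.mem_shift, h1]
    exact forall_congr' fun k => by rw [show r + s + l k = r + (l k + s) by ring]
  · rw [LatticeFunction.mem_shift, h2]
    exact forall_congr' fun k => by rw [show r + s + m k = r + (m k + s) by ring]
  · rw [LatticeFunction.mem_shift, h3]
    exact forall_congr' fun k => by
      rw [show r + s + (t * l k + (1 - t) * m k) =
        r + (t * (l k + s) + (1 - t) * (m k + s)) by ring]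

/-- Concavity of the norm along segments. -/
theorem IsBarycenter.mem {t : ℝ} {L M P : LatticeFunction v W} (h : IsBarycenter t L M P)
    (ht : t ∈ Set.Icc (0 : ℝ) 1) {p q : ℝ} {x : W} (hp : x ∈ L.toFun p) (hq : x ∈ M.toFun q) :
    x ∈ P.toFun (t * p + (1 - t) * q) := by
  obtain ⟨n, b, l, m, h1, h2, h3⟩ := h
  rw [h3]
  intro k
  by_cases hk : b.repr x k = 0
  · rw [hk]; exact le_zero_val _
  rw [le_iff_val hk]
  have e1 := (le_iff_val hk).1 ((h1 _ _).1 hp k)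
  have e2 := (le_iff_val hk).1 ((h2 _ _).1 hq k)
  have := ht.1
  have := ht.2
  nlinarith

/-- A vector of `P r`, for the barycenter `P` of `L` and `M`, is a sum of vectors which lie in
`L p ∩ M q` with `t p + (1 - t) q = r`. -/
theorem IsBarycenter.exists_sum {t : ℝ} {L M P : LatticeFunction v W} (h : IsBarycenter t L M P)
    {r : ℝ} {x : W} (hx : x ∈ P.toFun r) :
    ∃ (n : ℕ) (u : Fin n → W), x = ∑ k, u k ∧
      ∀ k, ∃ p q, t * p + (1 - t) * q = r ∧ u k ∈ L.toFun p ∧ u k ∈ M.toFun q := by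
  obtain ⟨n, b, l, m, h1, h2, h3⟩ := h
  refine ⟨n, fun k => b.repr x k • b k, (b.sum_repr x).symm, fun k => ?_⟩
  have hk := (h3 _ _).1 hx k
  have key : ∀ (s : ℝ) (j : Fin n → ℝ), ((s : ℝ) : WithTop ℝ) ≤ v (b.repr x k) → ∀ i,
      ((s - j k + j i : ℝ) : WithTop ℝ) ≤ v (b.repr (b.repr x k • b k) i) := by
    intro s j hs i
    rw [map_smul, b.repr_self, Finsupp.smul_apply, Finsupp.single_apply]
    split_ifs with hki
    · subst hki
      simpa using hs
    · simp
  exact ⟨r + (t * l k + (1 - t) * m k) - l k, r + (t * l k + (1 - t) * m k) - m k, by ring,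
    (h1 _ _).2 (key _ l hk), (h2 _ _).2 (key _ m hk)⟩

/-- Linear forms detect the steps of a lattice function: if `x` is not in the step `r`, some linear
form takes the value `1` at `x` and values of valuation at least `q - s` on each step `q`, with a
constant `s < r`. -/
theorem LatticeFunction.exists_form [FiniteDimensional K W] (hd : DiscreteValues v)
    (L : LatticeFunction v W) {r : ℝ} {x : W} (hx : x ∉ L.toFun r) :
    ∃ (s : ℝ) (φ : W →ₗ[K] K), s < r ∧ φ x = 1 ∧
      ∀ q, ∀ y ∈ L.toFun q, ((q - s : ℝ) : WithTop ℝ) ≤ v (φ y) := by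
  obtain ⟨b, l, h⟩ := L.exists_splitBy hd rfl
  rw [h] at hx
  push Not at hx
  obtain ⟨k, hk⟩ := hx
  have h0 : b.repr x k ≠ 0 := by
    intro h0
    rw [h0] at hk
    exact absurd (le_zero_val _) (not_le.2 hk)
  refine ⟨val v (b.repr x k) - l k, (b.repr x k)⁻¹ • b.coord k, ?_, ?_, ?_⟩
  · rw [← not_le, le_iff_val h0, not_le] at hk
    linarith
  · simp [h0]
  · intro q y hy
    have e1 := (h _ _).1 hy k
    have e2 : ((-val v (b.repr x k) : ℝ) : WithTop ℝ) ≤ v (b.repr x k)⁻¹ := by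
      rw [le_iff_val (inv_ne_zero h0), val_inv h0]
    exact le_of_le_val (by linarith) (le_mul_val e2 e1)

end LatticeFunctions

/-! ### Complete fields and their finite extensions -/

section Complete

variable {K : Type*} [Field K] {v : AddValuation K (WithTop ℝ)}

/-- Completeness of a filtration, in the same form as `CompleteVal`. -/
def CompleteFiltration {W : Type*} [AddCommGroup W] (P : ℝ → W → Prop) : Prop :=
  ∀ δ : ℝ, 0 < δ → ∀ a : ℕ → W, (∀ n : ℕ, P (n * δ) (a (n + 1) - a n)) →
    ∃ l, ∀ n : ℕ, P (n * δ) (l - a n)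

/-- A filtration with bounded linear forms is coarser than any other filtration, up to a shift. -/
theorem IsFiltration.exists_comparison {W : Type*} [AddCommGroup W] [Module K W]
    [FiniteDimensional K W] {P Q : ℝ → W → Prop} (hb : BoundedForms v P) (hQ : IsFiltration v Q) :
    ∃ C : ℝ, ∀ r x, P r x → Q (r - C) x := by
  classical
  let b := Module.finBasis K W
  choose M hM using fun k => hb (b.coord k)
  choose s hs using fun k => hQ.exh (b k)
  obtain ⟨C, hC⟩ := (Finset.univ.image fun k => M k - s k).exists_le
  refine ⟨C, fun r x hx => ?_⟩
  rw [← b.sum_repr x]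
  refine hQ.sum _ _ fun k _ => ?_
  refine hQ.anti ?_ (hQ.smul (hM k r x hx) (hs k))
  linarith [hC _ (Finset.mem_image_of_mem (fun k => M k - s k) (Finset.mem_univ k))]

theorem IsFiltration.cauchy {W : Type*} [AddCommGroup W] [Module K W] {P : ℝ → W → Prop}
    (hP : IsFiltration v P) {δ : ℝ} (hδ : 0 < δ) {a : ℕ → W}
    (ha : ∀ n : ℕ, P (n * δ) (a (n + 1) - a n)) (n k : ℕ) : P (n * δ) (a (n + k) - a n) := by
  induction k with
  | zero => simpa using hP.zero _
  | succ k ih =>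
    have h1 : P (n * δ) (a (n + k + 1) - a (n + k)) := by
      refine hP.anti ?_ (ha (n + k))
      push_cast
      nlinarith [(Nat.cast_nonneg k : (0 : ℝ) ≤ k)]
    have := hP.add h1 ih
    rwa [sub_add_sub_cancel] at this

theorem IsFiltration.complete_of_bounded (hc : CompleteVal v) {W : Type*} [AddCommGroup W]
    [Module K W] [FiniteDimensional K W] {P : ℝ → W → Prop} (hP : IsFiltration v P)
    (hb : BoundedForms v P) : CompleteFiltration P := by
  classical
  intro δ hδ a ha
  let b := Module.finBasis K W
  choose M hM using fun k => hb (b.coord k)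
  choose s hs using fun k => hP.exh (b k)
  obtain ⟨C, hC⟩ := (Finset.univ.image M).exists_le
  obtain ⟨D, hD⟩ := (Finset.univ.image fun k => -s k).exists_le
  obtain ⟨N, hN⟩ := exists_nat_ge (C / δ)
  rw [div_le_iff₀ hδ] at hN
  have h1 : ∀ k, ∃ l : K, ∀ n : ℕ, ((n * δ : ℝ) : WithTop ℝ) ≤ v (l - b.coord k (a (N + n))) := by
    intro k
    refine hc δ hδ (fun n => b.coord k (a (N + n))) fun n => ?_
    have := hM k _ _ (ha (N + n))
    rw [map_sub] at this
    refine le_of_le_val ?_ this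
    have := hC _ (Finset.mem_image_of_mem M (Finset.mem_univ k))
    push_cast
    linarith
  choose l hl using h1
  have h2 : ∀ n : ℕ, P (n * δ - D) (∑ k, l k • b k - a (N + n)) := by
    intro n
    have : ∑ k, l k • b k - a (N + n) = ∑ k, (l k - b.coord k (a (N + n))) • b k := by
      conv_lhs => rw [← b.sum_repr (a (N + n))]
      rw [← Finset.sum_sub_distrib]
      simp [sub_smul]
    rw [this]
    refine hP.sum _ _ fun k _ => hP.anti ?_ (hP.smul (hl k n) (hs k))
    linarith [hD _ (Finset.mem_image_of_mem (fun k => -s k) (Finset.mem_univ k))]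
  refine ⟨∑ k, l k • b k, fun n => ?_⟩
  obtain ⟨m, hm⟩ := exists_nat_ge (D / δ)
  rw [div_le_iff₀ hδ] at hm
  have h3 := h2 (n + m)
  have h4 := hP.cauchy hδ ha n (N + m)
  have h5 := hP.add (hP.anti (s := n * δ) (by push_cast; linarith) h3) h4
  rwa [show N + (n + m) = n + (N + m) by ring, sub_add_sub_cancel] at h5

/-- Over a complete field, linear forms on a finite-dimensional space are bounded for every
separated filtration. -/
theorem IsFiltration.boundedForms (hc : CompleteVal v) : ∀ (n : ℕ) {W : Type*} [AddCommGroup W]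
    [Module K W] [FiniteDimensional K W] {P : ℝ → W → Prop}, Module.finrank K W = n →
    IsFiltration v P → Separated P → BoundedForms v P := by
  intro n
  induction n with
  | zero =>
    intro W _ _ _ P hn hP hs φ
    have := Module.finrank_zero_iff.1 hn
    exact ⟨0, fun r x _ => by rw [Subsingleton.elim x 0, map_zero]; exact le_zero_val _⟩
  | succ n ih =>
    intro W _ _ _ P hn hP hs φ
    by_cases hφ : φ = 0
    · exact ⟨0, fun r x _ => by rw [hφ, LinearMap.zero_apply]; exact le_zero_val _⟩
    obtain ⟨x1, hx1⟩ : ∃ x, φ x ≠ 0 := by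
      by_contra! h
      exact hφ (LinearMap.ext h)
    let H := LinearMap.ker φ
    have hH : Module.finrank K H = n := by
      have h1 := LinearMap.finrank_range_add_finrank_ker φ
      have h2 : LinearMap.range φ = ⊤ := LinearMap.range_eq_top.2 fun c =>
        ⟨(c * (φ x1)⁻¹) • x1, by simp [hx1]⟩
      rw [h2, finrank_top, Module.finrank_self] at h1
      change Module.finrank K (LinearMap.ker φ) = n
      omega
    have hPH : IsFiltration v fun r (y : H) => P r y :=
      { zero := fun r => hP.zero r
        add := fun h1 h2 => hP.add h1 h2
        smul := fun h1 h2 => hP.smul h1 h2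
        anti := fun h1 h2 => hP.anti h1 h2
        left := fun h => hP.left h
        exh := fun x => hP.exh x }
    have hsH : Separated fun r (y : H) => P r y := fun x hx => hs x (by simpa using hx)
    have hcH := hPH.complete_of_bounded hc (ih hH hPH hsH)
    by_contra hcon
    push Not at hcon
    -- if `φ` is unbounded, its affine hyperplane `φ = 1` meets all the steps; by completeness of
    -- the kernel, it then contains a vector which lies in all the steps
    have h1 : ∀ m : ℕ, ∃ x, φ x = 1 ∧ P m x := by
      intro m
      obtain ⟨r, x, hx, hlt⟩ := hcon m
      have h0 : φ x ≠ 0 := by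
        intro h0
        rw [h0] at hlt
        exact absurd (le_zero_val _) (not_le.2 hlt)
      rw [← not_le, le_iff_val h0, not_le] at hlt
      refine ⟨(φ x)⁻¹ • x, by simp [h0], ?_⟩
      rw [hP.smul_iff (inv_ne_zero h0), val_inv h0]
      exact hP.anti (by linarith) hx
    choose x hx1 hxP using h1
    obtain ⟨l, hl⟩ := hcH 1 one_pos (fun n => ⟨x n - x 0, by simp [H, hx1]⟩) fun n => by
      change P _ (x (n + 1) - x 0 - (x n - x 0))
      rw [sub_sub_sub_cancel_right, mul_one]
      exact hP.sub (hP.anti (by push_cast; linarith) (hxP (n + 1))) (hxP n)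
    have h2 : ∀ n : ℕ, P n (x 0 + l) := by
      intro n
      have h3 : P (n * 1) ((l : W) - (x n - x 0)) := hl n
      rw [mul_one] at h3
      have := hP.add h3 (hxP n)
      rwa [show (l : W) - (x n - x 0) + x n = x 0 + l by abel] at this
    have h3 : x 0 + (l : W) ≠ 0 := by
      intro h
      have := congrArg φ h
      rw [map_add, hx1, show φ l = 0 from l.2, map_zero, add_zero] at this
      exact one_ne_zero this
    obtain ⟨r, hr⟩ := hs _ h3
    obtain ⟨n, hn⟩ := exists_nat_ge r
    exact hr (hP.anti hn (h2 n))

variable {E : Type*} [Field E] [Algebra K E] {vE : AddValuation E (WithTop ℝ)}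

theorem isFiltration_of_extends (hv : ∀ a, vE (algebraMap K E a) = v a) :
    IsFiltration v fun r (x : E) => (r : WithTop ℝ) ≤ vE x where
  zero _ := le_zero_val _
  add h1 h2 := vE.map_le_add h1 h2
  smul {c t r x} hc hx := by
    rw [Algebra.smul_def, add_comm]
    exact le_mul_val (by rwa [hv]) hx
  anti h hx := le_of_le_val h hx
  left {r x} h := by
    by_cases hx : x = 0
    · rw [hx]; exact le_zero_val _
    · rw [le_iff_val hx]
      exact le_of_forall_lt_imp_le_of_dense fun s hs => (le_iff_val hx).1 (h s hs)
  exh x := by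
    by_cases hx : x = 0
    · exact ⟨0, by rw [hx]; exact le_zero_val _⟩
    · exact ⟨val vE x, (le_iff_val hx).2 le_rfl⟩

theorem separated_val : Separated fun r (x : E) => (r : WithTop ℝ) ≤ vE x := fun x hx =>
  ⟨val vE x + 1, fun h => by linarith [(le_iff_val hx).1 h]⟩

theorem nrm_val {x : E} (hx : x ≠ 0) : nrm (fun r (x : E) => (r : WithTop ℝ) ≤ vE x) x =
    val vE x := by
  unfold nrm
  simp only [le_iff_val hx]
  exact csSup_Iic

variable [FiniteDimensional K E]

theorem CompleteVal.of_extends (hc : CompleteVal v) (hv : ∀ a, vE (algebraMap K E a) = v a) :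
    CompleteVal vE :=
  (isFiltration_of_extends hv).complete_of_bounded hc
    ((isFiltration_of_extends hv).boundedForms hc _ rfl separated_val)

/-- The valuation of a complete field has at most one extension to a finite extension. -/
theorem extension_unique (hc : CompleteVal v) (hv : ∀ a, vE (algebraMap K E a) = v a)
    {vE' : AddValuation E (WithTop ℝ)} (hv' : ∀ a, vE' (algebraMap K E a) = v a) (x : E) :
    vE x = vE' x := by
  have key : ∀ {w w' : AddValuation E (WithTop ℝ)}, (∀ a, w (algebraMap K E a) = v a) →
      (∀ a, w' (algebraMap K E a) = v a) → ∀ x ≠ 0, val w x ≤ val w' x := by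
    intro w w' hw hw' x hx
    obtain ⟨C, hC⟩ := IsFiltration.exists_comparison
      ((isFiltration_of_extends hw).boundedForms hc _ rfl separated_val)
      (isFiltration_of_extends hw')
    by_contra! hlt
    obtain ⟨n, hn⟩ := exists_nat_gt (C / (val w x - val w' x))
    rw [div_lt_iff₀ (by linarith)] at hn
    have h1 := hC (val w (x ^ n)) (x ^ n) ((le_iff_val (pow_ne_zero _ hx)).2 le_rfl)
    rw [le_iff_val (pow_ne_zero _ hx), val_pow hx, val_pow hx] at h1
    linarith
  by_cases hx : x = 0
  · rw [hx, vE.map_zero, vE'.map_zero]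
  · rw [← coe_val hx, ← coe_val (v := vE') hx, le_antisymm (key hv hv' x hx) (key hv' hv x hx)]

/-- In an extension of degree `d` the value group is multiplied by at most `1 / d!`: among the
powers `1, x, …, x ^ d` two have valuations which are congruent modulo the smaller group. -/
theorem DiscreteValues.of_extends (hd : DiscreteValues v)
    (hv : ∀ a, vE (algebraMap K E a) = v a) : DiscreteValues vE := by
  have hval : ∀ a : K, a ≠ 0 → val vE (algebraMap K E a) = val v a := fun a ha =>
    val_eq_of (by rw [hv, coe_val ha])
  constructor
  · obtain ⟨δ, hδ, hm⟩ := hd.values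
    let d := Module.finrank K E
    have hf : (0 : ℝ) < (d.factorial : ℝ) := by exact_mod_cast d.factorial_pos
    refine ⟨δ / d.factorial, div_pos hδ hf, fun x hx => ?_⟩
    have hP := isFiltration_of_extends (v := v) (vE := vE) hv
    have hdep : ¬ LinearIndependent K fun i : Fin (d + 1) => x ^ (i : ℕ) := by
      intro h
      have := h.fintype_card_le_finrank
      simp [d] at this
    have h1 : ∃ i j : Fin (d + 1), i ≠ j ∧ ∃ c : K, c ≠ 0 ∧
        val vE (x ^ (i : ℕ)) = val vE (x ^ (j : ℕ)) + val v c := by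
      by_contra! hcon
      refine hdep (hP.linearIndependent separated_val _ (fun i => pow_ne_zero _ hx) ?_)
      intro i j hij c hc
      rw [nrm_val (pow_ne_zero _ hx), nrm_val (pow_ne_zero _ hx)]
      exact hcon i j hij c hc
    obtain ⟨i, j, hij, c, hc, h⟩ := h1
    obtain ⟨m, hm⟩ := hm c hc
    rw [val_pow hx, val_pow hx, hm] at h
    let k : ℤ := (i : ℤ) - j
    have hk : k ≠ 0 := by
      have : (i : ℕ) ≠ j := fun h => hij (Fin.ext h)
      omega
    have hkd : k ∣ (d.factorial : ℤ) := by
      rw [← Int.natAbs_dvd_natAbs, Int.natAbs_natCast]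
      refine Nat.dvd_factorial (Int.natAbs_pos.2 hk) ?_
      have := i.2
      have := j.2
      omega
    obtain ⟨q, hq⟩ := hkd
    have hq' : (d.factorial : ℝ) = k * q := by exact_mod_cast hq
    have hk' : (k : ℝ) * val vE x = m * δ := by
      have : (k : ℝ) = (i : ℕ) - (j : ℕ) := by simp [k]
      rw [this]
      linarith
    refine ⟨m * q, ?_⟩
    rw [mul_div_assoc', eq_div_iff hf.ne', hq']
    push_cast
    linear_combination (q : ℝ) * hk'
  · obtain ⟨π, h0, hπ⟩ := hd.nontrivial
    refine ⟨algebraMap K E π, by simpa using h0, by rwa [hval π h0]⟩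

/-- An automorphism of a finite extension which stabilizes the base field and is isometric there
is isometric. -/
theorem val_comp_eq (hc : CompleteVal v) (hv : ∀ a, vE (algebraMap K E a) = v a)
    {E' : Type*} [Field E'] [Algebra K E'] {vE' : AddValuation E' (WithTop ℝ)}
    (hv' : ∀ a, vE' (algebraMap K E' a) = v a) (ρ : E →+* E') (τ : K → K)
    (hτ : ∀ a, v (τ a) = v a) (hρ : ∀ a, ρ (algebraMap K E a) = algebraMap K E' (τ a)) (x : E) :
    vE' (ρ x) = vE x :=
  (extension_unique (vE' := vE'.comap ρ) hc hv (fun a => by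
    change vE' (ρ _) = _
    rw [hρ, hv', hτ]) x).symm

end Complete

/-! ### Maps out of a glued space -/

section GlueMaps

variable {G A X : Type*} [Group G] {move : G → A → A → Prop} {U : A → Subgroup G}

theorem GlueSpace.exists_mk (p : GlueSpace move U) : ∃ g x, p = GlueSpace.mk move U g x := by
  obtain ⟨⟨g, x⟩, rfl⟩ := Quot.exists_rep p
  exact ⟨g, x, rfl⟩

theorem GlueSpace.smul_mk (g g' : G) (x : A) :
    g • GlueSpace.mk move U g' x = GlueSpace.mk move U (g * g') x := rfl

theorem GlueSpace.mk_eq_of_move {n : G} {x y : A} (h : move n x y) :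
    n • GlueSpace.mk move U 1 x = GlueSpace.mk move U 1 y :=
  Quot.sound ⟨n, h, by simp⟩

/-- A map `x ↦ S x` on the apartment extends to an injective equivariant map on the glued space
if `S` is compatible with the action of `N`, the groups `U x` fix the points `S x`, and two points of
the apartment whose images are in one orbit are related by an element of `N`. -/
theorem GlueSpace.exists_map (act : G → X → X) (h1 : ∀ L, act 1 L = L)
    (hmul : ∀ g g' L, act (g * g') L = act g (act g' L)) (S : A → X)
    (hmove : ∀ n x y, move n x y → act n (S x) = S y)
    (hU : ∀ x, ∀ u ∈ U x, act u (S x) = S x)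
    (hinj : ∀ g x y, act g (S x) = S y → ∃ n, move n y x ∧ g * n ∈ U y) :
    ∃ j : GlueSpace move U → X, (∀ g x, j (GlueSpace.mk move U g x) = act g (S x)) ∧
      Function.Injective j ∧ ∀ g p, j (g • p) = act g (j p) := by
  let j : GlueSpace move U → X := Quot.lift (fun p => act p.1 (S p.2)) (by
    rintro ⟨g, x⟩ ⟨g', y⟩ ⟨n, hn, hu⟩
    have e1 := hU _ _ hu
    have e2 : g' * n = g * (g⁻¹ * g' * n) := by group
    change act g (S x) = act g' (S y)
    rw [← hmove n x y hn, ← hmul, e2, hmul, e1])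
  refine ⟨j, fun g x => rfl, ?_, ?_⟩
  · rintro ⟨g, x⟩ ⟨g', y⟩ h
    have h' : act g (S x) = act g' (S y) := h
    obtain ⟨n, hn, hu⟩ := hinj (g'⁻¹ * g) x y (by
      rw [hmul, h', ← hmul, inv_mul_cancel, h1])
    exact (Quot.sound ⟨n, hn, hu⟩ :
      Quot.mk (GlueRel move U) (g', y) = Quot.mk (GlueRel move U) (g, x)).symm
  · rintro g ⟨g', x⟩
    exact hmul g g' (S x)

end GlueMaps

section Monomial

variable {K : Type*} [Field K] {W : Type*} [AddCommGroup W] [Module K W]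

/-- The inverse of a monomial transformation is monomial. -/
theorem exists_monomial_inv {I : Type*} [Finite I] {e : I → W} (he : LinearIndependent K e)
    {g : W ≃ₗ[K] W} (hg : ∀ i, ∃ j, ∃ c : K, g (e i) = c • e j) (k : I) :
    ∃ i, ∃ c : K, c ≠ 0 ∧ g (e i) = c • e k := by
  choose j c hc using hg
  have hc0 : ∀ i, c i ≠ 0 := by
    intro i h
    have := hc i
    rw [h, zero_smul] at this
    exact he.ne_zero i (by simpa using this)
  have hj : Function.Injective j := by
    intro i i' hii
    by_contra hne
    have h1 : c i' • e i = c i • e i' := g.injective (by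
      rw [map_smul, map_smul, hc, hc, hii, smul_smul, smul_smul, mul_comm])
    have h2 : Finsupp.single i (c i') = Finsupp.single i' (c i) := he (by simpa using h1)
    have h3 := DFunLike.congr_fun h2 i
    rw [Finsupp.single_eq_same, Finsupp.single_eq_of_ne hne] at h3
    exact hc0 _ h3
  obtain ⟨i, rfl⟩ := Finite.surjective_of_injective hj k
  exact ⟨i, c i, hc0 i, hc i⟩

end Monomial

/-! ### The enlarged building of a general linear group and lattice functions -/

section LinearIdent

variable {K : Type*} [Field K] {v : AddValuation K (WithTop ℝ)}
  {W : Type*} [AddCommGroup W] [Module K W] {n : ℕ} {b : Module.Basis (Fin n) K W}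

theorem linearMove_inv {g : W ≃ₗ[K] W} {x y : Fin n → ℝ} (h : linearMove v b g x y) :
    linearMove v b g⁻¹ y x := by
  have key := exists_monomial_inv b.linearIndependent h.1
  have hinv : ∀ {z z'}, g z = z' → g⁻¹ z' = z := fun {z z'} h => by
    rw [← h]; exact g.symm_apply_apply z
  refine ⟨fun k => ?_, fun k m c hkm => ?_⟩
  · obtain ⟨i, c, hc, hi⟩ := key k
    refine ⟨i, c⁻¹, hinv ?_⟩
    rw [map_smul, hi, smul_smul, inv_mul_cancel₀ hc, one_smul]
  · have hc : c ≠ 0 := by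
      rintro rfl
      rw [zero_smul] at hkm
      exact b.ne_zero k (by simpa using hkm)
    have h1 : g (b m) = c⁻¹ • b k := by
      have : b k = g (c • b m) := by
        rw [← hkm]; exact (g.apply_symm_apply _).symm
      rw [this, map_smul, smul_smul, inv_mul_cancel₀ hc, one_smul]
    have := h.2 m k c⁻¹ h1
    rw [val_inv hc] at this
    linarith

/-- The standard lattice function attached to a point of the standard apartment. -/
abbrev stdLinear (hd : DiscreteValues v) (b : Module.Basis (Fin n) K W) (x : Fin n → ℝ) :
    LatticeFunction v W := LatticeFunction.ofBasis hd b fun k => -x k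

theorem mem_stdLinear {hd : DiscreteValues v} {x : Fin n → ℝ} {r : ℝ} {z : W} :
    z ∈ (stdLinear hd b x).toFun r ↔ ∀ k, ((r - x k : ℝ) : WithTop ℝ) ≤ v (b.repr z k) := by
  simp only [sub_eq_add_neg]; rfl

theorem smul_basis_mem_stdLinear {hd : DiscreteValues v} {x : Fin n → ℝ} {r : ℝ} {c : K}
    {k : Fin n} : c • b k ∈ (stdLinear hd b x).toFun r ↔ ((r - x k : ℝ) : WithTop ℝ) ≤ v c := by
  rw [mem_stdLinear]
  constructor
  · intro h
    simpa using h k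
  · intro h i
    rw [map_smul, b.repr_self, Finsupp.smul_apply, Finsupp.single_apply]
    split_ifs with hki
    · subst hki
      simpa using h
    · simp

theorem map_stdLinear_of_move {hd : DiscreteValues v} {g : W ≃ₗ[K] W} {x y : Fin n → ℝ}
    (h : linearMove v b g x y) : (stdLinear hd b x).map g = stdLinear hd b y := by
  have key : ∀ {g : W ≃ₗ[K] W} {x y : Fin n → ℝ}, linearMove v b g x y → ∀ r z,
      z ∈ (stdLinear hd b x).toFun r → g z ∈ (stdLinear hd b y).toFun r := by
    intro g x y h r z hz
    rw [← b.sum_repr z, map_sum]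
    refine Submodule.sum_mem _ fun i _ => ?_
    obtain ⟨j, c, hj⟩ := h.1 i
    have hc : c ≠ 0 := by
      rintro rfl
      rw [zero_smul] at hj
      exact b.ne_zero i (by simpa using hj)
    rw [map_smul, hj, smul_smul, smul_basis_mem_stdLinear]
    refine le_of_le_val ?_ (le_mul_val (mem_stdLinear.1 hz i) (coe_val hc).le)
    have := h.2 i j c hj
    linarith
  refine LatticeFunction.ext_mem fun r z => ?_
  rw [LatticeFunction.mem_map]
  constructor
  · intro hz
    have := key h r _ hz
    rwa [g.apply_symm_apply] at this
  · exact key (linearMove_inv h) r z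

theorem map_stdLinear_of_mem_unip {hd : DiscreteValues v} {x : Fin n → ℝ} {u : W ≃ₗ[K] W}
    (hu : u ∈ linearUnip v b x) : (stdLinear hd b x).map u = stdLinear hd b x := by
  induction hu using Subgroup.closure_induction with
  | mem u hu =>
    obtain ⟨i, j, c, hij, huj, hul, hc⟩ := hu
    have hform : ∀ z, u z = z + (b.repr z j * c) • b i := by
      intro z
      have h1 : u.toLinearMap = LinearMap.id +
          (LinearMap.toSpanSingleton K W (b i)).comp (c • b.coord j) := by
        refine b.ext fun l => ?_
        by_cases hl : l = j
        · subst hl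
          simp [huj]
        · simp [hul l hl, hl]
      have := LinearMap.congr_fun h1 z
      simpa [mul_comm] using this
    refine LatticeFunction.ext_mem fun r z => ?_
    rw [← u.apply_symm_apply z, LatticeFunction.apply_mem_map, hform]
    generalize u.symm z = z
    have hmem : ((r - x j : ℝ) : WithTop ℝ) ≤ v (b.repr z j) →
        (b.repr z j * c) • b i ∈ (stdLinear hd b x).toFun r := fun h => by
      rw [smul_basis_mem_stdLinear]
      exact le_of_le_val (by linarith) (le_mul_val h hc)
    constructor
    · exact fun hz => Submodule.add_mem _ hz (hmem (mem_stdLinear.1 hz j))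
    · intro hz
      have hj := mem_stdLinear.1 hz j
      rw [map_add, map_smul, b.repr_self, Finsupp.add_apply, Finsupp.smul_apply,
        Finsupp.single_eq_of_ne hij.symm, smul_zero, add_zero] at hj
      simpa using Submodule.sub_mem _ hz (hmem hj)
  | one => exact LatticeFunction.map_one _
  | mul u u' _ _ h h' => rw [LatticeFunction.map_mul, h', h]
  | inv u _ h =>
    conv_lhs => rw [← h]
    rw [← LatticeFunction.map_mul, inv_mul_cancel, LatticeFunction.map_one]

/-- Column operations: a transvection adding multiples of the other basis vectors to `b j` lies in
the group `U_x` as soon as its entries satisfy the bounds. -/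
theorem transvection_mem_linearUnip {x : Fin n → ℝ} (j : Fin n) (t : Fin n → K)
    (ht : ∀ k, ((-(x k - x j) : ℝ) : WithTop ℝ) ≤ v (t k)) (s : Finset (Fin n)) (hs : j ∉ s) :
    ∃ u ∈ linearUnip v b x, ∀ z, u z = z + b.repr z j • ∑ k ∈ s, t k • b k := by
  induction s using Finset.induction_on with
  | empty => exact ⟨1, Subgroup.one_mem _, fun z => by simp⟩
  | insert a s ha ih =>
    obtain ⟨u, hu, hus⟩ := ih fun h => hs (Finset.mem_insert_of_mem h)
    have haj : a ≠ j := fun h => hs (by rw [h]; exact Finset.mem_insert_self _ _)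
    have h0 : b.coord j (t a • b a) = 0 := by simp [haj]
    refine ⟨LinearEquiv.transvection h0 * u, Subgroup.mul_mem _ (Subgroup.subset_closure ?_) hu,
      fun z => ?_⟩
    · refine ⟨a, j, t a, haj, ?_, fun l hl => ?_, ht a⟩
      · rw [LinearEquiv.transvection.apply]; simp
      · rw [LinearEquiv.transvection.apply]; simp [hl]
    · have hsum : b.repr (∑ k ∈ s, t k • b k) j = 0 := by
        rw [map_sum, Finsupp.finsetSum_apply]
        refine Finset.sum_eq_zero fun k hk => ?_
        have : k ≠ j := fun h => hs (by rw [← h]; exact Finset.mem_insert_of_mem hk)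
        simp [this]
      rw [LinearEquiv.mul_apply, hus, LinearEquiv.transvection.apply, Finset.sum_insert ha]
      simp only [Module.Basis.coord_apply, map_add, map_smul, hsum, smul_zero, add_zero, smul_add]
      abel

/-- Gaussian elimination: if `g` maps one standard lattice function to another, then
operations from `U_y` make it monomial. -/
theorem exists_linear_reduction {hd : DiscreteValues v} {g : W ≃ₗ[K] W} {x y : Fin n → ℝ}
    (hg : (stdLinear hd b x).map g = stdLinear hd b y) (s : ℕ) :
    ∃ u ∈ linearUnip v b y, ∀ i : Fin n, (i : ℕ) < s → ∃ j, ∃ c : K, (u * g) (b i) = c • b j := by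
  induction s with
  | zero => exact ⟨1, Subgroup.one_mem _, fun i hi => absurd hi (Nat.not_lt_zero _)⟩
  | succ s ih =>
    obtain ⟨u, hu, hus⟩ := ih
    by_cases hsn : s < n
    swap
    · exact ⟨u, hu, fun i _ => hus i (by omega)⟩
    let i : Fin n := ⟨s, hsn⟩
    set g' := u * g with hg'
    have hmap : (stdLinear hd b x).map g' = stdLinear hd b y := by
      rw [hg', LatticeFunction.map_mul, hg, map_stdLinear_of_mem_unip hu]
    let a := b.repr (g' (b i))
    have ha : g' (b i) = ∑ k, a k • b k := (b.sum_repr _).symm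
    -- the linear form dual to `g' bᵢ` with respect to the basis `g' b`
    let ψ : W →ₗ[K] K := (b.coord i).comp g'.symm.toLinearMap
    have hψ : ∀ z, ψ (g' z) = b.repr z i := fun z => by simp [ψ]
    -- a pivot `k`: the terms `aₖ ψ(bₖ)` add up to `1`, so one of them is not in the maximal ideal
    obtain ⟨k, hk⟩ : ∃ k, ¬ 0 < v (a k * ψ (b k)) := by
      by_contra! hcon
      have h1 : ψ (g' (b i)) = 1 := by rw [hψ]; simp
      rw [ha, map_sum] at h1
      have h2 : 0 < v (∑ k, ψ (a k • b k)) := v.map_lt_sum' WithTop.top_pos fun k _ => by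
        rw [map_smul, smul_eq_mul]; exact hcon k
      rw [h1, v.map_one] at h2
      exact lt_irrefl _ h2
    have hak : a k ≠ 0 := by
      intro h
      rw [h, zero_mul, v.map_zero] at hk
      exact hk WithTop.top_pos
    have hψk : ψ (b k) ≠ 0 := by
      intro h
      rw [h, mul_zero, v.map_zero] at hk
      exact hk WithTop.top_pos
    have hval : val v (a k) ≤ x i - y k := by
      rw [pos_iff_val (mul_ne_zero hak hψk), val_mul hak hψk, not_lt] at hk
      have h1 : b k ∈ (stdLinear hd b y).toFun (y k) := by
        have := (smul_basis_mem_stdLinear (hd := hd) (b := b) (x := y) (r := y k) (c := 1)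
          (k := k)).2 (by rw [sub_self, v.map_one]; exact le_rfl)
        rwa [one_smul] at this
      rw [← hmap, LatticeFunction.mem_map] at h1
      have h2 := (le_iff_val hψk).1 (mem_stdLinear.1 h1 i)
      linarith
    have hbound : ∀ l, ((x i - y l : ℝ) : WithTop ℝ) ≤ v (a l) := by
      have h1 : b i ∈ (stdLinear hd b x).toFun (x i) := by
        have := (smul_basis_mem_stdLinear (hd := hd) (b := b) (x := x) (r := x i) (c := 1)
          (k := i)).2 (by rw [sub_self, v.map_one]; exact le_rfl)
        rwa [one_smul] at this
      rw [← LatticeFunction.apply_mem_map (g := g'), hmap] at h1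
      exact mem_stdLinear.1 h1
    obtain ⟨u', hu', hu's⟩ := transvection_mem_linearUnip (v := v) (b := b) (x := y) k
      (fun l => a l * (a k)⁻¹) (fun l => by
        refine le_of_le_val ?_ (le_mul_val (hbound l) (coe_val (inv_ne_zero hak)).le)
        rw [val_inv hak]
        linarith) (Finset.univ.erase k) (Finset.notMem_erase _ _)
    have huk : u' (b k) = (a k)⁻¹ • g' (b i) := by
      rw [hu's, ha, ← Finset.add_sum_erase _ _ (Finset.mem_univ k), smul_add, smul_smul,
        inv_mul_cancel₀ hak, one_smul, b.repr_self, Finsupp.single_eq_same, one_smul,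
        Finset.smul_sum]
      simp only [smul_smul, mul_comm]
    refine ⟨u'⁻¹ * u, Subgroup.mul_mem _ (Subgroup.inv_mem _ hu') hu, fun m hm => ?_⟩
    rw [mul_assoc, ← hg']
    by_cases hmi : m = i
    · subst hmi
      refine ⟨k, a k, ?_⟩
      have : g' (b i) = u' (a k • b k) := by
        rw [map_smul, huk, smul_smul, mul_inv_cancel₀ hak, one_smul]
      rw [LinearEquiv.mul_apply, this]
      exact u'.symm_apply_apply _
    · have hms : (m : ℕ) < s := by
        have : (m : ℕ) ≠ s := fun h => hmi (Fin.ext h)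
        omega
      obtain ⟨j, c, hj⟩ := hus m hms
      have hc : c ≠ 0 := by
        rintro rfl
        rw [zero_smul] at hj
        exact b.ne_zero m (by simpa using hj)
      -- `ψ` vanishes on the columns which are already reduced, so the pivot is a new line
      have hjk : j ≠ k := by
        rintro rfl
        have := hψ (b m)
        rw [hj, map_smul, b.repr_self, Finsupp.single_eq_of_ne (Ne.symm hmi), smul_eq_mul] at this
        exact (mul_ne_zero hc hψk) this
      refine ⟨j, c, ?_⟩
      have : u' (c • b j) = c • b j := by
        rw [hu's, map_smul, Finsupp.smul_apply, b.repr_self, Finsupp.single_eq_of_ne hjk.symm]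
        simp
      rw [LinearEquiv.mul_apply, hj]
      conv_lhs => rw [← this]
      exact u'.symm_apply_apply _

theorem linearMove_of_map {hd : DiscreteValues v} {g : W ≃ₗ[K] W} {x y : Fin n → ℝ}
    (hg : (stdLinear hd b x).map g = stdLinear hd b y)
    (hmon : ∀ i, ∃ j, ∃ c : K, g (b i) = c • b j) : linearMove v b g x y := by
  refine ⟨hmon, fun i j c hc => ?_⟩
  have hc0 : c ≠ 0 := by
    rintro rfl
    rw [zero_smul] at hc
    exact b.ne_zero i (by simpa using hc)
  have key : ∀ r, r ≤ x i ↔ r - y j ≤ val v c := by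
    intro r
    have h1 := smul_basis_mem_stdLinear (hd := hd) (b := b) (x := x) (r := r) (c := 1) (k := i)
    rw [one_smul, ← LatticeFunction.apply_mem_map (g := g), hg, hc, smul_basis_mem_stdLinear,
      le_iff_val hc0, le_iff_val one_ne_zero, val_one] at h1
    rw [h1]
    constructor <;> intro h <;> linarith
  have h1 := (key (x i)).1 le_rfl
  have h2 := (key (val v c + y j)).2 (by linarith)
  linarith

/-- The enlarged building of `GL(W)` is identified with the set of lattice functions. -/
theorem exists_isLinearIdent (hd : DiscreteValues v) (b : Module.Basis (Fin n) K W) :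
    ∃ j : LinearBuilding v b → LatticeFunction v W, IsLinearIdent b j := by
  have : FiniteDimensional K W := b.finiteDimensional_of_finite
  obtain ⟨j, hj, hinj, hact⟩ := GlueSpace.exists_map (move := linearMove v b)
    (U := linearUnip v b) (LatticeFunction.map (v := v)) LatticeFunction.map_one
    LatticeFunction.map_mul (stdLinear hd b) (fun _ _ _ => map_stdLinear_of_move)
    (fun _ _ => map_stdLinear_of_mem_unip) (fun g x y hg => by
      obtain ⟨u, hu, hus⟩ := exists_linear_reduction hg n
      have h1 : (stdLinear hd b x).map (u * g) = stdLinear hd b y := by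
        rw [LatticeFunction.map_mul, hg, map_stdLinear_of_mem_unip hu]
      refine ⟨(u * g)⁻¹, linearMove_inv (linearMove_of_map h1 fun i => hus i i.2), ?_⟩
      rw [mul_inv_rev, mul_inv_cancel_left]
      exact Subgroup.inv_mem _ hu)
  refine ⟨j, ⟨hinj, fun L => ?_⟩, fun g p r y => ?_, fun g x y t _ => ?_⟩
  · have hn : Module.finrank K W = n := by simp [Module.finrank_eq_card_basis b]
    obtain ⟨b', l, hl⟩ := L.exists_splitBy hd hn
    refine ⟨GlueSpace.mk _ _ (b.equiv b' (Equiv.refl _)) fun k => -l k, ?_⟩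
    rw [hj]
    have h1 := (LatticeFunction.splitBy_ofBasis hd b fun k => - -l k).map
      (b.equiv b' (Equiv.refl _))
    have h2 : b.map (b.equiv b' (Equiv.refl _)) = b' := by
      ext k
      simp
    rw [h2] at h1
    exact SplitBy.eq h1 (by simpa only [neg_neg] using hl)
  · rw [hact, LatticeFunction.apply_mem_map]
  · rw [hj, hj, hj]
    refine IsBarycenter.map ⟨n, b, _, _, LatticeFunction.splitBy_ofBasis hd b _,
      LatticeFunction.splitBy_ofBasis hd b _, ?_⟩ g
    have := LatticeFunction.splitBy_ofBasis hd b fun k => -((t • x + (1 - t) • y) k)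
    convert this using 2 with k
    simp
    ring

end LinearIdent

/-! ### Hermitian forms over complete fields -/

section Hensel

variable {K : Type*} [Field K] {v : AddValuation K (WithTop ℝ)} {τ : K →+* K}

theorem eq_zero_of_forall_le {x : K} {δ : ℝ} (hδ : 0 < δ)
    (h : ∀ n : ℕ, ((n * δ : ℝ) : WithTop ℝ) ≤ v x) : x = 0 := by
  by_contra hx
  obtain ⟨n, hn⟩ := exists_nat_gt (val v x / δ)
  rw [div_lt_iff₀ hδ] at hn
  exact absurd ((le_iff_val hx).1 (h n)) (not_le.2 hn)

/-- Hensel's lemma for the equation `s = 1 + d s²`, with `d` in the maximal ideal, solved by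
iteration; if `d` is fixed by an isometric `τ`, so is the solution. -/
theorem exists_quadratic_root (hc : CompleteVal v) (hτ : ∀ a, v (τ a) = v a) {d : K}
    (hd : 0 < v d) (hτd : τ d = d) : ∃ s : K, s = 1 + d * s ^ 2 ∧ τ s = s ∧ 0 ≤ v s := by
  by_cases hd0 : d = 0
  · exact ⟨1, by simp [hd0], map_one τ, v.map_one.ge⟩
  set δ := val v d with hδ
  have hδ0 : 0 < δ := (pos_iff_val hd0).1 hd
  let s : ℕ → K := fun n => Nat.rec 1 (fun _ x => 1 + d * x ^ 2) n
  have hs0 : s 0 = 1 := rfl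
  have hs1 : ∀ n, s (n + 1) = 1 + d * s n ^ 2 := fun n => rfl
  have hdv : ((δ : ℝ) : WithTop ℝ) ≤ v d := (coe_val hd0).le
  have hint : ∀ n, ((0 : ℝ) : WithTop ℝ) ≤ v (s n) := by
    intro n
    induction n with
    | zero => rw [hs0, v.map_one]; exact le_rfl
    | succ n ih =>
      rw [hs1]
      refine v.map_le_add (by rw [v.map_one]; exact le_rfl) ?_
      rw [sq]
      exact le_of_le_val (by linarith) (le_mul_val hdv (le_mul_val ih ih))
  have hτs : ∀ n, τ (s n) = s n := by
    intro n
    induction n with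
    | zero => rw [hs0, map_one]
    | succ n ih => rw [hs1, map_add, map_mul, map_pow, ih, hτd, map_one]
  have hstep : ∀ n : ℕ, ((n * δ : ℝ) : WithTop ℝ) ≤ v (s (n + 1) - s n) := by
    intro n
    induction n with
    | zero =>
      rw [Nat.cast_zero, zero_mul]
      exact v.map_le_sub (hint 1) (hint 0)
    | succ n ih =>
      have : s (n + 1 + 1) - s (n + 1) = d * ((s (n + 1) - s n) * (s (n + 1) + s n)) := by
        rw [hs1 (n + 1), hs1 n]; ring
      rw [this]
      refine le_of_le_val ?_ (le_mul_val hdv (le_mul_val ih (v.map_le_add (hint (n + 1)) (hint n))))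
      push_cast
      linarith
  obtain ⟨l, hl⟩ := hc δ hδ0 s hstep
  have hl0 : ((0 : ℝ) : WithTop ℝ) ≤ v l := by
    have := hl 0
    rw [Nat.cast_zero, zero_mul] at this
    have h2 := v.map_le_add this (hint 0)
    rwa [sub_add_cancel] at h2
  refine ⟨l, ?_, ?_, hl0⟩
  · rw [← sub_eq_zero]
    refine eq_zero_of_forall_le (v := v) hδ0 fun n => ?_
    have : l - (1 + d * l ^ 2) = (l - s (n + 1)) - d * ((l - s n) * (l + s n)) := by
      rw [hs1 n]; ring
    rw [this]
    refine v.map_le_sub (le_of_le_val ?_ (hl (n + 1))) (le_of_le_val ?_ (le_mul_val hdv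
      (le_mul_val (hl n) (v.map_le_add hl0 (hint n)))))
    · push_cast; linarith
    · linarith
  · rw [← sub_eq_zero]
    refine eq_zero_of_forall_le (v := v) hδ0 fun n => ?_
    have : τ l - l = τ (l - s n) - (l - s n) := by rw [map_sub, hτs]; ring
    rw [this]
    exact v.map_le_sub (by rw [hτ]; exact hl n) (hl n)

end Hensel

section Hermitian

variable {K : Type*} [Field K] {τ : K →+* K} {W : Type*} [AddCommGroup W] [Module K W]

/-- An `ε`-hermitian form relative to an isometric involution, in residual characteristic
different from `2`. -/
structure HermitianSetting (v : AddValuation K (WithTop ℝ)) (ε : ℤˣ) (h : W →ₛₗ[τ] W →ₗ[K] K) :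
    Prop where
  herm : IsEpsHermitian ε h
  invol : ∀ a, τ (τ a) = a
  isom : ∀ a, v (τ a) = v a
  two : v 2 = 0

variable {v : AddValuation K (WithTop ℝ)} {ε : ℤˣ} {h : W →ₛₗ[τ] W →ₗ[K] K}

theorem two_mul_le_of_forall_lt {a : K} {r : ℝ}
    (ha : ∀ q : ℝ, q < r → ((2 * q : ℝ) : WithTop ℝ) ≤ v a) :
    ((2 * r : ℝ) : WithTop ℝ) ≤ v a := by
  by_cases h0 : a = 0
  · rw [h0]; exact le_zero_val _
  rw [le_iff_val h0]
  by_contra! hlt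
  have := (le_iff_val h0).1 (ha ((val v a / 2 + r) / 2) (by linarith))
  linarith

theorem form_smul_left (c : K) (x y : W) : h (c • x) y = τ c * h x y := by
  rw [LinearMap.map_smulₛₗ, LinearMap.smul_apply, smul_eq_mul]

theorem unit_mul_self (ε : ℤˣ) : ((ε : ℤ) : K) * ((ε : ℤ) : K) = 1 := by
  rw [← Int.cast_mul, ← Units.val_mul, Int.units_mul_self]
  simp

theorem map_unit (ε : ℤˣ) : τ ((ε : ℤ) : K) = ((ε : ℤ) : K) := map_intCast τ _

theorem val_unit (ε : ℤˣ) : v ((ε : ℤ) : K) = 0 := by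
  rcases Int.units_eq_one_or ε with rfl | rfl
  · simp
  · simp [v.map_neg]

theorem IsEpsHermitian.eq_zero (H : IsEpsHermitian ε h) {x y : W} (hxy : h x y = 0) :
    h y x = 0 := by
  rw [H, hxy, map_zero, mul_zero]

namespace HermitianSetting

variable (H : HermitianSetting v ε h)
include H

theorem two_ne_zero : (2 : K) ≠ 0 := by
  intro h2
  have := H.two
  rw [h2, v.map_zero] at this
  exact WithTop.top_ne_zero this

theorem val_half_mul (a : K) : v (a / 2) = v a := by
  have : v (a / 2 * 2) = v a := by rw [div_mul_cancel₀ _ H.two_ne_zero]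
  rwa [v.map_mul, H.two, add_zero] at this

theorem val_swap (x y : W) : v (h y x) = v (h x y) := by
  rw [H.herm, v.map_mul, val_unit, zero_add, H.isom]

/-- If `h x y = 1` and `h x x * h y y` is in the maximal ideal, then the plane spanned by `x` and
`y` contains an isotropic vector close to `x`. -/
theorem exists_isotropic (hc : CompleteVal v) {x y : W} (hxy : h x y = 1)
    (hpos : 0 < v (h x x * h y y)) :
    ∃ c : K, v (h x x) ≤ v c ∧ h (x + c • y) (x + c • y) = 0 := by
  set a := h x x with ha
  set b := h y y with hb
  have h2 := H.two_ne_zero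
  have hee := unit_mul_self (K := K) ε
  have haτ : τ a = ((ε : ℤ) : K) * a := by
    have : a = ((ε : ℤ) : K) * τ a := H.herm x x
    linear_combination (-((ε : ℤ) : K)) * this - τ a * hee
  have hbτ : τ b = ((ε : ℤ) : K) * b := by
    have : b = ((ε : ℤ) : K) * τ b := H.herm y y
    linear_combination (-((ε : ℤ) : K)) * this - τ b * hee
  have hyx : h y x = ((ε : ℤ) : K) := by rw [H.herm, hxy, map_one, mul_one]
  obtain ⟨s, hs, hτs, hvs⟩ := exists_quadratic_root (d := ((ε : ℤ) : K) * (a * b) / 2 / 2)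
    hc H.isom (by rwa [H.val_half_mul, H.val_half_mul, v.map_mul, val_unit, zero_add])
    (by
      rw [map_div₀, map_div₀, map_mul, map_mul, map_unit, haτ, hbτ, map_ofNat]
      linear_combination (((ε : ℤ) : K) * a * b / 2 / 2) * hee)
  -- the equation for `c` reduces to the one for `s` by the substitution `c = -(a / 2) s`
  refine ⟨-(a / 2) * s, ?_, ?_⟩
  · rw [v.map_mul, v.map_neg, H.val_half_mul]
    calc v a = v a + 0 := (add_zero _).symm
      _ ≤ _ := by gcongr
  · have hc' : τ (-(a / 2) * s) = -(((ε : ℤ) : K) * a / 2) * s := by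
      rw [map_mul, map_neg, map_div₀, haτ, hτs, map_ofNat]
    simp only [map_add, LinearMap.add_apply, map_smul, LinearMap.map_smulₛₗ, LinearMap.smul_apply,
      smul_eq_mul, hc', hxy, hyx, ← ha, ← hb]
    have h22 : (2 : K)⁻¹ * 2 = 1 := inv_mul_cancel₀ h2
    linear_combination (-a) * hs - a * s / 2 * hee - a * s * h22

/-- The Cauchy-Schwarz inequality `v (h x y) ≥ (v (h x x) + v (h y y)) / 2` on an anisotropic
plane. -/
theorem cauchy_schwarz (hc : CompleteVal v) {x y : W}
    (han : ∀ c : K, h (x + c • y) (x + c • y) = 0 → x + c • y = 0) {r s : ℝ}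
    (hx : ((2 * r : ℝ) : WithTop ℝ) ≤ v (h x x)) (hy : ((2 * s : ℝ) : WithTop ℝ) ≤ v (h y y)) :
    ((r + s : ℝ) : WithTop ℝ) ≤ v (h x y) := by
  by_contra hcon
  have ht : h x y ≠ 0 := by
    intro h0
    rw [h0] at hcon
    exact hcon (le_zero_val _)
  rw [le_iff_val ht, not_le] at hcon
  set t := h x y with htdef
  have hxy : h x (t⁻¹ • y) = 1 := by
    rw [map_smul, smul_eq_mul, ← htdef, inv_mul_cancel₀ ht]
  have hτt : ((-val v t : ℝ) : WithTop ℝ) ≤ v (τ t⁻¹) := by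
    rw [H.isom, ← val_inv ht]
    exact (coe_val (inv_ne_zero ht)).le
  have ht' : ((-val v t : ℝ) : WithTop ℝ) ≤ v t⁻¹ := by
    rw [← val_inv ht]
    exact (coe_val (inv_ne_zero ht)).le
  have hyy : h (t⁻¹ • y) (t⁻¹ • y) = τ t⁻¹ * (t⁻¹ * h y y) := by
    rw [form_smul_left, map_smul, smul_eq_mul]
  have hpos : 0 < v (h x x * h (t⁻¹ • y) (t⁻¹ • y)) := by
    rw [hyy]
    exact pos_of_le_val (by linarith) (le_mul_val hx (le_mul_val hτt (le_mul_val ht' hy)))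
  obtain ⟨c, hvc, hc0⟩ := H.exists_isotropic hc hxy hpos
  -- the isotropic vector vanishes, so the vectors are proportional and the product is a unit
  rw [smul_smul] at hc0
  have h1 := han _ hc0
  rw [← smul_smul] at h1
  have hx' : x = -(c • t⁻¹ • y) := eq_neg_of_add_eq_zero_left h1
  have hxx : h x x = -c := by
    have : h x x = h x (-(c • t⁻¹ • y)) := by rw [← hx']
    rw [this, map_neg, map_smul, hxy, smul_eq_mul, mul_one]
  have h2 : -(τ c * h (t⁻¹ • y) (t⁻¹ • y)) = 1 := by
    rw [← hxy]
    have : h x (t⁻¹ • y) = h (-(c • t⁻¹ • y)) (t⁻¹ • y) := by rw [← hx']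
    rw [this, map_neg, LinearMap.neg_apply, form_smul_left c]
  have h3 : v (h x x * h (t⁻¹ • y) (t⁻¹ • y)) = 0 := by
    rw [hxx, v.map_mul, v.map_neg, ← H.isom c, ← v.map_mul, ← v.map_neg, h2, v.map_one]
  rw [h3] at hpos
  exact lt_irrefl _ hpos

end HermitianSetting

/-- An isometry of a nondegenerate form on a finite-dimensional space is invertible. -/
theorem exists_isometryGroup [FiniteDimensional K W] (hnd : h.SeparatingLeft) (T : W →ₗ[K] W)
    (hT : ∀ x y, h (T x) (T y) = h x y) : ∃ g : isometryGroup h, ∀ y, g.1 y = T y := by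
  have hinj : Function.Injective T := by
    rw [injective_iff_map_eq_zero]
    intro x hx
    refine hnd x fun y => ?_
    rw [← hT, hx, map_zero, LinearMap.zero_apply]
  exact ⟨⟨LinearEquiv.ofInjectiveEndo T hinj, fun x y => hT x y⟩, fun y => rfl⟩

/-! ### Hyperbolic families -/

/-- The index `-i`. -/
def opp {m : ℕ} (i : Fin m × ℤˣ) : Fin m × ℤˣ := (i.1, -i.2)

theorem opp_opp {m : ℕ} (i : Fin m × ℤˣ) : opp (opp i) = i := by simp [opp]

theorem opp_ne {m : ℕ} (i : Fin m × ℤˣ) : opp i ≠ i := by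
  intro h
  have := congrArg Prod.snd h
  rcases Int.units_eq_one_or i.2 with h' | h' <;> simp [opp, h'] at this

theorem eq_or_eq_opp {m : ℕ} {i j : Fin m × ℤˣ} (h : i.1 = j.1) : i = j ∨ i = opp j := by
  obtain ⟨i1, i2⟩ := i
  obtain ⟨j1, j2⟩ := j
  obtain rfl : i1 = j1 := h
  rcases Int.units_eq_one_or i2 with rfl | rfl <;> rcases Int.units_eq_one_or j2 with rfl | rfl <;>
    simp [opp]

/-- The coordinate `± x_k` of a point of the apartment. -/
def crd {m : ℕ} (x : Fin m → ℝ) (i : Fin m × ℤˣ) : ℝ := ((i.2 : ℤ) : ℝ) * x i.1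

theorem crd_opp {m : ℕ} (x : Fin m → ℝ) (i : Fin m × ℤˣ) : crd x (opp i) = -crd x i := by
  simp [crd, opp]

/-- The vectors of a Witt decomposition, without the condition on the orthogonal complement. -/
structure IsHyperbolic (h : W →ₛₗ[τ] W →ₗ[K] K) {m : ℕ} (f : Fin m × ℤˣ → W) : Prop where
  orth : ∀ i j, j ≠ opp i → h (f i) (f j) = 0
  pair : ∀ k, h (f (k, 1)) (f (k, -1)) = 1

theorem WittFrame.isHyperbolic (w : WittFrame h) : IsHyperbolic h w.e := ⟨w.orth, w.pair⟩

variable (K) in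
/-- The value `h (f (-i)) (f i)` for a hyperbolic family `f`. -/
def sgn (ε : ℤˣ) {m : ℕ} (i : Fin m × ℤˣ) : K := if i.2 = 1 then ((ε : ℤ) : K) else 1

section Sgn

variable {m : ℕ} (i : Fin m × ℤˣ)

theorem sgn_mul_self : sgn K ε i * sgn K ε i = 1 := by
  unfold sgn
  split_ifs
  · exact unit_mul_self ε
  · exact mul_one 1

theorem sgn_mul_opp : sgn K ε i * sgn K ε (opp i) = ((ε : ℤ) : K) := by
  obtain ⟨i1, i2⟩ := i
  rcases Int.units_eq_one_or i2 with rfl | rfl <;> simp [sgn, opp]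

theorem map_sgn : τ (sgn K ε i) = sgn K ε i := by
  unfold sgn
  split_ifs
  · exact map_unit ε
  · exact map_one τ

theorem val_sgn : v (sgn K ε i) = 0 := by
  unfold sgn
  split_ifs
  · exact val_unit ε
  · exact v.map_one

theorem sgn_ne_zero : sgn K ε i ≠ 0 := fun h => by
  have := sgn_mul_self (K := K) (ε := ε) i
  rw [h, zero_mul] at this
  exact zero_ne_one this

end Sgn

variable (ε h) in
/-- The coordinate forms of a hyperbolic family. -/
def coef {m : ℕ} (f : Fin m × ℤˣ → W) (i : Fin m × ℤˣ) : W →ₗ[K] K :=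
  sgn K ε i • h (f (opp i))

variable (ε h) in
/-- The projection onto the orthogonal complement of a hyperbolic family. -/
def part {m : ℕ} (f : Fin m × ℤˣ → W) : W →ₗ[K] W :=
  LinearMap.id - ∑ i, (LinearMap.toSpanSingleton K W (f i)).comp (coef ε h f i)

section Coordinates

variable {m : ℕ} {f : Fin m × ℤˣ → W}

theorem coef_apply (i : Fin m × ℤˣ) (y : W) :
    coef ε h f i y = sgn K ε i * h (f (opp i)) y := rfl

theorem val_coef (i : Fin m × ℤˣ) (y : W) : v (coef ε h f i y) = v (h (f (opp i)) y) := by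
  rw [coef_apply, v.map_mul, val_sgn, zero_add]

theorem part_apply (y : W) : part ε h f y = y - ∑ i, coef ε h f i y • f i := by
  simp [part]

theorem form_eq_coef (i : Fin m × ℤˣ) (y : W) :
    h (f i) y = sgn K ε (opp i) * coef ε h f (opp i) y := by
  rw [coef_apply, opp_opp, ← mul_assoc, sgn_mul_self, one_mul]

theorem eq_sum_add_part (y : W) : y = ∑ i, coef ε h f i y • f i + part ε h f y := by
  rw [part_apply]; abel

theorem coef_of_orth {y : W} (hy : ∀ i, h (f i) y = 0) (i : Fin m × ℤˣ) : coef ε h f i y = 0 := by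
  rw [coef_apply, hy, mul_zero]

theorem part_of_orth {y : W} (hy : ∀ i, h (f i) y = 0) : part ε h f y = y := by
  rw [part_apply]
  simp [coef_of_orth hy]

theorem IsHyperbolic.form_opp (hf : IsHyperbolic h f) (H : IsEpsHermitian ε h) (i : Fin m × ℤˣ) :
    h (f (opp i)) (f i) = sgn K ε i := by
  obtain ⟨k, s⟩ := i
  rcases Int.units_eq_one_or s with rfl | rfl
  · rw [H, show opp (k, (1 : ℤˣ)) = (k, -1) from rfl, hf.pair]
    simp [sgn]
  · have : opp (k, (-1 : ℤˣ)) = (k, 1) := by simp [opp]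
    rw [this, hf.pair]
    simp [sgn]

theorem IsHyperbolic.form_self (hf : IsHyperbolic h f) (i : Fin m × ℤˣ) : h (f i) (f i) = 0 :=
  hf.orth i i (opp_ne i).symm

theorem IsHyperbolic.coef_self (hf : IsHyperbolic h f) (H : IsEpsHermitian ε h)
    (i : Fin m × ℤˣ) : coef ε h f i (f i) = 1 := by
  rw [coef_apply, hf.form_opp H, sgn_mul_self]

theorem IsHyperbolic.coef_ne (hf : IsHyperbolic h f) {i j : Fin m × ℤˣ} (hij : i ≠ j) :
    coef ε h f i (f j) = 0 := by
  rw [coef_apply, hf.orth _ _ (by rw [opp_opp]; exact hij.symm), mul_zero]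

theorem IsHyperbolic.ne_zero (hf : IsHyperbolic h f) (H : IsEpsHermitian ε h) (i : Fin m × ℤˣ) :
    f i ≠ 0 := by
  intro h0
  have := hf.coef_self H i
  rw [h0, map_zero] at this
  exact zero_ne_one this

theorem IsHyperbolic.orth_part (hf : IsHyperbolic h f) (H : IsEpsHermitian ε h)
    (i : Fin m × ℤˣ) (y : W) : h (f i) (part ε h f y) = 0 := by
  rw [part_apply, map_sub, map_sum, Finset.sum_eq_single (opp i)]
  · have := hf.form_opp H (opp i)
    rw [opp_opp] at this
    rw [map_smul, this, form_eq_coef (ε := ε) i y, smul_eq_mul]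
    ring
  · intro j _ hj
    rw [map_smul, hf.orth i j hj, smul_zero]
  · simp

theorem IsHyperbolic.part_self (hf : IsHyperbolic h f) (H : IsEpsHermitian ε h)
    (i : Fin m × ℤˣ) : part ε h f (f i) = 0 := by
  rw [part_apply, Finset.sum_eq_single i, hf.coef_self H, one_smul, sub_self]
  · intro j _ hj
    rw [hf.coef_ne hj, zero_smul]
  · simp

theorem IsHyperbolic.linearIndependent (hf : IsHyperbolic h f) (H : IsEpsHermitian ε h) :
    LinearIndependent K f :=
  LinearIndependent.of_pairwise_dual_eq_zero_one f (coef ε h f)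
    (fun _ _ hij => hf.coef_ne hij) (fun i => hf.coef_self H i)

/-- The form in the coordinates of a hyperbolic family. -/
theorem IsHyperbolic.form_expand (hf : IsHyperbolic h f) (H : IsEpsHermitian ε h) (y y' : W) :
    h y y' = ∑ i, τ (coef ε h f i y) * (sgn K ε (opp i) * coef ε h f (opp i) y') +
      h (part ε h f y) (part ε h f y') := by
  have h1 : h (part ε h f y) y' = h (part ε h f y) (part ε h f y') := by
    conv_lhs => rw [eq_sum_add_part (ε := ε) (h := h) (f := f) y']
    rw [map_add, map_sum, Finset.sum_eq_zero, zero_add]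
    intro i _
    rw [map_smul, H.eq_zero (hf.orth_part H i y), smul_zero]
  conv_lhs => rw [eq_sum_add_part (ε := ε) (h := h) (f := f) y]
  rw [map_add, LinearMap.add_apply, h1, map_sum, LinearMap.sum_apply]
  congr 1
  refine Finset.sum_congr rfl fun i _ => ?_
  rw [LinearMap.map_smulₛₗ, LinearMap.smul_apply, smul_eq_mul, form_eq_coef (ε := ε)]

/-- Two hyperbolic families with the same orthogonal complement are conjugate by an isometry which
is trivial on the complement. -/
theorem IsHyperbolic.exists_isometry [FiniteDimensional K W] (hf : IsHyperbolic h f)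
    (H : IsEpsHermitian ε h) (hnd : h.SeparatingLeft) {f' : Fin m × ℤˣ → W}
    (hf' : IsHyperbolic h f') (hff : ∀ z, (∀ i, h (f i) z = 0) → ∀ i, h (f' i) z = 0) :
    ∃ g : isometryGroup h, (∀ i, g.1 (f i) = f' i) ∧ ∀ z, (∀ i, h (f i) z = 0) → g.1 z = z := by
  let T : W →ₗ[K] W := ∑ i, (LinearMap.toSpanSingleton K W (f' i)).comp (coef ε h f i) +
    part ε h f
  have hT : ∀ y, T y = ∑ i, coef ε h f i y • f' i + part ε h f y := fun y => by simp [T]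
  have horth : ∀ y i, h (f' i) (part ε h f y) = 0 := fun y =>
    hff _ fun i => hf.orth_part H i y
  have hcoef : ∀ i y, coef ε h f' i (T y) = coef ε h f i y := by
    intro i y
    rw [hT, map_add, coef_of_orth (horth y), add_zero, map_sum, Finset.sum_eq_single i]
    · rw [map_smul, hf'.coef_self H, smul_eq_mul, mul_one]
    · intro j _ hj
      rw [map_smul, hf'.coef_ne hj.symm, smul_zero]
    · simp
  have hpart : ∀ y, part ε h f' (T y) = part ε h f y := by
    intro y
    rw [part_apply]
    simp only [hcoef]
    rw [hT]
    abel
  obtain ⟨g, hg⟩ := exists_isometryGroup hnd T fun x y => by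
    rw [hf'.form_expand H (T x), hf.form_expand H x]
    simp only [hcoef, hpart]
  refine ⟨g, fun i => ?_, fun z hz => ?_⟩
  · rw [hg, hT, hf.part_self H, add_zero, Finset.sum_eq_single i, hf.coef_self H, one_smul]
    · intro j _ hj
      rw [hf.coef_ne hj, zero_smul]
    · simp
  · rw [hg, hT, part_of_orth hz]
    simp [coef_of_orth hz]

variable (ε h f) in
/-- The Eichler transformation with parameters `z ∈ f(i)^⊥` and `k`. -/
def eichler (i : Fin m × ℤˣ) (z : W) (k : K) : W →ₗ[K] W :=
  LinearMap.id + (LinearMap.toSpanSingleton K W (z + k • f i)).comp (coef ε h f (opp i)) -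
    (LinearMap.toSpanSingleton K W (f i)).comp (sgn K ε i • h z)

theorem eichler_apply (i : Fin m × ℤˣ) (z : W) (k : K) (y : W) :
    eichler ε h f i z k y =
      y + coef ε h f (opp i) y • (z + k • f i) - (sgn K ε i * h z y) • f i := by
  simp [eichler]

/-- The condition on the parameters for an Eichler transformation to be an isometry. -/
def EichlerCond (ε : ℤˣ) (h : W →ₛₗ[τ] W →ₗ[K] K) (i : Fin m × ℤˣ) (z : W) (k : K) : Prop :=
  sgn K ε i * k + sgn K ε (opp i) * τ k + h z z = 0

theorem IsHyperbolic.eichler_isometry (hf : IsHyperbolic h f) (H : IsEpsHermitian ε h)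
    {i : Fin m × ℤˣ} {z : W} {k : K} (hz : h (f i) z = 0) (hk : EichlerCond ε h i z k) (x y : W) :
    h (eichler ε h f i z k x) (eichler ε h f i z k y) = h x y := by
  have hz' : h z (f i) = 0 := H.eq_zero hz
  have hs1 := sgn_mul_self (K := K) (ε := ε) i
  have hs2 := sgn_mul_self (K := K) (ε := ε) (opp i)
  have hs3 := sgn_mul_opp (K := K) (ε := ε) i
  have hfy : ∀ y, h (f i) y = sgn K ε (opp i) * coef ε h f (opp i) y := form_eq_coef i
  have hxf : ∀ x, h x (f i) = sgn K ε i * τ (coef ε h f (opp i) x) := by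
    intro x
    rw [H, hfy, map_mul, map_sgn, ← hs3]
    linear_combination (sgn K ε i * τ (coef ε h f (opp i) x)) * hs2
  have hxz : h x z = ((ε : ℤ) : K) * τ (h z x) := H z x
  have hff : h (f i) (f i) = 0 := hf.form_self i
  unfold EichlerCond at hk
  simp only [eichler_apply, map_add, map_sub, LinearMap.add_apply, LinearMap.sub_apply,
    LinearMap.map_smulₛₗ, LinearMap.smul_apply, smul_eq_mul, map_mul, map_sgn, RingHom.id_apply,
    hz, hz', hff]
  rw [hxf x, hfy y, hxz, ← hs3]
  generalize coef ε h f (opp i) x = p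
  generalize coef ε h f (opp i) y = q
  generalize h z x = A
  generalize h z y = B
  linear_combination (τ p * q) * hk - (τ p * B) * hs1

end Coordinates

end Hermitian

/-! ### The standard self-dual filtrations -/

section Standard

theorem ne_of_fst_ne {m : ℕ} {i j : Fin m × ℤˣ} (h : i.1 ≠ j.1) : i ≠ j := fun e =>
  h (congrArg Prod.fst e)

variable {K : Type*} [Field K] {τ : K →+* K} {W : Type*} [AddCommGroup W] [Module K W]
  {v : AddValuation K (WithTop ℝ)} {ε : ℤˣ} {h : W →ₛₗ[τ] W →ₗ[K] K}
  {m : ℕ} {f : Fin m × ℤˣ → W}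

/-- Membership in the step `r` of the standard filtration attached to the point `x` of the
apartment of a hyperbolic family: on the line of `f i` the norm of `f i` is the coordinate of `x`,
on the orthogonal complement the norm is `z ↦ v (h z z) / 2`. -/
def InStd (v : AddValuation K (WithTop ℝ)) (ε : ℤˣ) (h : W →ₛₗ[τ] W →ₗ[K] K) (f : Fin m × ℤˣ → W)
    (x : Fin m → ℝ) (r : ℝ) (y : W) : Prop :=
  (∀ i, ((r - crd x i : ℝ) : WithTop ℝ) ≤ v (coef ε h f i y)) ∧
    ((2 * r : ℝ) : WithTop ℝ) ≤ v (h (part ε h f y) (part ε h f y))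

/-- The Cauchy-Schwarz inequality on the orthogonal complement of `f`. -/
def OrthCauchySchwarz (v : AddValuation K (WithTop ℝ)) (h : W →ₛₗ[τ] W →ₗ[K] K)
    (f : Fin m × ℤˣ → W) : Prop :=
  ∀ z z', (∀ i, h (f i) z = 0) → (∀ i, h (f i) z' = 0) → ∀ r s : ℝ,
    ((2 * r : ℝ) : WithTop ℝ) ≤ v (h z z) → ((2 * s : ℝ) : WithTop ℝ) ≤ v (h z' z') →
      ((r + s : ℝ) : WithTop ℝ) ≤ v (h z z')

theorem HermitianSetting.orthCauchySchwarz (H : HermitianSetting v ε h) (hc : CompleteVal v)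
    (w : WittFrame h) : OrthCauchySchwarz v h w.e := fun z z' hz hz' r s hr hs =>
  H.cauchy_schwarz hc (fun c hc => w.aniso _ (fun i => by
    rw [map_add, map_smul, hz, hz', smul_zero, add_zero]) hc) hr hs

variable (H : HermitianSetting v ε h) (hf : IsHyperbolic h f) (hCS : OrthCauchySchwarz v h f)
include H hf hCS

omit H hf in
theorem two_mul_le_form_add {z z' : W} (hz : ∀ i, h (f i) z = 0) (hz' : ∀ i, h (f i) z' = 0) {r : ℝ}
    (hr : ((2 * r : ℝ) : WithTop ℝ) ≤ v (h z z)) (hr' : ((2 * r : ℝ) : WithTop ℝ) ≤ v (h z' z')) :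
    ((2 * r : ℝ) : WithTop ℝ) ≤ v (h (z + z') (z + z')) := by
  have h1 : h (z + z') (z + z') = h z z + h z' z + (h z z' + h z' z') := by
    simp only [map_add, LinearMap.add_apply]
  have h2 : ∀ {a b : W}, (∀ i, h (f i) a = 0) → (∀ i, h (f i) b = 0) →
      ((2 * r : ℝ) : WithTop ℝ) ≤ v (h a a) → ((2 * r : ℝ) : WithTop ℝ) ≤ v (h b b) →
      ((2 * r : ℝ) : WithTop ℝ) ≤ v (h a b) := fun ha hb h1 h2 =>
    le_of_le_val (by linarith) (hCS _ _ ha hb r r h1 h2)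
  rw [h1]
  exact v.map_le_add (v.map_le_add hr (h2 hz' hz hr' hr)) (v.map_le_add (h2 hz hz' hr hr') hr')

theorem isFiltration_inStd (x : Fin m → ℝ) : IsFiltration v (InStd v ε h f x) where
  zero r := ⟨fun i => by rw [map_zero]; exact le_zero_val _, by
    rw [map_zero, map_zero]; exact le_zero_val _⟩
  add {r y y'} hy hy' := by
    refine ⟨fun i => ?_, ?_⟩
    · rw [map_add]
      exact v.map_le_add (hy.1 i) (hy'.1 i)
    · rw [map_add]
      exact two_mul_le_form_add hCS (fun i => hf.orth_part H.herm i y)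
        (fun i => hf.orth_part H.herm i y') hy.2 hy'.2
  smul {c t r y} hc hy := by
    refine ⟨fun i => ?_, ?_⟩
    · rw [map_smul, smul_eq_mul]
      exact le_of_le_val (by linarith) (le_mul_val hc (hy.1 i))
    · rw [map_smul, form_smul_left, map_smul, smul_eq_mul]
      have hc' : (t : WithTop ℝ) ≤ v (τ c) := by rwa [H.isom]
      exact le_of_le_val (by linarith) (le_mul_val hc' (le_mul_val hc hy.2))
  anti h hy := ⟨fun i => le_of_le_val (by linarith) (hy.1 i), le_of_le_val (by linarith) hy.2⟩
  left {r y} hy := by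
    refine ⟨fun i => ?_, two_mul_le_of_forall_lt fun q hq => (hy q hq).2⟩
    by_cases h0 : coef ε h f i y = 0
    · rw [h0]; exact le_zero_val _
    rw [le_iff_val h0]
    refine le_of_forall_lt_imp_le_of_dense fun q hq => ?_
    have := (le_iff_val h0).1 ((hy (q + crd x i) (by linarith)).1 i)
    linarith
  exh y := by
    classical
    have h1 : ∀ a : K, ∃ t : ℝ, (t : WithTop ℝ) ≤ v a := fun a => by
      by_cases h0 : a = 0
      · exact ⟨0, by rw [h0]; exact le_zero_val _⟩
      · exact ⟨_, (coe_val h0).le⟩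
    choose t ht using fun i => h1 (coef ε h f i y)
    obtain ⟨t', ht'⟩ := h1 (h (part ε h f y) (part ε h f y))
    obtain ⟨M, hM⟩ := (Finset.univ.image fun i => -(t i + crd x i)).exists_le
    refine ⟨min (-M) (t' / 2), fun i => le_of_le_val ?_ (ht i), le_of_le_val ?_ ht'⟩
    · have := hM _ (Finset.mem_image_of_mem (fun i => -(t i + crd x i)) (Finset.mem_univ i))
      have := min_le_left (-M) (t' / 2)
      linarith
    · have := min_le_right (-M) (t' / 2)
      linarith

omit hCS in
theorem inStd_smul_iff {x : Fin m → ℝ} {i : Fin m × ℤˣ} {c : K} {r : ℝ} :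
    InStd v ε h f x r (c • f i) ↔ ((r - crd x i : ℝ) : WithTop ℝ) ≤ v c := by
  constructor
  · intro hr
    have := hr.1 i
    rwa [map_smul, hf.coef_self H.herm, smul_eq_mul, mul_one] at this
  · intro hr
    refine ⟨fun j => ?_, ?_⟩
    · by_cases hj : j = i
      · subst hj
        rwa [map_smul, hf.coef_self H.herm, smul_eq_mul, mul_one]
      · rw [map_smul, hf.coef_ne hj, smul_zero]
        exact le_zero_val _
    · rw [map_smul, hf.part_self H.herm, smul_zero, map_zero]
      exact le_zero_val _

omit hCS in
theorem inStd_self (x : Fin m → ℝ) (i : Fin m × ℤˣ) : InStd v ε h f x (crd x i) (f i) := by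
  have := (inStd_smul_iff H hf (x := x) (i := i) (c := 1) (r := crd x i)).2
    (by rw [sub_self, v.map_one]; exact le_rfl)
  rwa [one_smul] at this

omit H hf hCS in
theorem inStd_orth_iff {x : Fin m → ℝ} {z : W} (hz : ∀ i, h (f i) z = 0) {r : ℝ} :
    InStd v ε h f x r z ↔ ((2 * r : ℝ) : WithTop ℝ) ≤ v (h z z) := by
  unfold InStd
  rw [part_of_orth hz]
  exact ⟨fun h => h.2, fun h => ⟨fun i => by rw [coef_of_orth hz]; exact le_zero_val _, h⟩⟩

theorem le_form_of_inStd {x : Fin m → ℝ} {r s : ℝ} {y y' : W} (hy : InStd v ε h f x r y)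
    (hy' : InStd v ε h f x s y') : ((r + s : ℝ) : WithTop ℝ) ≤ v (h y y') := by
  rw [hf.form_expand H.herm]
  refine v.map_le_add (v.map_le_sum fun i _ => ?_)
    (hCS _ _ (fun i => hf.orth_part H.herm i y) (fun i => hf.orth_part H.herm i y') r s hy.2 hy'.2)
  rw [v.map_mul, H.isom, v.map_mul, val_sgn, zero_add, ← v.map_mul]
  refine le_of_le_val ?_ (le_mul_val (hy.1 i) (hy'.1 (opp i)))
  rw [crd_opp]
  linarith

/-- The standard filtrations are self-dual. -/
theorem inStd_iff_dual (x : Fin m → ℝ) (r : ℝ) (y : W) :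
    InStd v ε h f x r y ↔ ∀ s > -r, ∀ y', InStd v ε h f x s y' → 0 < v (h y y') := by
  constructor
  · intro hy s hs y' hy'
    exact pos_of_le_val (by linarith) (le_form_of_inStd H hf hCS hy hy')
  · intro hy
    refine ⟨fun i => ?_, ?_⟩
    · by_contra hcon
      have h0 : coef ε h f i y ≠ 0 := by
        intro h0
        rw [h0] at hcon
        exact hcon (le_zero_val _)
      rw [le_iff_val h0, not_le] at hcon
      have h1 : h y (f (opp i)) ≠ 0 := by
        intro h1
        rw [coef_apply, H.herm.eq_zero h1, mul_zero] at h0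
        exact h0 rfl
      have h2 : val v (h y (f (opp i))) = val v (coef ε h f i y) :=
        val_eq_of (by rw [← H.val_swap, ← val_coef (ε := ε), coe_val h0])
      have h3 := hy (-val v (coef ε h f i y) - crd x i) (by linarith)
        ((h y (f (opp i)))⁻¹ • f (opp i)) ((inStd_smul_iff H hf).2 (by
          rw [le_iff_val (inv_ne_zero h1), val_inv h1, h2, crd_opp]
          linarith))
      rw [map_smul, smul_eq_mul, inv_mul_cancel₀ h1, v.map_one] at h3
      exact lt_irrefl _ h3
    · set z := part ε h f y with hz
      have hzo : ∀ i, h (f i) z = 0 := fun i => hf.orth_part H.herm i y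
      by_contra hcon
      have h0 : h z z ≠ 0 := by
        intro h0
        rw [h0] at hcon
        exact hcon (le_zero_val _)
      rw [le_iff_val h0, not_le] at hcon
      have hyz : h y z = h z z := by
        rw [hf.form_expand H.herm, part_of_orth hzo, ← hz]
        simp [coef_of_orth hzo]
      have h3 := hy (-(val v (h z z) / 2)) (by linarith) ((h z z)⁻¹ • z)
        ((inStd_orth_iff fun i => by rw [map_smul, hzo, smul_zero]).2 (by
          rw [form_smul_left, map_smul, smul_eq_mul, inv_mul_cancel₀ h0, mul_one, H.isom,
            le_iff_val (inv_ne_zero h0), val_inv h0]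
          linarith))
      rw [map_smul, smul_eq_mul, hyz, inv_mul_cancel₀ h0, v.map_one] at h3
      exact lt_irrefl _ h3

/-- By self-duality, an isometry which maps a standard filtration into another maps it onto it. -/
theorem inStd_apply_iff {x x' : Fin m → ℝ} {g : isometryGroup h}
    (hg : ∀ r y, InStd v ε h f x r y → InStd v ε h f x' r (g.1 y)) (r : ℝ) (y : W) :
    InStd v ε h f x' r (g.1 y) ↔ InStd v ε h f x r y := by
  refine ⟨fun hy => ?_, hg r y⟩
  rw [inStd_iff_dual H hf hCS]
  intro s hs y' hy'
  rw [← g.2 y y']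
  exact (inStd_iff_dual H hf hCS x' r (g.1 y)).1 hy s hs _ (hg s y' hy')

/-- To check that an isometry maps a standard filtration to another, it is enough to consider the
vectors of the hyperbolic family and of its orthogonal complement. -/
theorem inStd_apply_iff_of_generators {x x' : Fin m → ℝ} {g : isometryGroup h}
    (h1 : ∀ i, InStd v ε h f x' (crd x i) (g.1 (f i)))
    (h2 : ∀ r z, (∀ i, h (f i) z = 0) → ((2 * r : ℝ) : WithTop ℝ) ≤ v (h z z) →
      InStd v ε h f x' r (g.1 z)) (r : ℝ) (y : W) :
    InStd v ε h f x' r (g.1 y) ↔ InStd v ε h f x r y := by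
  have hF := isFiltration_inStd H hf hCS x'
  refine inStd_apply_iff H hf hCS (fun r y hy => ?_) r y
  rw [eq_sum_add_part (ε := ε) (h := h) (f := f) y, map_add, map_sum]
  refine hF.add (hF.sum _ _ fun i _ => ?_)
    (h2 r _ (fun i => hf.orth_part H.herm i y) hy.2)
  rw [map_smul]
  exact hF.anti (by linarith) (hF.smul (hy.1 i) (h1 i))

end Standard

section Unipotent

variable {K : Type*} [Field K] {τ : K →+* K} {W : Type*} [AddCommGroup W] [Module K W]
  {v : AddValuation K (WithTop ℝ)} {ε : ℤˣ} {h : W →ₛₗ[τ] W →ₗ[K] K}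
  {w : WittFrame h}

variable (H : HermitianSetting v ε h) (hCS : OrthCauchySchwarz v h w.e)
include H hCS

/-- The group `U_x` stabilizes the standard filtration attached to `x`. -/
theorem inStd_apply_iff_of_mem_unip {x : Fin w.rank → ℝ} {u : isometryGroup h}
    (hu : u ∈ w.unip v x) :
    ∀ r y, InStd v ε h w.e x r (u.1 y) ↔ InStd v ε h w.e x r y := by
  have hf := w.isHyperbolic
  have hF := isFiltration_inStd H hf hCS x
  induction hu using Subgroup.closure_induction with
  | mem u hu =>
    rcases hu with ⟨i, j, c, ⟨hij, hui, ⟨c', huj⟩, hul, huo⟩, hc⟩ |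
      ⟨i, z, k, ⟨hz, hui, hul, huo⟩, hk⟩
    · change ((-(crd x i + crd x j) : ℝ) : WithTop ℝ) ≤ v c at hc
      change u.1 (w.e (opp i)) = w.e (opp i) + c • w.e j at hui
      change u.1 (w.e (opp j)) = w.e (opp j) + c' • w.e i at huj
      have hne : opp j ≠ opp i := fun h => hij (congrArg Prod.fst h).symm
      -- `c'` is determined by `c`, since `u` is an isometry
      have hc' : v c' = v c := by
        have h1 : h (u.1 (w.e (opp i))) (u.1 (w.e (opp j))) = 0 := by
          rw [u.2]
          exact hf.orth _ _ (by rw [opp_opp]; exact fun h => hij (congrArg Prod.fst h).symm)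
        rw [hui, huj, map_add, map_add, LinearMap.add_apply, LinearMap.add_apply,
          hf.orth (opp i) (opp j) (by rw [opp_opp]; exact fun h => hij (congrArg Prod.fst h).symm),
          form_smul_left, form_smul_left, map_smul, hf.form_opp H.herm, map_smul,
          hf.orth j i (ne_of_fst_ne (i := i) (j := opp j) hij)] at h1
        have h2 : h (w.e j) (w.e (opp j)) = sgn K ε (opp j) := by
          have := hf.form_opp H.herm (opp j)
          rwa [opp_opp] at this
        rw [h2, smul_zero, mul_zero, add_zero, zero_add, smul_eq_mul] at h1
        have h3 : v (c' * sgn K ε i) = v (τ c * sgn K ε (opp j)) := by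
          rw [eq_neg_of_add_eq_zero_right h1, v.map_neg]
        rwa [v.map_mul, v.map_mul, val_sgn, val_sgn, add_zero, add_zero, H.isom] at h3
      refine inStd_apply_iff_of_generators H hf hCS (fun l => ?_) fun r z hz hr => ?_
      · by_cases hli : l = opp i
        · rw [hli, hui]
          refine hF.add (inStd_self H hf x _) ((inStd_smul_iff H hf).2 ?_)
          refine le_of_le_val ?_ hc
          rw [crd_opp]; linarith
        · by_cases hlj : l = opp j
          · rw [hlj, huj]
            refine hF.add (inStd_self H hf x _) ((inStd_smul_iff H hf).2 ?_)
            rw [hc']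
            refine le_of_le_val ?_ hc
            rw [crd_opp]; linarith
          · rw [hul l hli hlj]
            exact inStd_self H hf x l
      · rw [huo z hz]
        exact (inStd_orth_iff hz).2 hr
    · change ((-(2 * crd x i) : ℝ) : WithTop ℝ) ≤ v k at hk
      change u.1 (w.e (opp i)) = w.e (opp i) + z + k • w.e i at hui
      change ∀ l, h (w.e l) z = 0 at hz
      have hpair : h (w.e i) (w.e (opp i)) = sgn K ε (opp i) := by
        have := hf.form_opp H.herm (opp i)
        rwa [opp_opp] at this
      have hz' : ∀ l, h z (w.e l) = 0 := fun l => H.herm.eq_zero (hz l)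
      -- `h z z` is determined by `k`, since `u` is an isometry
      have hzz : ((2 * (-crd x i) : ℝ) : WithTop ℝ) ≤ v (h z z) := by
        have h1 : h (u.1 (w.e (opp i))) (u.1 (w.e (opp i))) = 0 := by
          rw [u.2]; exact hf.form_self _
        rw [hui] at h1
        simp only [map_add, LinearMap.add_apply, map_smul, form_smul_left, hf.form_self,
          hf.form_opp H.herm, hz, hz', hpair, smul_eq_mul, mul_zero, add_zero,
          zero_add] at h1
        have h2 : h z z = -(τ k * sgn K ε (opp i)) - k * sgn K ε i := by
          linear_combination h1
        rw [h2]
        refine v.map_le_sub ?_ ?_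
        · rw [v.map_neg, v.map_mul, val_sgn, add_zero, H.isom]
          exact le_of_le_val (by linarith) hk
        · rw [v.map_mul, val_sgn, add_zero]
          exact le_of_le_val (by linarith) hk
      refine inStd_apply_iff_of_generators H hf hCS (fun l => ?_) fun r y hy hr => ?_
      · by_cases hli : l = opp i
        · rw [hli, hui]
          refine hF.add (hF.add (inStd_self H hf x _) ?_) ((inStd_smul_iff H hf).2 ?_)
          · rw [crd_opp]
            exact (inStd_orth_iff hz).2 hzz
          · refine le_of_le_val ?_ hk
            rw [crd_opp]; linarith
        · rw [hul l hli]
          exact inStd_self H hf x l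
      · obtain ⟨c, hc⟩ := huo y hy
        have h1 : h (u.1 (w.e (opp i))) (u.1 y) = 0 := by rw [u.2]; exact hy _
        rw [hui, hc] at h1
        simp only [map_add, LinearMap.add_apply, map_smul, form_smul_left, hf.form_self,
          hf.form_opp H.herm, hy, hz', smul_eq_mul, mul_zero, add_zero,
          zero_add] at h1
        have h2 : v c = v (h z y) := by
          have : v (c * sgn K ε i) = v (h z y) := by
            rw [show c * sgn K ε i = -h z y by linear_combination h1, v.map_neg]
          rwa [v.map_mul, val_sgn, add_zero] at this
        rw [hc]
        refine hF.add ((inStd_orth_iff hy).2 hr) ((inStd_smul_iff H hf).2 ?_)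
        rw [h2]
        exact le_of_le_val (by linarith) (hCS z y hz hy _ _ hzz hr)
  | one => exact fun r y => Iff.rfl
  | mul u u' _ _ h1 h2 => exact fun r y => (h1 r (u'.1 y)).trans (h2 r y)
  | inv u _ h1 =>
    intro r y
    have := h1 r (u⁻¹.1 y)
    rw [← this]
    change InStd v ε h w.e x r (u.1 (u.1.symm y)) ↔ _
    rw [u.1.apply_symm_apply]

omit hCS in
/-- Composition of Eichler transformations. -/
theorem eichler_comp {i : Fin w.rank × ℤˣ} {z z' : W} {k k' : K} (hz : h (w.e i) z = 0)
    (hz' : h (w.e i) z' = 0) (y : W) :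
    eichler ε h w.e i z k (eichler ε h w.e i z' k' y) =
      eichler ε h w.e i (z + z') (k + k' - sgn K ε i * h z z') y := by
  have hf := w.isHyperbolic
  have h1 : h z (w.e i) = 0 := H.herm.eq_zero hz
  have h2 : ∀ y, coef ε h w.e (opp i) (eichler ε h w.e i z' k' y) = coef ε h w.e (opp i) y := by
    intro y
    rw [eichler_apply]
    simp only [map_add, map_sub, map_smul, hf.coef_ne (opp_ne i), smul_eq_mul, mul_zero, sub_zero]
    rw [coef_apply (opp i) z', opp_opp, hz']
    ring
  rw [eichler_apply i z k, h2]
  simp only [eichler_apply, map_add, map_sub, map_smul, h1, LinearMap.add_apply, smul_eq_mul,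
    mul_zero, sub_zero, add_zero]
  module

omit hCS in
theorem EichlerCond.comp {i : Fin w.rank × ℤˣ} {z z' : W} {k k' : K}
    (hk : EichlerCond ε h i z k) (hk' : EichlerCond ε h i z' k') :
    EichlerCond ε h i (z + z') (k + k' - sgn K ε i * h z z') := by
  unfold EichlerCond at *
  have h1 : h z' z = ((ε : ℤ) : K) * τ (h z z') := H.herm z z'
  simp only [map_add, map_sub, map_mul, map_sgn, LinearMap.add_apply, h1]
  linear_combination hk + hk' - h z z' * sgn_mul_self (K := K) (ε := ε) i -
    τ (h z z') * sgn_mul_opp (K := K) (ε := ε) i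

variable [FiniteDimensional K W] (hnd : h.SeparatingLeft)
include hnd

/-- Eichler transformations with parameters in the appropriate steps of the standard filtration
belong to `U_x`. -/
theorem eichler_mem_unip {x : Fin w.rank → ℝ} {i : Fin w.rank × ℤˣ} {z : W} {k : K}
    (hz : h (w.e i) z = 0) (hz' : h (w.e (opp i)) z = 0)
    (hzx : InStd v ε h w.e x (-crd x i) z) (hk : ((-(2 * crd x i) : ℝ) : WithTop ℝ) ≤ v k)
    (hcond : EichlerCond ε h i z k) :
    ∃ u ∈ w.unip v x, ∀ y, u.1 y = eichler ε h w.e i z k y := by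
  classical
  have hf := w.isHyperbolic
  have hF := isFiltration_inStd H hf hCS x
  -- the roots `a_i` and `2 a_i`
  have hsingle : ∀ z k, (∀ l, h (w.e l) z = 0) → ((-(2 * crd x i) : ℝ) : WithTop ℝ) ≤ v k →
      EichlerCond ε h i z k → ∃ u ∈ w.unip v x, ∀ y, u.1 y = eichler ε h w.e i z k y := by
    intro z k hz hk hcond
    have hz' : ∀ l, h z (w.e l) = 0 := fun l => H.herm.eq_zero (hz l)
    obtain ⟨u, hu⟩ := exists_isometryGroup hnd _ (hf.eichler_isometry H.herm (hz i) hcond)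
    refine ⟨u, Subgroup.subset_closure (Or.inr ⟨i, z, k, ⟨hz, ?_, fun l hl => ?_, fun y hy => ?_⟩,
      hk⟩), hu⟩
    · change u.1 (w.e (opp i)) = w.e (opp i) + z + k • w.e i
      rw [hu, eichler_apply, hf.coef_self H.herm, hz', one_smul, mul_zero, zero_smul, sub_zero,
        add_assoc]
    · rw [hu, eichler_apply, hf.coef_ne (i := opp i) (j := l) (Ne.symm hl), hz', zero_smul, mul_zero,
        zero_smul, sub_zero, add_zero]
    · refine ⟨-(sgn K ε i * h z y), ?_⟩
      rw [hu, eichler_apply, coef_of_orth hy, zero_smul, add_zero, neg_smul, sub_eq_add_neg]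
  -- the roots `a_i + a_l`
  have hshort : ∀ l c, i.1 ≠ l.1 → ((-(crd x i + crd x l) : ℝ) : WithTop ℝ) ≤ v c →
      EichlerCond ε h i (c • w.e l) 0 ∧
        ∃ u ∈ w.unip v x, ∀ y, u.1 y = eichler ε h w.e i (c • w.e l) 0 y := by
    intro l c hil hc
    have hcond : EichlerCond ε h i (c • w.e l) 0 := by
      unfold EichlerCond
      rw [form_smul_left, map_smul, hf.form_self]
      simp
    have h1 : h (w.e i) (c • w.e l) = 0 := by
      rw [map_smul, hf.orth i l (fun h => hil (congrArg Prod.fst h).symm), smul_zero]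
    obtain ⟨u, hu⟩ := exists_isometryGroup hnd _ (hf.eichler_isometry H.herm h1 hcond)
    have h2 : ∀ l', l' ≠ opp l → h (c • w.e l) (w.e l') = 0 := fun l' hl' => by
      rw [form_smul_left, hf.orth l l' hl', mul_zero]
    refine ⟨hcond, u, Subgroup.subset_closure (Or.inl ⟨i, l, c, ⟨hil, ?_, ?_, fun l' h3 h4 => ?_,
      fun y hy => ?_⟩, hc⟩), hu⟩
    · change u.1 (w.e (opp i)) = w.e (opp i) + c • w.e l
      rw [hu, eichler_apply, hf.coef_self H.herm, h2 _ (ne_of_fst_ne (i := opp i) (j := opp l) hil)]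
      simp
    · refine ⟨-(sgn K ε i * h (c • w.e l) (w.e (opp l))), ?_⟩
      change u.1 (w.e (opp l)) = w.e (opp l) + _
      rw [hu, eichler_apply, hf.coef_ne (ne_of_fst_ne (i := opp i) (j := opp l) hil), zero_smul,
        add_zero, neg_smul, sub_eq_add_neg]
    · rw [hu, eichler_apply, hf.coef_ne (i := opp i) (j := l') (Ne.symm h3), h2 _ h4]
      simp
    · rw [hu, eichler_apply, coef_of_orth hy, form_smul_left, hy]
      simp
  have hcoef0 : ∀ l : Fin w.rank × ℤˣ, i.1 = l.1 → coef ε h w.e l z = 0 := by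
    intro l hl
    rcases eq_or_eq_opp hl with h1 | h1
    · rw [coef_apply, ← h1, hz', mul_zero]
    · rw [coef_apply, ← h1, hz, mul_zero]
  have hterm : ∀ l, InStd v ε h w.e x (-crd x i) (coef ε h w.e l z • w.e l) := fun l =>
    (inStd_smul_iff H hf).2 (hzx.1 l)
  have horth : ∀ l, h (w.e i) (coef ε h w.e l z • w.e l) = 0 := by
    intro l
    by_cases hl : i.1 = l.1
    · rw [hcoef0 l hl, zero_smul, map_zero]
    · rw [map_smul, hf.orth i l (fun h => hl (congrArg Prod.fst h).symm), smul_zero]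
  -- products of the transformations for the roots `a_i + a_l`
  have hsum : ∀ s : Finset (Fin w.rank × ℤˣ), ∃ k : K, ((-(2 * crd x i) : ℝ) : WithTop ℝ) ≤ v k ∧
      EichlerCond ε h i (∑ l ∈ s, coef ε h w.e l z • w.e l) k ∧
      ∃ u ∈ w.unip v x, ∀ y,
        u.1 y = eichler ε h w.e i (∑ l ∈ s, coef ε h w.e l z • w.e l) k y := by
    intro s
    induction s using Finset.induction_on with
    | empty =>
      refine ⟨0, le_zero_val _, by simp [EichlerCond], 1, Subgroup.one_mem _, fun y => ?_⟩
      rw [eichler_apply]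
      simp
    | insert l s hl ih =>
      obtain ⟨k, hk, hcond, u, hu, hus⟩ := ih
      by_cases hil : i.1 = l.1
      · refine ⟨k, hk, ?_⟩
        rw [Finset.sum_insert hl, hcoef0 l hil, zero_smul, zero_add]
        exact ⟨hcond, u, hu, hus⟩
      · obtain ⟨hcond', u', hu', hus'⟩ := hshort l (coef ε h w.e l z) hil
          (le_of_le_val (by linarith) (hzx.1 l))
        rw [Finset.sum_insert hl]
        refine ⟨_, ?_, hcond'.comp H hcond, u' * u, Subgroup.mul_mem _ hu' hu, fun y => ?_⟩
        · refine v.map_le_sub (v.map_le_add (le_zero_val _) hk) ?_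
          rw [v.map_mul, val_sgn, zero_add]
          exact le_of_le_val (by linarith) (le_form_of_inStd H hf hCS (hterm l)
            (hF.sum s _ fun l _ => hterm l))
        · rw [← eichler_comp H (horth l) (by
            rw [map_sum]; exact Finset.sum_eq_zero fun l _ => horth l), ← hus, ← hus']
          rfl
  obtain ⟨k1, hk1, hcond1, u1, hu1, hus1⟩ := hsum Finset.univ
  set z1 := ∑ l, coef ε h w.e l z • w.e l with hz1
  set z0 := part ε h w.e z with hz0
  have hzdec : z = z1 + z0 := eq_sum_add_part z
  have hz0o : ∀ l, h (w.e l) z0 = 0 := fun l => hf.orth_part H.herm l z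
  have hz1o : h (w.e i) z1 = 0 := by
    rw [hz1, map_sum]; exact Finset.sum_eq_zero fun l _ => horth l
  have hz10 : h z1 z0 = 0 := by
    refine H.herm.eq_zero ?_
    rw [hz1, map_sum]
    exact Finset.sum_eq_zero fun l _ => by rw [map_smul, H.herm.eq_zero (hz0o l), smul_zero]
  have hs1 := sgn_mul_self (K := K) (ε := ε) i
  have hs3 := sgn_mul_opp (K := K) (ε := ε) i
  have hhalf : (2 : K)⁻¹ * 2 = 1 := inv_mul_cancel₀ H.two_ne_zero
  have hk0 : ((-(2 * crd x i) : ℝ) : WithTop ℝ) ≤ v (-(sgn K ε i * (h z0 z0 / 2))) := by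
    rw [v.map_neg, v.map_mul, val_sgn, zero_add, H.val_half_mul]
    exact le_of_le_val (by linarith) hzx.2
  have hcond0 : EichlerCond ε h i z0 (-(sgn K ε i * (h z0 z0 / 2))) := by
    unfold EichlerCond
    rw [map_neg, map_mul, map_sgn, map_div₀, map_ofNat]
    have h1 : h z0 z0 = ((ε : ℤ) : K) * τ (h z0 z0) := H.herm z0 z0
    linear_combination (-(h z0 z0) / 2) * hs1 - τ (h z0 z0) / 2 * hs3 + h1 / 2 - h z0 z0 * hhalf
  obtain ⟨u0, hu0, hus0⟩ := hsingle z0 _ hz0o hk0 hcond0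
  have hcond10 := hcond1.comp H hcond0
  rw [hz10, mul_zero, sub_zero, ← hzdec] at hcond10
  set k2 := k1 + -(sgn K ε i * (h z0 z0 / 2)) with hk2
  -- the difference of two admissible values of `k` is corrected by the root `2 a_i`
  have hcond2 : EichlerCond ε h i 0 (k - k2) := by
    unfold EichlerCond at *
    rw [map_sub, map_zero]
    linear_combination hcond - hcond10
  obtain ⟨u2, hu2, hus2⟩ := hsingle 0 (k - k2) (fun l => map_zero _)
    (v.map_le_sub hk (v.map_le_add hk1 hk0)) hcond2
  refine ⟨u2 * (u1 * u0), Subgroup.mul_mem _ hu2 (Subgroup.mul_mem _ hu1 hu0), fun y => ?_⟩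
  have e1 : (u1 * u0).1 y = eichler ε h w.e i z k2 y := by
    have := eichler_comp (ε := ε) (k := k1) (k' := -(sgn K ε i * (h z0 z0 / 2))) H hz1o (hz0o i) y
    rw [hz10, mul_zero, sub_zero, ← hzdec, ← hk2, ← hus0, ← hus1] at this
    exact this
  have e2 : (u2 * (u1 * u0)).1 y = u2.1 ((u1 * u0).1 y) := rfl
  rw [e2, e1, hus2, eichler_comp H (map_zero _) hz]
  simp

end Unipotent

/-! ### Reduction of hyperbolic families by unipotent elements -/

section Reduction

variable {K : Type*} [Field K] {τ : K →+* K} {W : Type*} [AddCommGroup W] [Module K W]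
  {v : AddValuation K (WithTop ℝ)} {ε : ℤˣ} {h : W →ₛₗ[τ] W →ₗ[K] K}
  {w : WittFrame h}

variable (H : HermitianSetting v ε h) (hCS : OrthCauchySchwarz v h w.e)
include H hCS

/-- The norm of an isotropic vector `y` is attained by one of its coordinates, provided that `y`
has a partner `y'` of opposite norm with `h y y'` a unit. -/
theorem exists_minimal_coef {x : Fin w.rank → ℝ} {r : ℝ} {y y' : W}
    (hy : InStd v ε h w.e x r y) (hy' : InStd v ε h w.e x (-r) y') (hyy : h y y = 0)
    (hyy' : v (h y y') = 0) :
    ∃ j, coef ε h w.e j y ≠ 0 ∧ val v (coef ε h w.e j y) ≤ r - crd x j := by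
  have hf := w.isHyperbolic
  -- otherwise all the terms in the expansion of `h y y'` have positive valuation
  by_contra! hcon
  have hlt : ∀ j, ((r - crd x j : ℝ) : WithTop ℝ) < v (coef ε h w.e j y) := by
    intro j
    by_cases h0 : coef ε h w.e j y = 0
    · rw [h0, v.map_zero]; exact WithTop.coe_lt_top _
    · exact (lt_iff_val h0).2 (hcon j h0)
  have hsum : ∀ s y', InStd v ε h w.e x s y' → ((r + s : ℝ) : WithTop ℝ) <
      v (∑ i, τ (coef ε h w.e i y) * (sgn K ε (opp i) * coef ε h w.e (opp i) y')) := by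
    intro s y' hy'
    refine v.map_lt_sum (WithTop.coe_ne_top) fun i _ => ?_
    rw [v.map_mul, H.isom, v.map_mul, val_sgn, zero_add, ← v.map_mul]
    by_cases h0 : coef ε h w.e (opp i) y' = 0
    · rw [h0, mul_zero, v.map_zero]; exact WithTop.coe_lt_top _
    have h1 : coef ε h w.e i y ≠ 0 ∨ coef ε h w.e i y = 0 := ne_or_eq _ _
    rcases h1 with h1 | h1
    · rw [lt_iff_val (mul_ne_zero h1 h0), val_mul h1 h0]
      have e1 := (lt_iff_val h1).1 (hlt i)
      have e2 := (le_iff_val h0).1 (hy'.1 (opp i))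
      rw [crd_opp] at e2
      linarith
    · rw [h1, zero_mul, v.map_zero]; exact WithTop.coe_lt_top _
  have horth : ∀ y i, h (w.e i) (part ε h w.e y) = 0 := fun y i => hf.orth_part H.herm i y
  have hzz : ((r + r : ℝ) : WithTop ℝ) < v (h (part ε h w.e y) (part ε h w.e y)) := by
    have h1 := hf.form_expand H.herm y y
    rw [hyy] at h1
    rw [eq_neg_of_add_eq_zero_right h1.symm, v.map_neg]
    exact hsum r y hy
  obtain ⟨q, hq, hqz⟩ : ∃ q, r < q ∧
      ((2 * q : ℝ) : WithTop ℝ) ≤ v (h (part ε h w.e y) (part ε h w.e y)) := by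
    by_cases h0 : h (part ε h w.e y) (part ε h w.e y) = 0
    · exact ⟨r + 1, by linarith, by rw [h0]; exact le_zero_val _⟩
    · have := (lt_iff_val h0).1 hzz
      exact ⟨val v (h (part ε h w.e y) (part ε h w.e y)) / 2, by linarith,
        (le_iff_val h0).2 (by linarith)⟩
  have h1 : 0 < v (h y y') := by
    rw [hf.form_expand H.herm]
    refine v.map_lt_add ?_ ?_
    · have := hsum _ _ hy'
      rwa [add_neg_cancel] at this
    · exact pos_of_le_val (by linarith) (hCS _ _ (horth y) (horth y') _ _ hqz hy'.2)
  rw [hyy'] at h1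
  exact lt_irrefl _ h1

variable [FiniteDimensional K W] (hnd : h.SeparatingLeft)
include hnd

/-- An isotropic vector whose norm is attained by the coordinate `j` is moved by `U_x` to the line
of `e_j`; the vectors of the frame which are orthogonal to it, and `e_{-j}`, are not moved. -/
theorem exists_move_to_line {x : Fin w.rank → ℝ} {r : ℝ} {y : W}
    (hy : InStd v ε h w.e x r y) (hyy : h y y = 0) {j : Fin w.rank × ℤˣ}
    (hj : coef ε h w.e j y ≠ 0) (hval : val v (coef ε h w.e j y) ≤ r - crd x j) :
    ∃ u ∈ w.unip v x, u.1 y = coef ε h w.e j y • w.e j ∧ u.1 (w.e (opp j)) = w.e (opp j) ∧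
      ∀ l, l.1 ≠ j.1 → h y (w.e l) = 0 → u.1 (w.e l) = w.e l := by
  have hf := w.isHyperbolic
  have hF := isFiltration_inStd H hf hCS x
  set c := coef ε h w.e j y with hc
  set d := coef ε h w.e (opp j) y with hd
  set z := c⁻¹ • (y - c • w.e j - d • w.e (opp j)) with hz
  have hyz : y = c • (w.e j + z + (c⁻¹ * d) • w.e (opp j)) := by
    rw [hz, smul_add, smul_add, smul_smul, smul_smul, mul_inv_cancel₀ hj, ← mul_assoc,
      mul_inv_cancel₀ hj, one_mul, one_smul]
    abel
  have hpj : h (w.e j) (w.e (opp j)) = sgn K ε (opp j) := by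
    have := hf.form_opp H.herm (opp j)
    rwa [opp_opp] at this
  have hjz : h (w.e j) z = 0 := by
    rw [hz, map_smul, map_sub, map_sub, map_smul, map_smul, hf.form_self, hpj,
      form_eq_coef (ε := ε), ← hd, smul_eq_mul, smul_eq_mul, smul_eq_mul]
    ring
  have hjz' : h (w.e (opp j)) z = 0 := by
    rw [hz, map_smul, map_sub, map_sub, map_smul, map_smul, hf.form_self, hf.form_opp H.herm,
      form_eq_coef (ε := ε), opp_opp, ← hc, smul_eq_mul, smul_eq_mul, smul_eq_mul]
    ring
  have hcv : ((crd x j - r : ℝ) : WithTop ℝ) ≤ v c⁻¹ := by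
    rw [le_iff_val (inv_ne_zero hj), val_inv hj]
    linarith
  have hzx : InStd v ε h w.e x (-crd x (opp j)) z := by
    rw [crd_opp, neg_neg]
    have := hF.smul hcv (hF.sub (hF.sub hy ((inStd_smul_iff H hf).2 (hy.1 j)))
      ((inStd_smul_iff H hf).2 (hy.1 (opp j))))
    exact hF.anti (by linarith) this
  have hk : ((-(2 * crd x (opp j)) : ℝ) : WithTop ℝ) ≤ v (c⁻¹ * d) := by
    refine le_of_le_val ?_ (le_mul_val hcv (hy.1 (opp j)))
    rw [crd_opp]
    linarith
  have hcond : EichlerCond ε h (opp j) z (c⁻¹ * d) := by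
    have h1 : h (w.e j + z + (c⁻¹ * d) • w.e (opp j)) (w.e j + z + (c⁻¹ * d) • w.e (opp j)) =
        0 := by
      have h2 := hyy
      rw [hyz, form_smul_left, map_smul, smul_eq_mul] at h2
      rcases mul_eq_zero.1 h2 with h3 | h3
      · exact absurd ((map_eq_zero τ).1 h3) hj
      · exact (mul_eq_zero.1 h3).resolve_left hj
    simp only [map_add, LinearMap.add_apply, form_smul_left, map_smul, smul_eq_mul,
      hf.form_self, hpj, hjz, hjz', hf.form_opp H.herm, H.herm.eq_zero hjz,
      H.herm.eq_zero hjz', mul_zero, add_zero, zero_add] at h1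
    unfold EichlerCond
    rw [opp_opp]
    linear_combination h1
  -- `y` is the image of `c e_j` under the Eichler transformation with center `e_{-j}`
  obtain ⟨u, hu, hus⟩ := eichler_mem_unip H hCS hnd hjz' (by rwa [opp_opp]) hzx hk hcond
  have huy : u.1 (c • w.e j) = y := by
    rw [map_smul, hus, eichler_apply, opp_opp, hf.coef_self H.herm, H.herm.eq_zero hjz, one_smul,
      mul_zero, zero_smul, sub_zero, ← add_assoc, ← hyz]
  have hinv : ∀ {a b}, u.1 a = b → (u⁻¹).1 b = a := fun {a b} hab => by
    rw [← hab]; exact u.1.symm_apply_apply a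
  refine ⟨u⁻¹, Subgroup.inv_mem _ hu, hinv huy, hinv ?_, fun l hl hyl => hinv ?_⟩
  · rw [hus, eichler_apply, opp_opp, hf.coef_ne (opp_ne j).symm, H.herm.eq_zero hjz']
    simp
  · have hzl : h z (w.e l) = 0 := by
      have h1 : h (w.e j) (w.e l) = 0 := hf.orth _ _ (ne_of_fst_ne (j := opp j) hl)
      have h2 : h (w.e (opp j)) (w.e l) = 0 := hf.orth _ _ (by
        rw [opp_opp]; exact ne_of_fst_ne hl)
      rw [hz, form_smul_left, map_sub, map_sub, LinearMap.sub_apply, LinearMap.sub_apply,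
        form_smul_left, form_smul_left, hyl, h1, h2]
      simp
    rw [hus, eichler_apply, opp_opp, hf.coef_ne (ne_of_fst_ne (i := j) hl.symm), hzl]
    simp

/-- A hyperbolic family whose vectors have opposite norms at the point `x` is moved by `U_x` into
the lines of the frame. -/
theorem exists_hyperbolic_reduction {x : Fin w.rank → ℝ} {m : ℕ} {f : Fin m × ℤˣ → W}
    (hf : IsHyperbolic h f) {a : Fin m → ℝ} (ha : ∀ i, InStd v ε h w.e x (crd a i) (f i))
    (s : ℕ) : ∃ u ∈ w.unip v x, ∀ i : Fin m × ℤˣ, (i.1 : ℕ) < s →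
      ∃ j, ∃ c : K, u.1 (f i) = c • w.e j := by
  induction s with
  | zero => exact ⟨1, Subgroup.one_mem _, fun i hi => absurd hi (Nat.not_lt_zero _)⟩
  | succ s ih =>
    obtain ⟨u, hu, hus⟩ := ih
    by_cases hsm : s < m
    swap
    · exact ⟨u, hu, fun i _ => hus i (by omega)⟩
    have hw := w.isHyperbolic
    have hux : ∀ i, InStd v ε h w.e x (crd a i) (u.1 (f i)) := fun i =>
      (inStd_apply_iff_of_mem_unip H hCS hu _ _).2 (ha i)
    let i0 : Fin m × ℤˣ := (⟨s, hsm⟩, 1)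
    set y := u.1 (f i0) with hy
    have hyy : h y y = 0 := by rw [hy, u.2]; exact hf.form_self _
    have hyy' : v (h y (u.1 (f (opp i0)))) = 0 := by
      rw [hy, u.2]
      have := hf.form_opp H.herm (opp i0)
      rw [opp_opp] at this
      rw [this, val_sgn]
    have hy' := hux (opp i0)
    rw [crd_opp] at hy'
    obtain ⟨j, hj, hval⟩ := exists_minimal_coef H hCS (hux i0) hy' hyy hyy'
    have hval' := (le_iff_val hj).1 ((hux i0).1 j)
    obtain ⟨u1, hu1, hu1y, -, hu1l⟩ := exists_move_to_line H hCS hnd (hux i0) hyy hj hval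
    set c := coef ε h w.e j y with hc
    set y1 := u1.1 (u.1 (f (opp i0))) with hy1
    have hy1x : InStd v ε h w.e x (-crd a i0) y1 :=
      (inStd_apply_iff_of_mem_unip H hCS hu1 _ _).2 hy'
    have hy1y : h y1 y1 = 0 := by rw [hy1, u1.2, u.2]; exact hf.form_self _
    have hcy : v (coef ε h w.e (opp j) y1) = ((-val v c : ℝ) : WithTop ℝ) := by
      have h1 : v (h (c • w.e j) y1) = 0 := by rw [← hu1y, hy1, u1.2]; exact hyy'
      rw [val_coef, opp_opp]
      rw [form_smul_left, v.map_mul, H.isom, ← coe_val hj] at h1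
      have hne : h (w.e j) y1 ≠ 0 := by
        intro h0
        rw [h0, v.map_zero, WithTop.add_top] at h1
        exact WithTop.top_ne_zero h1
      rw [← coe_val hne, ← WithTop.coe_add] at h1
      have h2 : val v c + val v (h (w.e j) y1) = 0 := by exact_mod_cast h1
      rw [← coe_val hne]
      congr 1
      linarith
    have hj1 := ne_zero_of_coe hcy
    obtain ⟨u2, hu2, hu2y, hu2j, hu2l⟩ := exists_move_to_line H hCS hnd hy1x hy1y hj1 (by
      rw [val_eq_of hcy, crd_opp]
      linarith)
    rw [opp_opp] at hu2j
    refine ⟨u2 * (u1 * u), Subgroup.mul_mem _ hu2 (Subgroup.mul_mem _ hu1 hu), fun i hi => ?_⟩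
    change ∃ j, ∃ c : K, u2.1 (u1.1 (u.1 (f i))) = c • w.e j
    by_cases his : (i.1 : ℕ) < s
    · have hii : i.1 ≠ i0.1 := fun e => by
        have : (i.1 : ℕ) = s := congrArg Fin.val e
        omega
      obtain ⟨l, d, hl⟩ := hus i his
      obtain ⟨l', d', hl'⟩ := hus (opp i) his
      have hne : ∀ {i : Fin m × ℤˣ} {l : Fin w.rank × ℤˣ} {d : K}, u.1 (f i) = d • w.e l →
          d ≠ 0 := by
        rintro i l d hd rfl
        rw [zero_smul] at hd
        exact hf.ne_zero H.herm i (by simpa using hd)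
      -- the earlier lines are orthogonal to `y`, hence different from `± j`
      have horth : ∀ {i : Fin m × ℤˣ} {l : Fin w.rank × ℤˣ} {d : K}, i.1 ≠ i0.1 →
          u.1 (f i) = d • w.e l → h y (w.e l) = 0 := by
        intro i l d hi hd
        have h1 : h y (u.1 (f i)) = 0 := by
          rw [hy, u.2]
          exact hf.orth _ _ (ne_of_fst_ne (j := opp i0) hi)
        rw [hd, map_smul, smul_eq_mul] at h1
        exact (mul_eq_zero.1 h1).resolve_left (hne hd)
      have hl1 := horth hii hl
      have hl2 := horth (i := opp i) hii hl'
      have hjy : h y (w.e (opp j)) ≠ 0 := by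
        intro h0
        rw [hc, coef_apply, H.herm.eq_zero h0, mul_zero] at hj
        exact hj rfl
      have hll' : l' = opp l := by
        by_contra hcon
        have h1 : h (u.1 (f i)) (u.1 (f (opp i))) = 0 := by
          rw [hl, hl', form_smul_left, map_smul, hw.orth _ _ hcon, smul_zero, mul_zero]
        rw [u.2] at h1
        have h2 := hf.form_opp H.herm (opp i)
        rw [opp_opp, h1] at h2
        exact sgn_ne_zero _ h2.symm
      have hlj : l.1 ≠ j.1 := by
        intro e
        rcases eq_or_eq_opp e with e1 | e1
        · rw [hll', e1] at hl2
          exact hjy hl2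
        · rw [e1] at hl1
          exact hjy hl1
      have hy1l : h y1 (w.e l) = 0 := by
        have h1 : h (u.1 (f (opp i0))) (u.1 (f i)) = 0 := by
          rw [u.2]
          exact hf.orth _ _ (by rw [opp_opp]; exact ne_of_fst_ne hii)
        rw [← u1.2, hl, map_smul, hu1l l hlj hl1, map_smul, smul_eq_mul] at h1
        exact (mul_eq_zero.1 h1).resolve_left (hne hl)
      refine ⟨l, d, ?_⟩
      rw [hl, map_smul, hu1l l hlj hl1, map_smul, hu2l l hlj hy1l]
    · have hi0 : i.1 = i0.1 := Fin.ext (by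
        have : (i0.1 : ℕ) = s := rfl
        omega)
      rcases eq_or_eq_opp hi0 with rfl | rfl
      · refine ⟨j, c, ?_⟩
        rw [← hy, hu1y, map_smul, hu2j]
      · exact ⟨opp j, _, hu2y⟩

end Reduction

section Frames

variable {K : Type*} [Field K] {τ : K →+* K} {W : Type*} [AddCommGroup W] [Module K W]
  [FiniteDimensional K W]
  {v : AddValuation K (WithTop ℝ)} {ε : ℤˣ} {h : W →ₛₗ[τ] W →ₗ[K] K}

variable (K) in
/-- The trivial valuation. -/
def trivialVal : AddValuation K (WithTop ℝ) := by
  classical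
  exact AddValuation.of (fun x => if x = 0 then ⊤ else 0) (by simp) (by simp)
    (fun x y => by
      by_cases hx : x = 0
      · simp [hx]
      by_cases hy : y = 0
      · simp [hx, hy]
      by_cases hxy : x + y = 0
      · simp [hxy]
      · simp [hx, hy, hxy])
    (fun x y => by
      by_cases hx : x = 0
      · simp [hx]
      by_cases hy : y = 0
      · simp [hx, hy]
      · simp [hx, hy])

theorem trivialVal_apply {x : K} (hx : x ≠ 0) : trivialVal K x = 0 := by
  simp [trivialVal, hx]

theorem zero_le_trivialVal (x : K) : 0 ≤ trivialVal K x := by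
  by_cases hx : x = 0
  · rw [hx, (trivialVal K).map_zero]; exact le_top
  · rw [trivialVal_apply hx]

/-- Any hyperbolic family is carried by an isometry into the lines of a given Witt decomposition.
This is the reduction by unipotent elements for the trivial valuation. -/
theorem WittFrame.exists_isometry_to_lines (w : WittFrame h) (H : IsEpsHermitian ε h)
    (hinv : ∀ a, τ (τ a) = a) (h2 : (2 : K) ≠ 0) (hnd : h.SeparatingLeft) {m : ℕ}
    {f : Fin m × ℤˣ → W} (hf : IsHyperbolic h f) :
    ∃ u : isometryGroup h, ∀ i, ∃ j, ∃ c : K, u.1 (f i) = c • w.e j := by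
  have H' : HermitianSetting (trivialVal K) ε h :=
    { herm := H
      invol := hinv
      isom := fun a => by
        by_cases ha : a = 0
        · rw [ha, map_zero]
        · rw [trivialVal_apply ha, trivialVal_apply (by simpa using ha)]
      two := trivialVal_apply h2 }
  have hCS : OrthCauchySchwarz (trivialVal K) h w.e := by
    intro z z' hz hz' r s hr hs
    by_cases h1 : h z z = 0
    · rw [w.aniso z hz h1, map_zero, LinearMap.zero_apply]; exact le_zero_val _
    by_cases h2 : h z' z' = 0
    · rw [w.aniso z' hz' h2, map_zero]; exact le_zero_val _
    rw [trivialVal_apply h1] at hr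
    rw [trivialVal_apply h2] at hs
    refine le_trans ?_ (zero_le_trivialVal _)
    have hr' : 2 * r ≤ 0 := by exact_mod_cast hr
    have hs' : 2 * s ≤ 0 := by exact_mod_cast hs
    have : r + s ≤ 0 := by linarith
    exact_mod_cast this
  obtain ⟨u, -, hu⟩ := exists_hyperbolic_reduction (x := 0) (a := 0) H' hCS hnd hf
    (fun i => ⟨fun j => by simpa [crd] using zero_le_trivialVal _,
      by simpa [crd] using zero_le_trivialVal _⟩) m
  exact ⟨u, fun i => hu i i.1.2⟩

/-- The rank of a Witt decomposition is at most that of any other one. -/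
theorem WittFrame.rank_le (w w' : WittFrame h) (H : IsEpsHermitian ε h)
    (hinv : ∀ a, τ (τ a) = a) (h2 : (2 : K) ≠ 0) (hnd : h.SeparatingLeft) :
    w'.rank ≤ w.rank := by
  obtain ⟨u, hu⟩ := w.exists_isometry_to_lines H hinv h2 hnd w'.isHyperbolic
  choose j c hc using hu
  have hsub : Set.range (fun i => u.1 (w'.e i)) ⊆
      (Submodule.span K (Set.range w.e) : Set W) := by
    rintro _ ⟨i, rfl⟩
    change u.1 (w'.e i) ∈ _
    rw [hc]
    exact Submodule.smul_mem _ _ (Submodule.subset_span ⟨_, rfl⟩)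
  have hli : LinearIndependent K fun i => u.1 (w'.e i) :=
    (w'.isHyperbolic.linearIndependent H).map' u.1.toLinearMap u.1.ker
  have h1 := finrank_span_eq_card hli
  have h3 := finrank_span_eq_card (w.isHyperbolic.linearIndependent H)
  have h4 := Submodule.finrank_mono (Submodule.span_le.2 hsub)
  rw [h1, h3] at h4
  simp only [Fintype.card_prod, Fintype.card_fin] at h4
  have : 0 < Fintype.card ℤˣ := Fintype.card_pos
  exact Nat.le_of_mul_le_mul_right h4 this

/-- A hyperbolic family of maximal size is conjugate, under the isometry group, to the family of a
given Witt decomposition. -/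
theorem WittFrame.exists_conj (w : WittFrame h) (H : IsEpsHermitian ε h)
    (hinv : ∀ a, τ (τ a) = a) (h2 : (2 : K) ≠ 0) (hnd : h.SeparatingLeft)
    {f : Fin w.rank × ℤˣ → W} (hf : IsHyperbolic h f) :
    ∃ g : isometryGroup h, ∀ i, g.1 (w.e i) = f i := by
  obtain ⟨u, hu⟩ := w.exists_isometry_to_lines H hinv h2 hnd hf
  have hf' : IsHyperbolic h fun i => u.1 (f i) :=
    ⟨fun i j hij => by rw [u.2]; exact hf.orth i j hij, fun k => by rw [u.2]; exact hf.pair k⟩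
  obtain ⟨g, hg, -⟩ := w.isHyperbolic.exists_isometry H hnd hf' fun z hz i => by
    obtain ⟨j, c, hc⟩ := hu i
    rw [hc, form_smul_left, hz, mul_zero]
  refine ⟨u⁻¹ * g, fun i => ?_⟩
  change u.1.symm (g.1 (w.e i)) = _
  rw [hg, u.1.symm_apply_apply]

end Frames

/-! ### The lattice functions of the standard apartment -/

section StandardLattices

variable {K : Type*} [Field K] {τ : K →+* K} {W : Type*} [AddCommGroup W] [Module K W]
  [FiniteDimensional K W]
  {v : AddValuation K (WithTop ℝ)} {ε : ℤˣ} {h : W →ₛₗ[τ] W →ₗ[K] K}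

/-- The norm of a nonzero vector `x` is attained by a linear form: with `s` the norm of `x`, the form
takes the value `1` at `x` and values of valuation at least `q - s` on each step `q`. -/
theorem LatticeFunction.exists_norming_form (hd : DiscreteValues v) (L : LatticeFunction v W)
    {x : W} (hx : x ≠ 0) :
    ∃ (s : ℝ) (φ : W →ₗ[K] K), x ∈ L.toFun s ∧ φ x = 1 ∧
      ∀ q, ∀ y ∈ L.toFun q, ((q - s : ℝ) : WithTop ℝ) ≤ v (φ y) := by
  classical
  obtain ⟨b, l, h⟩ := L.exists_splitBy hd rfl
  have hne : (Finset.univ.filter fun k => b.repr x k ≠ 0).Nonempty := by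
    by_contra hcon
    rw [Finset.not_nonempty_iff_eq_empty, Finset.filter_eq_empty_iff] at hcon
    refine hx (b.repr.map_eq_zero_iff.1 (Finsupp.ext fun k => ?_))
    simpa using hcon (Finset.mem_univ k)
  obtain ⟨k, hk, hmin⟩ := Finset.exists_min_image _ (fun k => val v (b.repr x k) - l k) hne
  have h0 : b.repr x k ≠ 0 := (Finset.mem_filter.1 hk).2
  refine ⟨val v (b.repr x k) - l k, (b.repr x k)⁻¹ • b.coord k, ?_, ?_, ?_⟩
  · rw [h]
    intro i
    by_cases hi : b.repr x i = 0
    · rw [hi]; exact le_zero_val _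
    · rw [le_iff_val hi]
      have := hmin i (Finset.mem_filter.2 ⟨Finset.mem_univ i, hi⟩)
      linarith
  · simp [h0]
  · intro q y hy
    have e1 := (h _ _).1 hy k
    have e2 : ((-val v (b.repr x k) : ℝ) : WithTop ℝ) ≤ v (b.repr x k)⁻¹ := by
      rw [le_iff_val (inv_ne_zero h0), val_inv h0]
    exact le_of_le_val (by linarith) (le_mul_val e2 e1)

/-- A nondegenerate sesquilinear form represents all linear forms. -/
theorem exists_form_eq (hinv : ∀ a, τ (τ a) = a) (hnd : h.SeparatingLeft) (φ : W →ₗ[K] K) :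
    ∃ y, h y = φ := by
  let b := Module.finBasis K W
  have hsum : ∀ c : Fin (Module.finrank K W) → K,
      h (∑ i, τ (c i) • b i) = ∑ i, c i • h (b i) := fun c => by
    rw [map_sum]
    exact Finset.sum_congr rfl fun i _ => by rw [LinearMap.map_smulₛₗ, hinv]
  have hli : LinearIndependent K fun i => h (b i) := by
    rw [Fintype.linearIndependent_iff]
    intro c hc
    rw [← hsum] at hc
    have h1 : ∑ i, τ (c i) • b i = 0 := hnd _ fun y => by rw [hc]; rfl
    intro i
    have := Fintype.linearIndependent_iff.1 b.linearIndependent _ h1 i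
    exact (map_eq_zero τ).1 this
  have hsp := hli.span_eq_top_of_card_eq_finrank' (by simp)
  obtain ⟨c, hc⟩ := (Submodule.mem_span_range_iff_exists_fun K).1
    (show φ ∈ Submodule.span K (Set.range fun i => h (b i)) by rw [hsp]; trivial)
  exact ⟨∑ i, τ (c i) • b i, by rw [hsum, hc]⟩

variable {w : WittFrame h} (H : HermitianSetting v ε h) (hc : CompleteVal v)
  (hd : DiscreteValues v)
include H hc hd

/-- The standard filtrations are lattice functions, split by a common basis: the frame and a basis
which splits the filtration of the anisotropic part. -/
theorem exists_stdLattice : ∃ S : (Fin w.rank → ℝ) → LatticeFunction v W,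
    (∀ x r y, y ∈ (S x).toFun r ↔ InStd v ε h w.e x r y) ∧
    ∀ t x y, IsBarycenter t (S x) (S y) (S (t • x + (1 - t) • y)) := by
  have hf := w.isHyperbolic
  have hCS := H.orthCauchySchwarz hc w
  let V₀ : Submodule K W := ⨅ i, LinearMap.ker (h (w.e i))
  have hV₀ : ∀ {z}, z ∈ V₀ ↔ ∀ i, h (w.e i) z = 0 := fun {z} => by simp [V₀]
  let P : ℝ → V₀ → Prop := fun r z => ((2 * r : ℝ) : WithTop ℝ) ≤ v (h z.1 z.1)
  have hPs : ∀ r (z : V₀), P r z ↔ InStd v ε h w.e 0 r z := fun r z =>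
    (inStd_orth_iff (hV₀.1 z.2)).symm
  have hF := isFiltration_inStd H hf hCS 0
  have hP : IsFiltration v P :=
    { zero := fun r => (hPs _ _).2 (hF.zero r)
      add := fun h1 h2 => (hPs _ _).2 (hF.add ((hPs _ _).1 h1) ((hPs _ _).1 h2))
      smul := fun h1 h2 => (hPs _ _).2 (hF.smul h1 ((hPs _ _).1 h2))
      anti := fun h1 h2 => (hPs _ _).2 (hF.anti h1 ((hPs _ _).1 h2))
      left := fun h1 => (hPs _ _).2 (hF.left fun s hs => (hPs _ _).1 (h1 s hs))
      exh := fun z => (hF.exh z).imp fun r hr => (hPs _ _).2 hr }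
  have hsep : Separated P := fun z hz => by
    have h0 : h z.1 z.1 ≠ 0 := fun h0 => hz (Subtype.ext (w.aniso _ (hV₀.1 z.2) h0))
    refine ⟨val v (h z.1 z.1) / 2 + 1, fun hle => ?_⟩
    have := (le_iff_val h0).1 hle
    linarith
  obtain ⟨b₀, l₀, hb₀⟩ := hP.exists_split hd _ rfl (hP.boundedForms hc _ rfl hsep)
  -- the coordinates for the frame, and the anisotropic part
  let T : W →ₗ[K] (Fin w.rank × ℤˣ → K) × V₀ := (LinearMap.pi (coef ε h w.e)).prod
    ((part ε h w.e).codRestrict V₀ fun y => hV₀.2 fun i => hf.orth_part H.herm i y)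
  have hT1 : ∀ y i, (T y).1 i = coef ε h w.e i y := fun y i => rfl
  have hT2 : ∀ y, (T y).2.1 = part ε h w.e y := fun y => rfl
  have hTb : Function.Bijective T := by
    constructor
    · intro y y' hyy
      rw [eq_sum_add_part (ε := ε) (h := h) (f := w.e) y,
        eq_sum_add_part (ε := ε) (h := h) (f := w.e) y', ← hT2, ← hT2, hyy]
      simp only [← hT1, hyy]
    · rintro ⟨c, z⟩
      have h1 : ∀ i, coef ε h w.e i (∑ j, c j • w.e j + z.1) = c i := fun i => by
        rw [map_add, coef_of_orth (hV₀.1 z.2), add_zero, map_sum, Finset.sum_eq_single i,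
          map_smul, hf.coef_self H.herm, smul_eq_mul, mul_one]
        · intro j _ hj
          rw [map_smul, hf.coef_ne hj.symm, smul_zero]
        · simp
      refine ⟨∑ i, c i • w.e i + z.1, Prod.ext (funext fun i => ?_) (Subtype.ext ?_)⟩
      · rw [hT1, h1]
      · rw [hT2, part_apply]
        simp only [h1]
        abel
  let B := ((Pi.basisFun K (Fin w.rank × ℤˣ)).prod b₀).map (LinearEquiv.ofBijective T hTb).symm
  let l : (Fin w.rank → ℝ) → (Fin w.rank × ℤˣ) ⊕ Fin (Module.finrank K V₀) → ℝ := fun x =>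
    Sum.elim (fun i => -crd x i) l₀
  have hB : ∀ x r y, InStd v ε h w.e x r y ↔
      ∀ k, ((r + l x k : ℝ) : WithTop ℝ) ≤ v (B.repr y k) := by
    intro x r y
    rw [Sum.forall]
    refine and_congr (forall_congr' fun i => Iff.rfl) ?_
    exact hb₀ r (T y).2
  let σ := Fintype.equivFin ((Fin w.rank × ℤˣ) ⊕ Fin (Module.finrank K V₀))
  have hsplit : ∀ x, ∃ L : LatticeFunction v W, SplitBy (B.reindex σ) (l x ∘ σ.symm) L := fun x =>
    ⟨_, LatticeFunction.splitBy_ofBasis hd _ _⟩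
  choose S hS using hsplit
  refine ⟨S, fun x r y => ?_, fun t x y => ⟨_, B.reindex σ, _, _, hS x, hS y, ?_⟩⟩
  · rw [hS, hB]
    refine ⟨fun hk k => ?_, fun hk k => by simpa using hk _⟩
    simpa using hk (σ k)
  · convert hS (t • x + (1 - t) • y) using 2 with k
    simp only [l, Function.comp_apply]
    rcases σ.symm k with i | i
    · simp only [Sum.elim_inl, crd, Pi.add_apply, Pi.smul_apply, smul_eq_mul]
      ring
    · simp only [Sum.elim_inr]
      ring

end StandardLattices

/-! ### The identification of the building of a classical group -/

section SelfDual

variable {K : Type*} [Field K] {τ : K →+* K} {W : Type*} [AddCommGroup W] [Module K W]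
  {v : AddValuation K (WithTop ℝ)} {ε : ℤˣ} {h : W →ₛₗ[τ] W →ₗ[K] K}
  {L : LatticeFunction v W}

theorem IsSelfDual.le_form (hL : IsSelfDual h L) {r s : ℝ} {y y' : W} (hy : y ∈ L.toFun r)
    (hy' : y' ∈ L.toFun s) : ((r + s : ℝ) : WithTop ℝ) ≤ v (h y y') := by
  by_contra hcon
  have h0 : h y y' ≠ 0 := by
    intro h0
    rw [h0] at hcon
    exact hcon (le_zero_val _)
  rw [le_iff_val h0, not_le] at hcon
  have h1 := (L.smul_mem_iff (inv_ne_zero h0)).2 hy'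
  rw [val_inv h0] at h1
  have := (hL r y).1 hy _ (by linarith) _ h1
  rw [map_smul, smul_eq_mul, inv_mul_cancel₀ h0, v.map_one] at this
  exact lt_irrefl _ this

theorem IsSelfDual.map (hL : IsSelfDual h L) (g : isometryGroup h) :
    IsSelfDual h (L.map g.1) := by
  intro r x
  rw [LatticeFunction.mem_map, hL]
  refine forall₂_congr fun s _ => ⟨fun hx y hy => ?_, fun hx y hy => ?_⟩
  · have := hx _ (LatticeFunction.mem_map.1 hy)
    rwa [← g.2, g.1.apply_symm_apply, g.1.apply_symm_apply] at this
  · have := hx (g.1 y) (LatticeFunction.apply_mem_map.2 hy)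
    rw [← g.2, g.1.apply_symm_apply]
    exact this

theorem IsSelfDual.part_mem (hL : IsSelfDual h L) {m : ℕ} {f : Fin m × ℤˣ → W} {x : Fin m → ℝ}
    (hfL : ∀ i, f i ∈ L.toFun (crd x i)) {r : ℝ} {y : W} (hy : y ∈ L.toFun r) :
    (∀ i, ((r - crd x i : ℝ) : WithTop ℝ) ≤ v (coef ε h f i y)) ∧ part ε h f y ∈ L.toFun r := by
  have h1 : ∀ i, ((r - crd x i : ℝ) : WithTop ℝ) ≤ v (coef ε h f i y) := fun i => by
    rw [val_coef]
    refine le_of_le_val ?_ (hL.le_form (hfL (opp i)) hy)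
    rw [crd_opp]
    linarith
  have hF := L.isFiltration
  refine ⟨h1, ?_⟩
  rw [part_apply]
  exact hF.sub hy (hF.sum _ _ fun i _ => hF.anti (by linarith) (hF.smul (h1 i) (hfL i)))

/-- A self-dual lattice function is determined by the norms of a hyperbolic family, if these
norms are opposite on dual vectors and the orthogonal complement is anisotropic. -/
theorem IsSelfDual.mem_iff_inStd (hL : IsSelfDual h L) (H : HermitianSetting v ε h) {m : ℕ}
    {f : Fin m × ℤˣ → W} (hf : IsHyperbolic h f) (hCS : OrthCauchySchwarz v h f) {x : Fin m → ℝ}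
    (hfL : ∀ i, f i ∈ L.toFun (crd x i)) (r : ℝ) (y : W) :
    y ∈ L.toFun r ↔ InStd v ε h f x r y := by
  have key : ∀ r y, y ∈ L.toFun r → InStd v ε h f x r y := fun r y hy => by
    obtain ⟨h1, h2⟩ := hL.part_mem (ε := ε) hfL hy
    refine ⟨h1, ?_⟩
    rw [two_mul]
    exact hL.le_form h2 h2
  refine ⟨key r y, fun hy => (hL r y).2 fun s hs y' hy' => ?_⟩
  exact (inStd_iff_dual H hf hCS x r y).1 hy s hs y' (key s y' hy')

variable [FiniteDimensional K W]

/-- In a self-dual lattice function, each nonzero vector has a dual partner of opposite norm. -/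
theorem IsSelfDual.exists_partner (hL : IsSelfDual h L) (hd : DiscreteValues v)
    (hinv : ∀ a, τ (τ a) = a) (hnd : h.SeparatingLeft) {x : W} (hx : x ≠ 0) :
    ∃ s y, x ∈ L.toFun s ∧ y ∈ L.toFun (-s) ∧ h y x = 1 := by
  obtain ⟨s, φ, hs, hφx, hφ⟩ := L.exists_norming_form hd hx
  obtain ⟨y, rfl⟩ := exists_form_eq hinv hnd φ
  exact ⟨s, y, hs, (hL _ _).2 fun q hq z hz => pos_of_le_val (by linarith) (hφ q z hz), hφx⟩

/-- If the orthogonal complement of a hyperbolic family whose dual vectors lie in opposite steps of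
`L` contains an isotropic vector, the family extends to a larger one of the same kind. -/
theorem IsSelfDual.exists_extension (hL : IsSelfDual h L) (H : HermitianSetting v ε h)
    (hd : DiscreteValues v) (hnd : h.SeparatingLeft) {m : ℕ} {f : Fin m × ℤˣ → W}
    (hf : IsHyperbolic h f) {a : Fin m → ℝ} (hfL : ∀ i, f i ∈ L.toFun (crd a i)) {x : W}
    (hx : x ≠ 0) (hfx : ∀ i, h (f i) x = 0) (hxx : h x x = 0) :
    ∃ (f' : Fin (m + 1) × ℤˣ → W) (a' : Fin (m + 1) → ℝ), IsHyperbolic h f' ∧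
      ∀ i, f' i ∈ L.toFun (crd a' i) := by
  have hF := L.isFiltration
  -- a dual partner of `x`, made orthogonal to the family and then isotropic
  obtain ⟨s, y, hxs, hys, hyx⟩ := hL.exists_partner hd H.invol hnd hx
  obtain ⟨-, hpL⟩ := hL.part_mem (ε := ε) hfL hys
  set p := part ε h f y with hp
  have hfp : ∀ i, h (f i) p = 0 := fun i => hf.orth_part H.herm i y
  have hpx : h p x = 1 := by
    have h1 := hf.form_expand H.herm y x
    rw [part_of_orth hfx, hyx] at h1
    simpa [coef_of_orth hfx] using h1.symm
  have hxp : h x p = ((ε : ℤ) : K) := by rw [H.herm, hpx, map_one, mul_one]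
  set k := -(h p p / 2) with hk
  have hkv : ((-s + -s : ℝ) : WithTop ℝ) ≤ v k := by
    rw [hk, v.map_neg, H.val_half_mul]
    exact hL.le_form hpL hpL
  set q := p + k • x with hq
  have hqL : q ∈ L.toFun (-s) := hF.add hpL (hF.anti (by linarith) (hF.smul hkv hxs))
  have hqx : h q x = 1 := by
    rw [hq, map_add, LinearMap.add_apply, form_smul_left, hpx, hxx, mul_zero, add_zero]
  have hfq : ∀ i, h (f i) q = 0 := fun i => by
    rw [hq, map_add, map_smul, hfp, hfx, smul_zero, add_zero]
  have hqq : h q q = 0 := by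
    have h2 := H.two_ne_zero
    have h3 : τ (h p p) * ((ε : ℤ) : K) = h p p := by
      conv_rhs => rw [H.herm]
      exact mul_comm _ _
    have h4 : τ k = -(τ (h p p) / 2) := by rw [hk, map_neg, map_div₀, map_ofNat]
    simp only [hq, map_add, LinearMap.add_apply, map_smul, form_smul_left, hpx, hxp, hxx, h4,
      smul_eq_mul]
    rw [hk]
    field_simp
    rw [mul_comm, h3]
    ring
  have hxq : h x q = ((ε : ℤ) : K) := by rw [H.herm, hqx, map_one, mul_one]
  refine ⟨fun i => Fin.lastCases (motive := fun _ => W) (if i.2 = 1 then q else x)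
    (fun k => f (k, i.2)) i.1, Fin.snoc (α := fun _ => ℝ) a (-s), ⟨?_, ?_⟩, ?_⟩
  · rintro ⟨i1, i2⟩ ⟨j1, j2⟩ hij
    induction i1 using Fin.lastCases with
    | last =>
      induction j1 using Fin.lastCases with
      | last =>
        have : j2 = i2 := by
          by_contra hcon
          refine hij (Prod.ext rfl ?_)
          exact (Int.units_ne_iff_eq_neg.1 hcon)
        subst this
        simp only [Fin.lastCases_last]
        split_ifs
        · exact hqq
        · exact hxx
      | cast j1 =>
        simp only [Fin.lastCases_last, Fin.lastCases_castSucc]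
        split_ifs
        · exact H.herm.eq_zero (hfq _)
        · exact H.herm.eq_zero (hfx _)
    | cast i1 =>
      induction j1 using Fin.lastCases with
      | last =>
        simp only [Fin.lastCases_last, Fin.lastCases_castSucc]
        split_ifs
        · exact hfq _
        · exact hfx _
      | cast j1 =>
        simp only [Fin.lastCases_castSucc]
        refine hf.orth _ _ fun e => hij ?_
        have e1 := congrArg Prod.fst e
        have e2 := congrArg Prod.snd e
        exact Prod.ext (congrArg Fin.castSucc e1) e2
  · intro k
    induction k using Fin.lastCases with
    | last => simpa using hqx
    | cast k => simpa using hf.pair k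
  · rintro ⟨i1, i2⟩
    induction i1 using Fin.lastCases with
    | last =>
      rcases Int.units_eq_one_or i2 with rfl | rfl
      · simpa [crd] using hqL
      · simpa [crd] using hxs
    | cast i1 => simpa [crd] using hfL (i1, i2)

/-- For each self-dual lattice function there is a Witt decomposition whose dual vectors lie in
opposite steps. It is obtained from a hyperbolic family of maximal size with this property. -/
theorem IsSelfDual.exists_adapted_frame (hL : IsSelfDual h L) (H : HermitianSetting v ε h)
    (hd : DiscreteValues v) (hnd : h.SeparatingLeft) :
    ∃ (w' : WittFrame h) (a : Fin w'.rank → ℝ), ∀ i, w'.e i ∈ L.toFun (crd a i) := by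
  classical
  let Q : ℕ → Prop := fun m => ∃ (f : Fin m × ℤˣ → W) (a : Fin m → ℝ), IsHyperbolic h f ∧
    ∀ i, f i ∈ L.toFun (crd a i)
  have hbound : ∀ m, Q m → m ≤ Module.finrank K W := by
    rintro m ⟨f, a, hf, -⟩
    have := (hf.linearIndependent H.herm).fintype_card_le_finrank
    simp only [Fintype.card_prod, Fintype.card_fin] at this
    exact le_trans (Nat.le_mul_of_pos_right m Fintype.card_pos) this
  have h0 : Q 0 := ⟨fun i => i.1.elim0, fun i => i.elim0, ⟨fun i => i.1.elim0, fun i => i.elim0⟩,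
    fun i => i.1.elim0⟩
  obtain ⟨m, ⟨f, a, hf, hfL⟩, hm⟩ : ∃ m, Q m ∧ ¬ Q (m + 1) := by
    by_contra! hcon
    have hall : ∀ m, Q m := fun m => by
      induction m with
      | zero => exact h0
      | succ m ih => exact hcon m ih
    have := hbound _ (hall (Module.finrank K W + 1))
    omega
  refine ⟨⟨m, f, hf.orth, hf.pair, fun x hfx hxx => ?_⟩, a, hfL⟩
  by_contra hx
  exact hm (hL.exists_extension H hd hnd hf hfL hx hfx hxx)

end SelfDual

section ClassicalIdent

variable {K : Type*} [Field K] {τ : K →+* K} {W : Type*} [AddCommGroup W] [Module K W]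
  [FiniteDimensional K W]
  {v : AddValuation K (WithTop ℝ)} {ε : ℤˣ} {h : W →ₛₗ[τ] W →ₗ[K] K} {w : WittFrame h}

omit [FiniteDimensional K W] in
/-- An element of `N` which moves `x` to `y` maps the standard filtration at `x` to that at `y`. -/
theorem inStd_apply_iff_of_move (H : HermitianSetting v ε h) (hCS : OrthCauchySchwarz v h w.e)
    {n : isometryGroup h} {x y : Fin w.rank → ℝ} (hn : w.move v n x y) (r : ℝ) (z : W) :
    InStd v ε h w.e y r (n.1 z) ↔ InStd v ε h w.e x r z := by
  have hf := w.isHyperbolic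
  refine inStd_apply_iff_of_generators H hf hCS (fun i => ?_) (fun r z hz hr => ?_) r z
  · obtain ⟨j, c, hc⟩ := hn.1 i
    rw [hc, inStd_smul_iff H hf]
    by_cases h0 : c = 0
    · rw [h0]; exact le_zero_val _
    · have : crd y j = crd x i - val v c := hn.2 i j c hc
      rw [le_iff_val h0]
      linarith
  · rw [inStd_orth_iff, n.2]
    · exact hr
    · intro k
      obtain ⟨i, c, hc0, hc⟩ := exists_monomial_inv (hf.linearIndependent H.herm) hn.1 k
      have h1 : h (n.1 (w.e i)) (n.1 z) = 0 := by rw [n.2, hz]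
      rw [hc, form_smul_left] at h1
      exact (mul_eq_zero.1 h1).resolve_left fun h2 => hc0 ((map_eq_zero τ).1 h2)

omit [FiniteDimensional K W] in
/-- A monomial isometry which maps the standard filtration at `x` to that at `y` moves `x` to
`y`. -/
theorem WittFrame.move_of_inStd (H : HermitianSetting v ε h) {n : isometryGroup h}
    {x y : Fin w.rank → ℝ} (hmon : ∀ i, ∃ j, ∃ c : K, n.1 (w.e i) = c • w.e j)
    (hn : ∀ r z, InStd v ε h w.e y r (n.1 z) ↔ InStd v ε h w.e x r z) : w.move v n x y := by
  have hf := w.isHyperbolic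
  refine ⟨hmon, fun i j c hc => ?_⟩
  change crd y j = crd x i - val v c
  have h0 : c ≠ 0 := by
    rintro rfl
    rw [zero_smul] at hc
    exact hf.ne_zero H.herm i (by simpa using hc)
  have key : ∀ r, r - crd y j ≤ val v c ↔ r ≤ crd x i := fun r => by
    have h1 := hn r (w.e i)
    have h2 := inStd_smul_iff (v := v) H hf (x := x) (i := i) (c := 1) (r := r)
    rw [one_smul] at h2
    rw [hc, inStd_smul_iff H hf, le_iff_val h0, h2, le_iff_val one_ne_zero, val_one] at h1
    rw [h1, sub_nonpos]
  have h1 := (key (crd x i)).2 le_rfl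
  have h2 := (key (val v c + crd y j)).1 (by linarith)
  linarith

/-- The building of a classical group is identified with the set of self-dual lattice functions;
on the standard apartment the identification is given by the standard filtrations. -/
theorem exists_isClassicalIdent (hd : DiscreteValues v) (hc : CompleteVal v)
    (H : HermitianSetting v ε h) (hnd : h.SeparatingLeft) (w : WittFrame h) :
    ∃ j : ClassicalBuilding v w → LatticeFunction v W, IsClassicalIdent w h j := by
  have hf := w.isHyperbolic
  have hCS := H.orthCauchySchwarz hc w
  obtain ⟨S, hS, hbar⟩ := exists_stdLattice (w := w) H hc hd
  have hmap : ∀ (g : isometryGroup h) x y,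
      (∀ r z, InStd v ε h w.e y r (g.1 z) ↔ InStd v ε h w.e x r z) → (S x).map g.1 = S y :=
    fun g x y hg => LatticeFunction.ext_mem fun r z => by
      rw [LatticeFunction.mem_map, hS, hS, ← hg, g.1.apply_symm_apply]
  have hmap' : ∀ (g : isometryGroup h) x y, (S x).map g.1 = S y →
      ∀ r z, InStd v ε h w.e y r (g.1 z) ↔ InStd v ε h w.e x r z := fun g x y hg r z => by
    rw [← hS, ← hg, LatticeFunction.apply_mem_map, hS]
  obtain ⟨j, hj, hinj, hact⟩ := GlueSpace.exists_map (move := w.move v) (U := w.unip v)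
    (fun (g : isometryGroup h) L => LatticeFunction.map (v := v) g.1 L) LatticeFunction.map_one
    (fun g g' L => LatticeFunction.map_mul g.1 g'.1 L) S
    (fun n x y hn => hmap n x y (inStd_apply_iff_of_move H hCS hn))
    (fun x u hu => hmap u x x (inStd_apply_iff_of_mem_unip H hCS hu))
    (fun g x y hg => by
      have hg' := hmap' g x y hg
      have hfg : IsHyperbolic h fun i => g.1 (w.e i) :=
        ⟨fun i j hij => by rw [g.2]; exact hf.orth i j hij, fun k => by rw [g.2]; exact hf.pair k⟩
      obtain ⟨u, hu, hul⟩ := exists_hyperbolic_reduction H hCS hnd hfg (a := x)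
        (fun i => (hg' _ _).2 (inStd_self H hf x i)) w.rank
      have hmon : ∀ i, ∃ j, ∃ c : K, (u * g).1 (w.e i) = c • w.e j := fun i => hul i i.1.2
      have hug : ∀ r z, InStd v ε h w.e y r ((u * g).1 z) ↔ InStd v ε h w.e x r z := fun r z =>
        (inStd_apply_iff_of_mem_unip H hCS hu r (g.1 z)).trans (hg' r z)
      refine ⟨(u * g)⁻¹, WittFrame.move_of_inStd H (fun k => ?_) fun r z => ?_, ?_⟩
      · obtain ⟨i, c, hc0, hc⟩ := exists_monomial_inv (hf.linearIndependent H.herm) hmon k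
        refine ⟨i, c⁻¹, ?_⟩
        change (u * g).1.symm (w.e k) = _
        rw [LinearEquiv.symm_apply_eq, map_smul, hc, smul_smul, inv_mul_cancel₀ hc0, one_smul]
      · rw [← hug]
        change InStd v ε h w.e y r ((u * g).1 ((u * g).1.symm z)) ↔ _
        rw [LinearEquiv.apply_symm_apply]
      · rw [mul_inv_rev, mul_inv_cancel_left]
        exact Subgroup.inv_mem _ hu)
  have hSd : ∀ x, IsSelfDual h (S x) := fun x r y => by
    simp only [hS]
    exact inStd_iff_dual H hf hCS x r y
  refine ⟨j, ⟨?_, hinj.injOn, ?_⟩, fun g p r y => ?_, fun g x y t _ => ?_⟩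
  · intro p _
    obtain ⟨g, x, rfl⟩ := p.exists_mk
    rw [hj]
    exact (hSd x).map g
  · intro L hL
    obtain ⟨w', a, ha⟩ := IsSelfDual.exists_adapted_frame hL H hd hnd
    have hr : w'.rank = w.rank :=
      le_antisymm (w.rank_le w' H.herm H.invol H.two_ne_zero hnd)
        (w'.rank_le w H.herm H.invol H.two_ne_zero hnd)
    obtain ⟨m, f, o, p, an⟩ := w'
    obtain rfl : m = w.rank := hr
    obtain ⟨g, hg⟩ := w.exists_conj H.herm H.invol H.two_ne_zero hnd (f := f) ⟨o, p⟩
    refine ⟨GlueSpace.mk _ _ g a, Set.mem_univ _, ?_⟩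
    rw [hj]
    refine LatticeFunction.ext_mem fun r y => ?_
    have hL' : IsSelfDual h (L.map g⁻¹.1) := IsSelfDual.map hL g⁻¹
    have h1 : ∀ r y, y ∈ (L.map g⁻¹.1).toFun r ↔ g.1 y ∈ L.toFun r := fun r y =>
      LatticeFunction.mem_map
    have h2 := hL'.mem_iff_inStd H hf hCS (x := a) fun i => by
      rw [h1, hg]
      exact ha i
    rw [LatticeFunction.mem_map, hS, ← h2, h1, g.1.apply_symm_apply]
  · rw [hact]
    exact LatticeFunction.apply_mem_map
  · rw [hj, hj, hj]
    exact (hbar t x y).map g.1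

end ClassicalIdent

/-! ### Uniqueness of the identification for a classical group -/

/-- A concave periodic function on the line is constant. -/
theorem eq_of_concave_periodic {f : ℝ → ℝ} {P : ℝ} (hP : 0 < P) (hper : ∀ p, f (p + P) = f p)
    (hconc : ∀ p q, ∀ t ∈ Set.Icc (0 : ℝ) 1, t * f p + (1 - t) * f q ≤ f (t * p + (1 - t) * q))
    (p q : ℝ) : f p = f q := by
  have hN : ∀ (n : ℕ) p, f (p + n * P) = f p := fun n => by
    induction n with
    | zero => simp
    | succ n ih =>
      intro p
      rw [← ih p, ← hper (p + n * P)]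
      congr 1
      push_cast
      ring
  have key : ∀ p q, f p ≤ f q := fun p q => by
    obtain ⟨n, hn⟩ := exists_nat_gt (|q - p| / P)
    rw [div_lt_iff₀ hP] at hn
    have hn0 : 0 < n * P := lt_of_le_of_lt (abs_nonneg _) hn
    obtain ⟨h1, h2⟩ := abs_lt.1 hn
    -- `q` lies between `p - n P` and `p + n P`, where `f` takes the value `f p`
    have h3 := hconc (p - n * P) (p + n * P) ((p + n * P - q) / (2 * (n * P)))
      ⟨div_nonneg (by linarith) (by linarith), (div_le_one (by linarith)).2 (by linarith)⟩
    have h4 := hN n (p - n * P)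
    rw [sub_add_cancel] at h4
    rw [hN, ← h4, ← add_mul, add_sub_cancel, one_mul] at h3
    convert h3 using 2
    generalize n * P = N at hn0
    field_simp
    ring
  exact le_antisymm (key p q) (key q p)

theorem crd_affine {m : ℕ} (x y : Fin m → ℝ) (t : ℝ) (i : Fin m × ℤˣ) :
    crd (t • x + (1 - t) • y) i = t * crd x i + (1 - t) * crd y i := by
  simp only [crd, Pi.add_apply, Pi.smul_apply, smul_eq_mul]
  ring

section Monomial

variable {K : Type*} [Field K] {τ : K →+* K} {W : Type*} [AddCommGroup W] [Module K W]
  {v : AddValuation K (WithTop ℝ)} {ε : ℤˣ} {h : W →ₛₗ[τ] W →ₗ[K] K} {w : WittFrame h}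

theorem WittFrame.move_of_smul (H : IsEpsHermitian ε h) {n : isometryGroup h}
    {π : Fin w.rank × ℤˣ → Fin w.rank × ℤˣ} {c : Fin w.rank × ℤˣ → K}
    (hn : ∀ i, n.1 (w.e i) = c i • w.e (π i)) {x y : Fin w.rank → ℝ}
    (hxy : ∀ i, crd y (π i) = crd x i - val v (c i)) : w.move v n x y := by
  have hf := w.isHyperbolic
  refine ⟨fun i => ⟨_, _, hn i⟩, fun i j d hd => ?_⟩
  have hc0 : c i ≠ 0 := fun h0 => by
    have := hn i
    rw [h0, zero_smul] at this
    exact hf.ne_zero H i (by simpa using this)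
  have e1 : c i • w.e (π i) = d • w.e j := (hn i).symm.trans hd
  have e2 : c i = d * coef ε h w.e (π i) (w.e j) := by
    have := congrArg (coef ε h w.e (π i)) e1
    rwa [map_smul, map_smul, hf.coef_self H, smul_eq_mul, smul_eq_mul, mul_one] at this
  have hj : π i = j := by
    by_contra hne
    rw [hf.coef_ne hne, mul_zero] at e2
    exact hc0 e2
  subst hj
  rw [hf.coef_self H, mul_one] at e2
  rw [← e2]
  exact hxy i

variable [FiniteDimensional K W]

theorem WittFrame.exists_diagonal (w : WittFrame h) (H : IsEpsHermitian ε h)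
    (hnd : h.SeparatingLeft) (c : Fin w.rank × ℤˣ → K)
    (hc : ∀ k, τ (c (k, 1)) * c (k, -1) = 1) :
    ∃ g : isometryGroup h, (∀ i, g.1 (w.e i) = c i • w.e i) ∧
      ∀ z, (∀ i, h (w.e i) z = 0) → g.1 z = z := by
  refine w.isHyperbolic.exists_isometry H hnd ⟨fun i j hij => ?_, fun k => ?_⟩ fun z hz i => ?_
  · rw [form_smul_left, map_smul, w.orth i j hij, smul_zero, mul_zero]
  · rw [form_smul_left, map_smul, w.pair, smul_eq_mul, mul_one, hc]
  · rw [form_smul_left, hz, mul_zero]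

/-- The reflection in the coordinate `k`: an isometry which exchanges, up to units, `e_k` and
`e_{-k}`. -/
theorem exists_frame_swap (w : WittFrame h) (H : IsEpsHermitian ε h)
    (hnd : h.SeparatingLeft) (k : Fin w.rank) :
    ∃ g : isometryGroup h, ∀ i, g.1 (w.e i) =
      (if i.1 = k then sgn K ε (opp i) else 1) • w.e (if i.1 = k then opp i else i) := by
  have hf := w.isHyperbolic
  refine (hf.exists_isometry H hnd ⟨fun i j hij => ?_, fun l => ?_⟩ fun z hz i => ?_).imp
    fun g hg => hg.1
  · rw [form_smul_left, map_smul, hf.orth, smul_zero, mul_zero]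
    intro e
    apply hij
    by_cases hi : i.1 = k
    · have hj : j.1 = k := by
        by_contra hj
        rw [if_pos hi, if_neg hj, opp_opp] at e
        exact hj (e ▸ hi)
      rw [if_pos hi, if_pos hj, opp_opp] at e
      rw [← e, opp_opp]
    · have hj : j.1 ≠ k := by
        intro hj
        rw [if_neg hi, if_pos hj] at e
        exact hi ((congrArg Prod.fst e).symm.trans hj)
      rwa [if_neg hi, if_neg hj] at e
  · dsimp only
    split_ifs
    · have e1 : opp (l, (-1 : ℤˣ)) = (l, 1) := by simp [opp]
      rw [e1, form_smul_left, map_smul, hf.form_opp H, map_sgn, smul_eq_mul]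
      simp [sgn, opp, unit_mul_self]
    · rw [form_smul_left, map_smul, w.pair]
      simp
  · rw [form_smul_left, hz, mul_zero]

end Monomial

section Uniqueness

variable {K : Type*} [Field K] {τ : K →+* K} {W : Type*} [AddCommGroup W] [Module K W]
  [FiniteDimensional K W]
  {v : AddValuation K (WithTop ℝ)} {ε : ℤˣ} {h : W →ₛₗ[τ] W →ₗ[K] K} {w : WittFrame h}

/-- An affine map from the standard apartment to the self-dual lattice functions, which is
compatible with the action of `N`. -/
structure IsApartmentMap (w : WittFrame h) (L : (Fin w.rank → ℝ) → LatticeFunction v W) :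
    Prop where
  dual : ∀ x, IsSelfDual h (L x)
  move : ∀ n x y, w.move v n x y → ∀ r z, n.1 z ∈ (L y).toFun r ↔ z ∈ (L x).toFun r
  bary : ∀ x y, ∀ t ∈ Set.Icc (0 : ℝ) 1, IsBarycenter t (L x) (L y) (L (t • x + (1 - t) • y))

/-- The norm of the frame vector `i` at the point `x`, relative to its value for the standard
filtration. -/
def defect {w : WittFrame h} (L : (Fin w.rank → ℝ) → LatticeFunction v W) (i : Fin w.rank × ℤˣ)
    (x : Fin w.rank → ℝ) : ℝ :=
  nrm (fun r y => y ∈ (L x).toFun r) (w.e i) - crd x i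

variable {L : (Fin w.rank → ℝ) → LatticeFunction v W} (H : HermitianSetting v ε h)
  (hd : DiscreteValues v)
include H hd

omit [FiniteDimensional K W] in
theorem smul_frame_mem_iff {i : Fin w.rank × ℤˣ} {x : Fin w.rank → ℝ} {c : K} (hc : c ≠ 0)
    {r : ℝ} : c • w.e i ∈ (L x).toFun r ↔ r ≤ crd x i + defect L i x + val v c := by
  rw [(L x).isFiltration.smul_iff hc, (L x).isFiltration.le_nrm_iff
    (separated_of_boundedForms ((L x).boundedForms hd)) (w.isHyperbolic.ne_zero H.herm i), defect]
  constructor <;> intro h <;> linarith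

omit [FiniteDimensional K W] in
theorem frame_mem_iff {i : Fin w.rank × ℤˣ} {x : Fin w.rank → ℝ} {r : ℝ} :
    w.e i ∈ (L x).toFun r ↔ r ≤ crd x i + defect L i x := by
  have := smul_frame_mem_iff (L := L) H hd (i := i) (x := x) (one_ne_zero (α := K)) (r := r)
  rwa [one_smul, val_one, add_zero] at this

variable (hL : IsApartmentMap w L)
include hL

omit [FiniteDimensional K W] in
theorem IsApartmentMap.defect_eq_of_smul {n : isometryGroup h}
    {π : Fin w.rank × ℤˣ → Fin w.rank × ℤˣ} {c : Fin w.rank × ℤˣ → K}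
    (hn : ∀ i, n.1 (w.e i) = c i • w.e (π i)) (hc : ∀ i, c i ≠ 0)
    {x y : Fin w.rank → ℝ} (hxy : ∀ i, crd y (π i) = crd x i - val v (c i))
    (i : Fin w.rank × ℤˣ) : defect L (π i) y = defect L i x := by
  have h1 := hL.move n x y (WittFrame.move_of_smul H.herm hn hxy)
  have key : ∀ r, r ≤ crd y (π i) + defect L (π i) y + val v (c i) ↔ r ≤ crd x i + defect L i x :=
    fun r => by rw [← smul_frame_mem_iff H hd (hc i), ← frame_mem_iff H hd, ← h1, hn]
  have h2 := hxy i
  have h3 := (key _).1 le_rfl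
  have h4 := (key _).2 le_rfl
  linarith

omit [FiniteDimensional K W] in
theorem IsApartmentMap.defect_concave (i : Fin w.rank × ℤˣ) (x y : Fin w.rank → ℝ) {t : ℝ}
    (ht : t ∈ Set.Icc (0 : ℝ) 1) :
    t * defect L i x + (1 - t) * defect L i y ≤ defect L i (t • x + (1 - t) • y) := by
  have h1 := (hL.bary x y t ht).mem ht ((frame_mem_iff H hd (i := i)).2 le_rfl)
    ((frame_mem_iff H hd (i := i)).2 le_rfl)
  rw [frame_mem_iff H hd, crd_affine] at h1
  linarith

variable (hnd : h.SeparatingLeft)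
include hnd

/-- The defect does not change along a coordinate axis, where it is concave and periodic. -/
theorem IsApartmentMap.defect_update (i : Fin w.rank × ℤˣ) (x : Fin w.rank → ℝ) (k : Fin w.rank)
    (s : ℝ) : defect L i (Function.update x k s) = defect L i x := by
  obtain ⟨ϖ, h0, hϖ⟩ := hd.nontrivial
  have h0' : τ ϖ ≠ 0 := fun h => h0 ((map_eq_zero τ).1 h)
  -- a diagonal isometry which translates the coordinate `k` by `val v ϖ`
  let c : Fin w.rank × ℤˣ → K := fun i =>
    if i.1 = k then (if i.2 = 1 then ϖ⁻¹ else τ ϖ) else 1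
  have hc0 : ∀ i, c i ≠ 0 := fun i => by
    simp only [c]
    split_ifs
    exacts [inv_ne_zero h0, h0', one_ne_zero]
  obtain ⟨g, hg, -⟩ := w.exists_diagonal H.herm hnd c fun l => by
    simp only [c]
    by_cases hl : l = k
    · simp [hl, h0']
    · simp [hl]
  have hτ : val v (τ ϖ) = val v ϖ := val_eq_of (by rw [H.isom, coe_val h0])
  have := eq_of_concave_periodic (f := fun s => defect L i (Function.update x k s)) hϖ
    (fun p => by
      refine hL.defect_eq_of_smul H hd (π := id) hg hc0 (fun j => ?_) i
      obtain ⟨j1, j2⟩ := j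
      by_cases hj : j1 = k
      · subst hj
        rcases Int.units_eq_one_or j2 with rfl | rfl
        · simp [crd, c, val_inv h0]
        · simp [crd, c, hτ]
          ring
      · simp [crd, c, hj, val_one])
    (fun p q t ht => by
      have := hL.defect_concave H hd i (Function.update x k p) (Function.update x k q) ht
      convert this using 2
      ext l
      by_cases hl : l = k
      · subst hl; simp
      · simp [hl]
        ring) s (x k)
  simpa using this

theorem IsApartmentMap.defect_eq_zero_point (i : Fin w.rank × ℤˣ) (x : Fin w.rank → ℝ) :
    defect L i x = defect L i 0 := by
  classical
  have key : ∀ s : Finset (Fin w.rank), defect L i (fun k => if k ∈ s then x k else 0) =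
      defect L i 0 := fun s => by
    induction s using Finset.induction_on with
    | empty => simp; rfl
    | insert a s ha ih =>
      rw [← ih, ← hL.defect_update H hd hnd i (fun k => if k ∈ s then x k else 0) a (x a)]
      congr 1
      ext l
      by_cases hl : l = a
      · subst hl; simp
      · simp [hl]
  simpa using key Finset.univ

theorem IsApartmentMap.defect_opp (i : Fin w.rank × ℤˣ) : defect L (opp i) 0 = defect L i 0 := by
  obtain ⟨g, hg⟩ := exists_frame_swap w H.herm hnd i.1
  have h1 := hL.defect_eq_of_smul H hd hg (x := 0) (y := 0) (fun j => by
    split_ifs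
    exacts [sgn_ne_zero _, one_ne_zero]) (fun j => by
    have : val v (if j.1 = i.1 then sgn K ε (opp j) else 1) = 0 := by
      split_ifs
      · exact val_eq_of (val_sgn _)
      · exact val_one
    rw [this]
    simp [crd]) i
  simpa using h1

omit hd in
/-- The projection to the hyperbolic plane `k` preserves the lattice functions of the apartment. -/
theorem IsApartmentMap.plane_mem (k : Fin w.rank) {x : Fin w.rank → ℝ} {r : ℝ} {u : W}
    (hu : u ∈ (L x).toFun r) :
    coef ε h w.e (k, 1) u • w.e (k, 1) + coef ε h w.e (k, -1) u • w.e (k, -1) ∈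
      (L x).toFun r := by
  have hf := w.isHyperbolic
  -- the projection is `(1 - g) / 2`, where `g` is `-1` on the plane and `1` on its complement
  obtain ⟨g, hg, hgz⟩ := w.exists_diagonal H.herm hnd (fun i => if i.1 = k then -1 else 1)
    fun l => by
      dsimp only
      split_ifs
      · rw [map_neg, map_one]; ring
      · rw [map_one, mul_one]
  have hgL : g.1 u ∈ (L x).toFun r := by
    refine (hL.move g x x (WittFrame.move_of_smul (π := id) H.herm hg fun i => ?_) r u).2 hu
    split_ifs
    · rw [val_eq_of (map_neg_one (v := v)), sub_zero]; rfl
    · rw [val_one, sub_zero]; rfl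
  have h2 := H.two_ne_zero
  have h3 : (1 / 2 : K) • (u - g.1 u) ∈ (L x).toFun r := by
    have hF := (L x).isFiltration
    have := hF.smul (c := (1 / 2 : K)) (t := 0) (by
      rw [H.val_half_mul, v.map_one]; rfl) (hF.sub hu hgL)
    rwa [add_zero] at this
  convert h3 using 1
  have h4 : g.1 u = ∑ i, coef ε h w.e i u • (if i.1 = k then (-1 : K) else 1) • w.e i +
      part ε h w.e u := by
    conv_lhs => rw [eq_sum_add_part (ε := ε) (h := h) (f := w.e) u]
    rw [map_add, map_sum, hgz _ fun i => hf.orth_part H.herm i u]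
    simp only [map_smul, hg]
  have h5 : u - g.1 u = ∑ i, coef ε h w.e i u • (if i.1 = k then (2 : K) else 0) • w.e i := by
    have h6 : u - g.1 u = ∑ i, coef ε h w.e i u • w.e i + part ε h w.e u - g.1 u :=
      congrArg (· - g.1 u) (eq_sum_add_part u)
    rw [h6, h4, add_sub_add_right_eq_sub, ← Finset.sum_sub_distrib]
    refine Finset.sum_congr rfl fun i _ => ?_
    rw [← smul_sub]
    congr 1
    split_ifs
    · rw [neg_smul, one_smul, two_smul]; abel
    · rw [one_smul, zero_smul, sub_self]
  have h6 : ∀ f : Fin w.rank × ℤˣ → W, (∀ i, i.1 ≠ k → f i = 0) →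
      ∑ i, f i = f (k, 1) + f (k, -1) := fun f hf => by
    rw [Fintype.sum_prod_type, Finset.sum_eq_single k]
    · rw [show (Finset.univ : Finset ℤˣ) = {1, -1} from rfl, Finset.sum_pair (by decide)]
    · exact fun l _ hl => Finset.sum_eq_zero fun s _ => hf _ hl
    · simp
  rw [h5, h6 _ fun i hi => by rw [if_neg hi, zero_smul, smul_zero]]
  simp only [if_true]
  rw [smul_comm _ (2 : K), smul_comm _ (2 : K), ← smul_add, smul_smul, one_div_mul_cancel h2,
    one_smul]

/-- The norms of the frame vectors are at least those of the standard filtration. If they were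
smaller by `T > 0`, then `e₋` would not be in the step `0` at the origin, so by self-duality some
`y` in a step `s > 0` would have `v (h e₋ y) ≤ 0`. As the origin is the midpoint of `± T`, the
vector `y` is a sum of vectors which lie in steps `p` and `q` at these two points, with
`p + q = 2 s`; the plane component of such a vector has `v (h e₋ ·) > 0`. -/
theorem IsApartmentMap.defect_nonneg (k : Fin w.rank) : 0 ≤ defect L (k, -1) 0 := by
  classical
  by_contra! hneg
  have hf := w.isHyperbolic
  set a := defect L (k, -1) 0 with ha
  have hdef : ∀ x, defect L (k, -1) x = a := fun x => hL.defect_eq_zero_point H hd hnd _ x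
  have hdef' : ∀ x, defect L (k, 1) x = a := fun x => by
    rw [hL.defect_eq_zero_point H hd hnd _ x, ha, ← hL.defect_opp H hd hnd (k, 1)]
    rfl
  have he : w.e (k, -1) ∉ (L 0).toFun 0 := fun hcon => by
    have := (frame_mem_iff H hd).1 hcon
    rw [hdef] at this
    simp [crd] at this
    linarith
  rw [hL.dual 0] at he
  push Not at he
  obtain ⟨s, hs, y, hy, hhy⟩ := he
  rw [gt_iff_lt, neg_zero] at hs
  let X : Fin w.rank → ℝ := Function.update 0 k (-a)
  have hX : ((1 / 2 : ℝ) • (-X) + (1 - (1 / 2 : ℝ)) • X) = 0 := by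
    ext l
    simp
    ring
  have hbar := hL.bary (-X) X (1 / 2) ⟨by norm_num, by norm_num⟩
  rw [hX] at hbar
  obtain ⟨n, u, rfl, hu⟩ := hbar.exists_sum hy
  obtain ⟨m, hm⟩ : ∃ m, v (h (w.e (k, -1)) (u m)) ≤ 0 := by
    by_contra! hcon
    rw [map_sum] at hhy
    refine absurd ?_ (not_lt.2 hhy)
    exact v.map_lt_sum (by exact WithTop.coe_ne_top (a := (0 : ℝ))) fun m _ => hcon m
  obtain ⟨p, q, hpq, hp, hq⟩ := hu m
  have hp' := hL.plane_mem H hnd k hp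
  have hq' := hL.plane_mem H hnd k hq
  set d := coef ε h w.e (k, 1) (u m) with hdd
  set c := coef ε h w.e (k, -1) (u m) with hcc
  have ho1 : opp (k, (1 : ℤˣ)) = (k, (-1 : ℤˣ)) := rfl
  have ho2 : opp (k, (-1 : ℤˣ)) = (k, (1 : ℤˣ)) := by simp [opp]
  have hdv : v d ≤ 0 := by rw [hdd, val_coef, ho1]; exact hm
  have hd0 : d ≠ 0 := fun h0 => by
    rw [h0, v.map_zero] at hdv
    exact absurd hdv (not_le.2 (WithTop.coe_lt_top (0 : ℝ)))
  have hdv' : val v d ≤ 0 := by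
    have : ((val v d : ℝ) : WithTop ℝ) ≤ ((0 : ℝ) : WithTop ℝ) := by rw [coe_val hd0]; exact hdv
    exact WithTop.coe_le_coe.1 this
  have hX1 : crd X (k, 1) = -a := by simp [crd, X]
  have hX2 : crd X (k, -1) = a := by simp [crd, X]
  have hX3 : crd (-X) (k, 1) = a := by simp [crd, X]
  have hX4 : crd (-X) (k, -1) = -a := by simp [crd, X]
  -- the pairing with `e₋` at `-X` bounds `d`, the pairing with `e₊` at `X` bounds `c`
  have hdp : p ≤ val v d := by
    have h1 := (hL.dual (-X)).le_form ((frame_mem_iff H hd (i := (k, -1)) (r := 0)).2 (by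
      rw [hdef, hX4]; linarith)) hp
    rw [← ho1, ← val_coef (ε := ε), ← hdd, zero_add] at h1
    exact (le_iff_val hd0).1 h1
  have hcq : ((q : ℝ) : WithTop ℝ) ≤ v c := by
    have h1 := (hL.dual X).le_form ((frame_mem_iff H hd (i := (k, 1)) (r := 0)).2 (by
      rw [hdef', hX1]; linarith)) hq
    rwa [← ho2, ← val_coef (ε := ε), ← hcc, zero_add] at h1
  have hce : ∀ (x : Fin w.rank → ℝ), c • w.e (k, -1) ∈ (L x).toFun (crd x (k, -1) + a + q) :=
    fun x => (L x).isFiltration.smul hcq ((frame_mem_iff H hd).2 (by rw [hdef]))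
  have hde : ∀ (x : Fin w.rank → ℝ) (r : ℝ),
      d • w.e (k, 1) + c • w.e (k, -1) ∈ (L x).toFun r → r ≤ crd x (k, -1) + a + q →
        r ≤ crd x (k, 1) + a + val v d := fun x r h1 h2 => by
    have h3 := (L x).isFiltration.sub h1 ((L x).isFiltration.anti h2 (hce x))
    rw [add_sub_cancel_right, smul_frame_mem_iff H hd hd0, hdef'] at h3
    exact h3
  have h1 := hde (-X) p hp' (by rw [hX4]; linarith)
  have h2 := hde X (q + 2 * a) ((L X).isFiltration.anti (by linarith) hq') (by rw [hX2]; linarith)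
  rw [hX3] at h1
  rw [hX1] at h2
  linarith

/-- An apartment map is the standard one: its defects for opposite indices are equal and
nonnegative. -/
theorem IsApartmentMap.mem_iff (hc : CompleteVal v) (x : Fin w.rank → ℝ) (r : ℝ) (y : W) :
    y ∈ (L x).toFun r ↔ InStd v ε h w.e x r y := by
  refine (hL.dual x).mem_iff_inStd H w.isHyperbolic (H.orthCauchySchwarz hc w) (fun i => ?_) r y
  rw [frame_mem_iff H hd, hL.defect_eq_zero_point H hd hnd]
  have h1 := hL.defect_nonneg H hd hnd i.1
  have h2 := hL.defect_opp H hd hnd (i.1, 1)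
  obtain ⟨i1, i2⟩ := i
  rcases Int.units_eq_one_or i2 with rfl | rfl
  · change defect L (i1, -1) 0 = _ at h2
    rw [← h2]
    linarith
  · linarith

omit hL in
/-- The identification of the building of a classical group is unique. -/
theorem IsClassicalIdent.unique (hc : CompleteVal v)
    {j j' : ClassicalBuilding v w → LatticeFunction v W} (hj : IsClassicalIdent w h j)
    (hj' : IsClassicalIdent w h j') : j = j' := by
  have key : ∀ {j : ClassicalBuilding v w → LatticeFunction v W}, IsClassicalIdent w h j →
      IsApartmentMap w fun x => j (GlueSpace.mk _ _ 1 x) := fun {j} hj =>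
    { dual := fun x => hj.1.mapsTo (Set.mem_univ _)
      move := fun n x y hn r z => by
        rw [← GlueSpace.mk_eq_of_move hn]
        exact hj.2.1 n _ r z
      bary := fun x y t ht => hj.2.2 1 x y t ht }
  funext p
  obtain ⟨g, x, rfl⟩ := p.exists_mk
  refine LatticeFunction.ext_mem fun r y => ?_
  have h1 : ∀ {j : ClassicalBuilding v w → LatticeFunction v W}, IsClassicalIdent w h j →
      (y ∈ (j (GlueSpace.mk _ _ g x)).toFun r ↔ InStd v ε h w.e x r (g.1.symm y)) :=
    fun {j} hj => by
      rw [← (key hj).mem_iff H hd hnd hc]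
      have := hj.2.1 g (GlueSpace.mk _ _ 1 x) r (g.1.symm y)
      rwa [g.1.apply_symm_apply, GlueSpace.smul_mk, mul_one] at this
  rw [h1 hj, h1 hj']

end Uniqueness

/-! ### The valuation of a local field -/

section LocalField

variable {Fo : Type*} [Field Fo] [ValuativeRel Fo] [TopologicalSpace Fo]
  [IsNonarchimedeanLocalField Fo] {v : AddValuation Fo (WithTop ℝ)}
  (hv : ∀ a b : Fo, a ≤ᵥ b ↔ v b ≤ v a)

omit [ValuativeRel Fo] [TopologicalSpace Fo] [IsNonarchimedeanLocalField Fo] in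
theorem discreteValues_of_int (hvZ : ∀ a : Fo, a ≠ 0 → ∃ m : ℤ, v a = (((m : ℤ) : ℝ) : WithTop ℝ))
    (hv1 : ∃ a : Fo, v a = ((1 : ℝ) : WithTop ℝ)) : DiscreteValues v where
  values := ⟨1, one_pos, fun x hx => by
    obtain ⟨m, hm⟩ := hvZ x hx
    exact ⟨m, by rw [val_eq_of hm, mul_one]⟩⟩
  nontrivial := by
    obtain ⟨a, ha⟩ := hv1
    exact ⟨a, ne_zero_of_coe ha, by rw [val_eq_of ha]; exact one_pos⟩

include hv

/-- Balls in a local field are compact; hence the sequences in `CompleteVal` have limits. -/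
theorem completeVal_of_isNonarchimedeanLocalField (hd : DiscreteValues v) : CompleteVal v := by
  have hball : ∀ c : Fo, IsCompact {x : Fo | v c ≤ v x} := fun c => by
    convert IsNonarchimedeanLocalField.isCompact_closedBall Fo (ValuativeRel.valuation Fo c)
      using 1
    ext x
    change v c ≤ v x ↔ ValuativeRel.valuation Fo x ≤ ValuativeRel.valuation Fo c
    rw [← hv, Valuation.Compatible.vle_iff_le (v := ValuativeRel.valuation Fo)]
  have hF : IsFiltration v fun r (x : Fo) => (r : WithTop ℝ) ≤ v x :=
    isFiltration_of_extends (K := Fo) fun _ => rfl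
  intro δ hδ a ha
  have hcau := hF.cauchy hδ ha
  obtain ⟨l, -, hl⟩ := (hball 1).exists_mapClusterPt (f := Filter.atTop)
    (u := fun n => a n - a 0) (by
      rw [Filter.le_principal_iff, Filter.mem_map]
      refine Filter.univ_mem' fun n => ?_
      have := hcau 0 n
      rw [zero_add, Nat.cast_zero, zero_mul] at this
      change v 1 ≤ v (a n - a 0)
      rwa [v.map_one])
  refine ⟨l + a 0, fun n => ?_⟩
  -- the ball `{y | n δ ≤ v (y - (a n - a 0))}` is closed and contains almost all terms
  obtain ⟨c, hc0, hcn, hcmin⟩ := hd.exists_min (n * δ)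
  have hiff : ∀ x : Fo, v c ≤ v x ↔ ((n * δ : ℝ) : WithTop ℝ) ≤ v x := fun x => by
    by_cases hx : x = 0
    · rw [hx, v.map_zero]; simp
    · rw [← coe_val hc0, le_iff_val hx, le_iff_val hx]
      exact ⟨fun h => hcn.trans h, hcmin x hx⟩
  have hclosed : IsClosed {y : Fo | v c ≤ v (y - (a n - a 0))} :=
    have : T2Space Fo := by
      let := IsTopologicalAddGroup.rightUniformSpace Fo
      have := isUniformAddGroup_of_addCommGroup (G := Fo)
      infer_instance
    (hball c).isClosed.preimage (continuous_id.sub continuous_const)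
  rw [← hiff, show l + a 0 - a n = l - (a n - a 0) by ring]
  refine isClosed_iff_clusterPt.1 hclosed l (ClusterPt.mono hl ?_)
  · rw [Filter.le_principal_iff, Filter.mem_map, Filter.mem_atTop_sets]
    refine ⟨n, fun m hm => ?_⟩
    obtain ⟨k, rfl⟩ := Nat.exists_eq_add_of_le hm
    change v c ≤ v (a (n + k) - a 0 - (a n - a 0))
    rw [hiff, sub_sub_sub_cancel_right]
    exact hcau n k

theorem val_two_eq_zero (hres : ringChar 𝓀[Fo] ≠ 2) : v 2 = 0 := by
  have h1 : (2 : 𝓀[Fo]) ≠ 0 := Ring.two_ne_zero hres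
  have h2 : IsUnit (2 : 𝒪[Fo]) := by
    by_contra hcon
    refine h1 ?_
    have h3 : (2 : 𝒪[Fo]) ∈ IsLocalRing.maximalIdeal 𝒪[Fo] :=
      (IsLocalRing.mem_maximalIdeal _).2 hcon
    have := (IsLocalRing.residue_eq_zero_iff (2 : 𝒪[Fo])).2 h3
    rwa [map_ofNat] at this
  obtain ⟨u, hu⟩ := h2
  have h0 : ∀ x : 𝒪[Fo], 0 ≤ v (x : Fo) := fun x => by
    have h4 : ValuativeRel.valuation Fo (x : Fo) ≤ ValuativeRel.valuation Fo 1 := by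
      rw [map_one]; exact x.2
    rw [← Valuation.Compatible.vle_iff_le (v := ValuativeRel.valuation Fo), hv, v.map_one] at h4
    exact h4
  have h5 : v ((u : 𝒪[Fo]) : Fo) + v ((u⁻¹ : 𝒪[Fo]ˣ) : 𝒪[Fo]) = 0 := by
    rw [← v.map_mul, ← MulMemClass.coe_mul, Units.mul_inv, OneMemClass.coe_one, v.map_one]
  have h6 : v ((u : 𝒪[Fo]) : Fo) = 0 := le_antisymm
    (by rw [← h5]; exact le_add_of_nonneg_right (h0 _)) (h0 _)
  rw [hu] at h6
  exact h6

end LocalField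

/-! ### Traces of extensions of degree at most two -/

section Trace

theorem zero_le_val_natCast {K : Type*} [Field K] (v : AddValuation K (WithTop ℝ)) (n : ℕ) :
    0 ≤ v (n : K) := by
  induction n with
  | zero => rw [Nat.cast_zero, v.map_zero]; exact le_top
  | succ n ih =>
    rw [Nat.cast_succ]
    exact v.map_le_add ih v.map_one.ge

theorem val_natCast_eq_zero {K : Type*} [Field K] {v : AddValuation K (WithTop ℝ)} (h2 : v 2 = 0)
    {n : ℕ} (h0 : 0 < n) (hn : n ≤ 2) : v (n : K) = 0 := by
  interval_cases n
  · rw [Nat.cast_one, v.map_one]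
  · exact_mod_cast h2

/-- The trace does not decrease valuations. -/
theorem le_val_trace_of_isGalois {K L : Type*} [Field K] [Field L] [Algebra K L]
    [FiniteDimensional K L] [IsGalois K L] {v : AddValuation L (WithTop ℝ)}
    (hv : ∀ (ρ : L ≃ₐ[K] L) x, v (ρ x) = v x) (x : L) :
    v x ≤ v (algebraMap K L (Algebra.trace K L x)) := by
  rw [trace_eq_sum_automorphisms]
  exact v.map_le_sum fun ρ _ => (hv ρ x).ge

variable {E : Type*} [Field E] {τ : E →+* E}

/-- The fixed field of a ring endomorphism. -/
abbrev fixedSubfield (τ : E →+* E) : Subfield E := τ.eqLocusField (RingHom.id E)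

variable (hinv : ∀ a, τ (τ a) = a)
include hinv

theorem two_mul_trace (x : E) : 2 * ((Algebra.trace (fixedSubfield τ) E x : fixedSubfield τ) : E) =
    Module.finrank (fixedSubfield τ) E * (x + τ x) := by
  let τ' : E ≃ₐ[fixedSubfield τ] E :=
    AlgEquiv.ofBijective { τ with commutes' := fun s => s.2 }
      ⟨τ.injective, fun x => ⟨τ x, hinv x⟩⟩
  have h1 := Algebra.trace_eq_of_algEquiv τ' x
  have h2 : x + τ x ∈ fixedSubfield τ := by
    change τ (x + τ x) = x + τ x
    rw [map_add, hinv, add_comm]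
  have h3 := Algebra.trace_algebraMap (S := E) (⟨x + τ x, h2⟩ : fixedSubfield τ)
  have h4 : algebraMap (fixedSubfield τ) E ⟨x + τ x, h2⟩ = x + τ' x := rfl
  rw [h4, map_add, h1] at h3
  have := congrArg (algebraMap (fixedSubfield τ) E) h3
  rw [map_add, map_nsmul, nsmul_eq_mul] at this
  rw [two_mul]
  exact this

theorem finrank_fixedSubfield (h2 : (2 : E) ≠ 0) :
    0 < Module.finrank (fixedSubfield τ) E ∧ Module.finrank (fixedSubfield τ) E ≤ 2 := by
  classical
  obtain ⟨d, hd, hd0⟩ : ∃ d : E, τ d = -d ∧ ∀ x, τ x = -x → ∃ s : fixedSubfield τ, x = s * d := by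
    by_cases h : ∃ d : E, τ d = -d ∧ d ≠ 0
    · obtain ⟨d, hd, hd0⟩ := h
      refine ⟨d, hd, fun x hx => ⟨⟨x / d, ?_⟩, (div_mul_cancel₀ x hd0).symm⟩⟩
      change τ (x / d) = x / d
      rw [map_div₀, hx, hd, neg_div_neg_eq]
    · push Not at h
      exact ⟨0, by simp, fun x hx => ⟨0, by simp [h x hx]⟩⟩
  have hspan : Submodule.span (fixedSubfield τ) (({1, d} : Finset E) : Set E) = ⊤ := by
    rw [eq_top_iff]
    intro x _
    have h1 : (x + τ x) / 2 ∈ fixedSubfield τ := by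
      change τ ((x + τ x) / 2) = (x + τ x) / 2
      rw [map_div₀, map_add, hinv, map_ofNat, add_comm]
    obtain ⟨s, hs⟩ := hd0 ((x - τ x) / 2) (by
      rw [map_div₀, map_sub, hinv, map_ofNat, ← neg_div, neg_sub])
    have h3 : x = (⟨_, h1⟩ : fixedSubfield τ) • (1 : E) + s • d := by
      change x = (x + τ x) / 2 * 1 + s * d
      rw [← hs]
      field_simp
      ring
    rw [h3]
    exact Submodule.add_mem _ (Submodule.smul_mem _ _ (Submodule.subset_span (by simp)))
      (Submodule.smul_mem _ _ (Submodule.subset_span (by simp)))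
  have : Module.Finite (fixedSubfield τ) E := ⟨⟨_, hspan⟩⟩
  refine ⟨Module.finrank_pos, ?_⟩
  have h1 := finrank_span_finset_le_card (R := fixedSubfield τ) ({1, d} : Finset E)
  rw [Set.finrank, hspan, finrank_top] at h1
  exact h1.trans Finset.card_le_two

variable {v : AddValuation E (WithTop ℝ)} (h2 : v 2 = 0) (hτ : ∀ a, v (τ a) = v a)
include h2 hτ

theorem le_val_trace (x : E) :
    v x ≤ v ((Algebra.trace (fixedSubfield τ) E x : fixedSubfield τ) : E) := by
  have h1 := congrArg v (two_mul_trace hinv x)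
  rw [v.map_mul, h2, zero_add, v.map_mul] at h1
  rw [h1]
  exact le_add_of_nonneg_of_le (zero_le_val_natCast v _) (v.map_le_add le_rfl (hτ x).ge)

end Trace

section NormalizedForm

variable {Fo F E : Type*} [Field Fo] [Field F] [Algebra Fo F] [Field E] [Algebra F E]
  [FiniteDimensional Fo F] [IsGalois Fo F]
  {v : AddValuation F (WithTop ℝ)} {vE : AddValuation E (WithTop ℝ)} {τ : E →+* E}

/-- The normalization of a linear form `λ`, which is stated on the fixed fields, means that
`{a | λ (a 𝔬_E) ⊆ 𝔭_F} = 𝔭_E`. -/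
theorem forall_pos_form_iff (hv : ∀ a, vE (algebraMap F E a) = v a)
    (hdeg : Module.finrank Fo F ≤ 2) (h2 : v 2 = 0) (hFo : ∀ (ρ : F ≃ₐ[Fo] F) x, v (ρ x) = v x)
    (hinv : ∀ a, τ (τ a) = a) (hτ : ∀ a, vE (τ a) = vE a) {lam : E →ₗ[F] F}
    {lamo : fixedSubfield τ → Fo}
    (hlamo : ∀ a : E, lamo (Algebra.trace (fixedSubfield τ) E a) = Algebra.trace Fo F (lam a))
    (hnorm : ∀ a : fixedSubfield τ, (∀ b : fixedSubfield τ, 0 ≤ vE b →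
      0 < v (algebraMap Fo F (lamo (a * b)))) ↔ 0 < vE a) (a : E) :
    (∀ b, 0 ≤ vE b → 0 < v (lam (a * b))) ↔ 0 < vE a := by
  have h2E : vE 2 = 0 := by
    have := hv 2
    rwa [map_ofNat, h2] at this
  have h20 : (2 : E) ≠ 0 := fun h0 => by
    rw [h0, vE.map_zero] at h2E
    exact WithTop.top_ne_zero h2E
  constructor
  · intro ha
    by_contra hcon
    have ha0 : a ≠ 0 := by
      rintro rfl
      rw [vE.map_zero] at hcon
      exact hcon (WithTop.coe_lt_top (0 : ℝ))
    have ha1 : 0 ≤ vE a⁻¹ := by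
      rw [pos_iff_val ha0, not_lt] at hcon
      have := (le_iff_val (v := vE) (inv_ne_zero ha0) (r := 0)).2 (by rw [val_inv ha0]; linarith)
      exact this
    have hb : ∀ b, 0 ≤ vE b → 0 < v (lam b) := fun b hb => by
      have := ha (a⁻¹ * b) (by rw [vE.map_mul]; exact add_nonneg ha1 hb)
      rwa [mul_inv_cancel_left₀ ha0] at this
    have h1 := (hnorm 1).1 fun b hb0 => by
      -- `b` is the trace of an integral element
      obtain ⟨hn0, hn2⟩ := finrank_fixedSubfield hinv h20
      set n := Module.finrank (fixedSubfield τ) E with hn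
      have hnv : vE (n : E) = 0 := val_natCast_eq_zero h2E hn0 hn2
      have hnE : (n : E) ≠ 0 := fun h0 => by
        rw [h0, vE.map_zero] at hnv
        exact WithTop.top_ne_zero hnv
      have hb1 : Algebra.trace (fixedSubfield τ) E ((n : E)⁻¹ * b) = b := by
        have h3 : ((n : E)⁻¹ * (b : E)) =
            algebraMap (fixedSubfield τ) E ((n : fixedSubfield τ)⁻¹ * b) := by
          rw [map_mul, map_inv₀, map_natCast]
          rfl
        have h4 : (n : fixedSubfield τ) ≠ 0 := fun h0 => hnE (by
          have := congrArg (algebraMap (fixedSubfield τ) E) h0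
          rwa [map_natCast, map_zero] at this)
        rw [h3, Algebra.trace_algebraMap, ← hn, nsmul_eq_mul, mul_inv_cancel_left₀ h4]
      rw [one_mul, ← hb1, hlamo]
      refine lt_of_lt_of_le (hb _ ?_) (le_val_trace_of_isGalois hFo _)
      have h5 : vE (n : E)⁻¹ = 0 := by
        have := vE.map_mul (n : E) (n : E)⁻¹
        rwa [mul_inv_cancel₀ hnE, vE.map_one, hnv, zero_add, eq_comm] at this
      rw [vE.map_mul, h5, zero_add]
      exact hb0
    have h6 : vE ((1 : fixedSubfield τ) : E) = 0 := vE.map_one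
    rw [h6] at h1
    exact lt_irrefl _ h1
  · intro ha b hb
    by_contra hcon
    set c := a * b with hc
    have hcv : 0 < vE c := by
      rw [hc, vE.map_mul]
      exact add_pos_of_pos_of_nonneg ha hb
    have hl0 : lam c ≠ 0 := fun h0 => hcon (by
      rw [h0, v.map_zero]; exact WithTop.coe_lt_top (0 : ℝ))
    -- rescale, so that the form takes the value `1`
    set d := (lam c)⁻¹ • c with hd
    have hd1 : lam d = 1 := by rw [hd, map_smul, smul_eq_mul, inv_mul_cancel₀ hl0]
    have hdv : 0 < vE d := by
      have h1 : 0 ≤ v (lam c)⁻¹ := by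
        rw [pos_iff_val hl0, not_lt] at hcon
        have := (le_iff_val (v := v) (inv_ne_zero hl0) (r := 0)).2 (by
          rw [val_inv hl0]; linarith)
        exact this
      rw [hd, Algebra.smul_def, vE.map_mul, hv]
      rw [add_comm]
      exact add_pos_of_pos_of_nonneg hcv h1
    have h1 := (hnorm (Algebra.trace (fixedSubfield τ) E d)).2
      (lt_of_lt_of_le hdv (le_val_trace hinv h2E hτ d)) 1 vE.map_one.ge
    rw [mul_one, hlamo, hd1] at h1
    have h3 : algebraMap Fo F (Algebra.trace Fo F 1) = (Module.finrank Fo F : F) := by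
      have := Algebra.trace_algebraMap (S := F) (1 : Fo)
      rw [map_one] at this
      rw [this, map_nsmul, map_one, nsmul_one]
    rw [h3, val_natCast_eq_zero h2 Module.finrank_pos hdeg] at h1
    exact lt_irrefl _ h1

end NormalizedForm

/-! ### The summands of `F[β]` and of `V` -/

section BlockAlgebra

variable {F : Type*} [Field F] {V : Type*} [AddCommGroup V] [Module F V]
  {β : Module.End F V} {ι : Type*} [DecidableEq ι] {E : ι → Type*}
  [∀ i, Field (E i)] [∀ i, Algebra F (E i)]
  (e : Algebra.adjoin F {β} ≃ₐ[F] (∀ i, E i))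

theorem emb_injective (i : ι) : Function.Injective (emb e i) := fun _ _ h =>
  Pi.single_injective i (e.symm.injective (Subtype.ext h))

theorem emb_mul_of_ne {i k : ι} (hik : i ≠ k) (x : E i) (y : E k) :
    emb e i x * emb e k y = 0 := by
  have h1 : (Pi.single i x : ∀ i, E i) * Pi.single k y = 0 := by
    ext l
    by_cases hl : l = i
    · subst hl
      rw [Pi.mul_apply, Pi.single_eq_of_ne hik, mul_zero, Pi.zero_apply]
    · rw [Pi.mul_apply, Pi.single_eq_of_ne hl, zero_mul, Pi.zero_apply]
  have h2 := congrArg (fun z => (e.symm z).1) h1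
  simp only [map_mul, map_zero] at h2
  exact h2

theorem emb_smul (i : ι) (a : F) (x : E i) : emb e i (a • x) = a • emb e i x := by
  unfold emb
  rw [Pi.single_smul, map_smul]
  rfl

theorem emb_algebraMap (i : ι) (a : F) : emb e i (algebraMap F (E i) a) = a • emb e i 1 := by
  rw [← emb_smul, Algebra.algebraMap_eq_smul_one]

theorem sum_emb_one [Fintype ι] : ∑ i, emb e i 1 = 1 := by
  have h1 : (1 : ∀ i, E i) = ∑ i, Pi.single i 1 := (Finset.univ_sum_single 1).symm
  have h2 := congrArg (fun z => (e.symm z).1) h1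
  simp only [map_one, map_sum] at h2
  rw [AddSubmonoidClass.coe_finsetSum] at h2
  exact h2.symm

theorem coe_smul_block {i : ι} (a : E i) (x : block e i) :
    ((a • x : block e i) : V) = emb e i a x :=
  rfl

instance blockIsScalarTower (i : ι) : IsScalarTower F (E i) (block e i) where
  smul_assoc a x u := Subtype.ext (by
    rw [coe_smul_block, emb_smul]
    rfl)

/-- The projection to `V_i` as a linear map. -/
def compLin (i : ι) : V →ₗ[F] block e i := (emb e i 1).rangeRestrict

theorem compLin_apply (i : ι) (x : V) : compLin e i x = comp e i x := rfl

theorem comp_coe {i : ι} (x : block e i) : comp e i (x : V) = x :=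
  Subtype.ext (emb_one_apply e x.2)

theorem comp_coe_of_ne {i k : ι} (hik : i ≠ k) (x : block e k) : comp e i (x : V) = 0 := by
  refine Subtype.ext ?_
  change emb e i 1 (x : V) = 0
  rw [← emb_one_apply e x.2, ← Module.End.mul_apply, emb_mul_of_ne e hik]
  rfl

theorem sum_comp [Fintype ι] (x : V) : ∑ i, (comp e i x : V) = x := by
  have := congrArg (fun T : Module.End F V => T x) (sum_emb_one e)
  simpa [comp] using this

/-- An endomorphism which commutes with `β` commutes with `F[β]`. -/
theorem apply_emb_of_commute {g : V →ₗ[F] V} (hg : ∀ x, g (β x) = β (g x)) (i : ι) (a : E i)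
    (x : V) : g (emb e i a x) = emb e i a (g x) := by
  have h1 : (e.symm (Pi.single i a)).1 ∈ Subalgebra.centralizer F {g} := by
    have hle : Algebra.adjoin F {β} ≤ Subalgebra.centralizer F {g} := by
      rw [Algebra.adjoin_le_iff, Set.singleton_subset_iff]
      intro y hy
      rw [Set.mem_singleton_iff.1 hy]
      exact LinearMap.ext hg
    exact hle (e.symm (Pi.single i a)).2
  exact congrArg (fun T : Module.End F V => T x) (h1 g rfl)

variable [FiniteDimensional F V]

include e in
theorem finiteDimensional_summand (i : ι) : FiniteDimensional F (E i) := by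
  let f : E i →ₗ[F] Module.End F V :=
    { toFun := emb e i, map_add' := emb_add e i, map_smul' := emb_smul e i }
  exact FiniteDimensional.of_injective f (emb_injective e i)

theorem finiteDimensional_block (i : ι) : FiniteDimensional (E i) (block e i) :=
  Module.Finite.of_restrictScalars_finite F (E i) (block e i)

end BlockAlgebra

/-! ### Change of the form by a scalar -/

section Rescaling

theorem le_val_mul_iff {K : Type*} [Field K] {v : AddValuation K (WithTop ℝ)} {μ a : K}
    (hμ : μ ≠ 0) {r : ℝ} : (r : WithTop ℝ) ≤ v (μ * a) ↔ ((r - val v μ : ℝ) : WithTop ℝ) ≤ v a := by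
  by_cases ha : a = 0
  · simp [ha]
  · rw [le_iff_val (mul_ne_zero hμ ha), le_iff_val ha, val_mul hμ ha, sub_le_iff_le_add']

/-- A linear form is positive on the steps `s > -r` of a filtration if and only if it is bounded
by `r + s` on all the steps `s`. -/
theorem IsFiltration.forall_pos_iff {K W : Type*} [Field K] [AddCommGroup W] [Module K W]
    {v : AddValuation K (WithTop ℝ)} {P : ℝ → W → Prop} (hP : IsFiltration v P) (φ : W →ₗ[K] K)
    (r : ℝ) : (∀ s > -r, ∀ y, P s y → 0 < v (φ y)) ↔
      ∀ s y, P s y → ((r + s : ℝ) : WithTop ℝ) ≤ v (φ y) := by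
  constructor
  · intro h s y hy
    by_contra hcon
    have h0 : φ y ≠ 0 := by
      intro h0
      rw [h0] at hcon
      exact hcon (le_zero_val _)
    rw [le_iff_val h0, not_le] at hcon
    have h1 := h (s - val v (φ y)) (by linarith) ((φ y)⁻¹ • y) (by
      rw [hP.smul_iff (inv_ne_zero h0), val_inv h0]
      exact hP.anti (by linarith) hy)
    rw [map_smul, smul_eq_mul, inv_mul_cancel₀ h0, v.map_one] at h1
    exact lt_irrefl _ h1
  · exact fun h s hs y hy => pos_of_le_val (by linarith) (h s y hy)

/-- Multiplying a form by `μ` amounts to a shift of filtrations by `-v(μ) / 2`. -/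
theorem forall_pos_shift_iff {K W : Type*} [Field K] [AddCommGroup W] [Module K W]
    {v : AddValuation K (WithTop ℝ)} {P : ℝ → W → Prop} (hP : IsFiltration v P)
    {φ ψ : W →ₗ[K] K} {μ : K} (hμ : μ ≠ 0) (hψ : ∀ y, ψ y = μ * φ y) {c : ℝ}
    (hc : c = -val v μ / 2) (r : ℝ) :
    (∀ s > -r, ∀ y, P (s + c) y → 0 < v (ψ y)) ↔ ∀ s > -(r + c), ∀ y, P s y → 0 < v (φ y) := by
  have hP' : IsFiltration v fun s y => P (s + c) y :=
    { zero := fun r => hP.zero _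
      add := hP.add
      smul := fun h1 h2 => by
        rw [add_right_comm]
        exact hP.smul h1 h2
      anti := fun h => hP.anti (by linarith)
      left := fun h => hP.left fun s hs => by
        have := h (s - c) (by linarith)
        rwa [sub_add_cancel] at this
      exh := fun x => by
        obtain ⟨r, hr⟩ := hP.exh x
        exact ⟨r - c, by rwa [sub_add_cancel]⟩ }
  rw [hP'.forall_pos_iff ψ, hP.forall_pos_iff φ]
  simp only [hψ, le_val_mul_iff hμ]
  constructor
  · intro h s y hy
    have := h (s - c) y (by rwa [sub_add_cancel])
    rwa [show r + (s - c) - val v μ = r + c + s by rw [hc]; ring] at this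
  · intro h s y hy
    have := h (s + c) y hy
    rwa [show r + c + (s + c) = r + s - val v μ by rw [hc]; ring] at this

variable {K : Type*} [Field K] {τ : K →+* K} {W : Type*} [AddCommGroup W] [Module K W]
  {v : AddValuation K (WithTop ℝ)}

theorem IsSelfDual.shift {h h' : W →ₛₗ[τ] W →ₗ[K] K} {μ : K} (hμ : μ ≠ 0)
    (hh : ∀ x y, h' x y = μ * h x y) {c : ℝ} (hc : c = -val v μ / 2) {L : LatticeFunction v W}
    (hL : IsSelfDual h L) : IsSelfDual h' (L.shift c) := fun r x =>
  (hL (r + c) x).trans (forall_pos_shift_iff L.isFiltration hμ (hh x) hc r).symm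

theorem LatticeFunction.shift_bijective (c : ℝ) :
    Function.Bijective (LatticeFunction.shift (v := v) (W := W) c) :=
  Function.bijective_iff_has_inverse.2 ⟨LatticeFunction.shift (-c),
    LatticeFunction.shift_shift c, fun L => by
      have := LatticeFunction.shift_shift (-c) L
      rwa [neg_neg] at this⟩

theorem IsClassicalIdent.shift {h₀ h h' : W →ₛₗ[τ] W →ₗ[K] K} {w : WittFrame h₀} {μ : K}
    (hμ : μ ≠ 0) (hh : ∀ x y, h' x y = μ * h x y) {c : ℝ} (hc : c = -val v μ / 2)
    {j : ClassicalBuilding v w → LatticeFunction v W} (hj : IsClassicalIdent w h j) :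
    IsClassicalIdent w h' fun p => (j p).shift c := by
  refine ⟨⟨fun p _ => ?_, fun p _ q _ hpq => ?_, fun L hL => ?_⟩, fun g p r y => hj.2.1 g p _ y,
    fun g x y t ht => (hj.2.2 g x y t ht).shift c⟩
  · exact IsSelfDual.shift hμ hh hc (hj.1.mapsTo (Set.mem_univ p))
  · exact hj.1.injOn (Set.mem_univ _) (Set.mem_univ _)
      ((LatticeFunction.shift_bijective c).injective hpq)
  · obtain ⟨M, rfl⟩ := (LatticeFunction.shift_bijective c).surjective L
    have hM : IsSelfDual h M := by
      have h1 := IsSelfDual.shift (h := h') (h' := h) (inv_ne_zero hμ)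
        (fun x y => by rw [hh, inv_mul_cancel_left₀ hμ]) (c := -c)
        (by rw [val_inv hμ, hc]; ring) hL
      rwa [LatticeFunction.shift_shift] at h1
    obtain ⟨p, hp, rfl⟩ := hj.1.surjOn hM
    exact ⟨p, hp, rfl⟩

theorem IsLinearIdent.shift {n : ℕ} {b : Module.Basis (Fin n) K W}
    {j : LinearBuilding v b → LatticeFunction v W} (hj : IsLinearIdent b j) (c : ℝ) :
    IsLinearIdent b fun p => (j p).shift c :=
  ⟨(LatticeFunction.shift_bijective c).comp hj.1, fun g p _ y => hj.2.1 g p _ y,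
    fun g x y t ht => (hj.2.2 g x y t ht).shift c⟩

/-- A lattice function over an extension, as a filtration over the base field. -/
theorem LatticeFunction.isFiltration_restrictScalars {E : Type*} [Field E] [Algebra K E]
    [Module E W] [IsScalarTower K E W] {vE : AddValuation E (WithTop ℝ)}
    (hv : ∀ a, vE (algebraMap K E a) = v a) (L : LatticeFunction vE W) :
    IsFiltration v fun r x => x ∈ L.toFun r :=
  have hF := L.isFiltration
  { zero := hF.zero
    add := hF.add
    smul := fun {c t r x} hc hx => by
      rw [← algebraMap_smul E c x]
      exact hF.smul (by rwa [hv]) hx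
    anti := hF.anti
    left := hF.left
    exh := hF.exh }

end Rescaling

section RescalingBlocks

variable {F : Type*} [Field F] {V : Type*} [AddCommGroup V] [Module F V]
  {β : Module.End F V} {ι : Type*} [DecidableEq ι] {E : ι → Type*}
  [∀ i, Field (E i)] [∀ i, Algebra F (E i)]
  {e : Algebra.adjoin F {β} ≃ₐ[F] (∀ i, E i)}
  {v : AddValuation F (WithTop ℝ)} {vE : ∀ i, AddValuation (E i) (WithTop ℝ)}
  (hvE : ∀ i a, vE i (algebraMap F (E i) a) = v a) {τ : F →+* F}
include hvE

theorem IsDualPair.shift {h h' : V →ₛₗ[τ] V →ₗ[F] F} {μ : F} (hμ : μ ≠ 0)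
    (hh : ∀ x y, h' x y = μ * h x y) {c : ℝ} (hc : c = -val v μ / 2) {i k : ι}
    {L : LatticeFunction (vE i) (block e i)} {M : LatticeFunction (vE k) (block e k)}
    (hLM : IsDualPair e v h L M) : IsDualPair e v h' (L.shift c) (M.shift c) := fun r x =>
  (hLM (r + c) x).trans (forall_pos_shift_iff (L.isFiltration_restrictScalars (hvE i)) hμ
    (φ := (h (x : V)).comp (block e i).subtype) (ψ := (h' (x : V)).comp (block e i).subtype)
    (fun y => hh x y) hc r).symm

/-- If the forms are multiplied by scalars with the same valuation, all lattice functions are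
shifted by the same constant, and the maps `j_β` do not change. -/
theorem jSet_subset_of_smul {neg : ι → ι} {Jp : Set ι} {h₀ h h' : V →ₛₗ[τ] V →ₗ[F] F}
    {w : WittFrame h₀} {τE : ∀ i : {i // neg i = i}, E i.1 →+* E i.1}
    {k₀ k k' : ∀ i : {i // neg i = i}, block e i.1 →ₛₗ[τE i] block e i.1 →ₗ[E i.1] E i.1}
    {wE : ∀ i, WittFrame (k₀ i)} {n : Jp → ℕ}
    {bE : ∀ i : Jp, Module.Basis (Fin (n i)) (E i.1) (block e i.1)} {μ : F} (hμ : μ ≠ 0)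
    (hh : ∀ x y, h' x y = μ * h x y) {κ : ∀ i : {i // neg i = i}, E i.1} (hκ : ∀ i, κ i ≠ 0)
    (hk : ∀ i x y, k' i x y = κ i * k i x y) (hκμ : ∀ i, val (vE i.1) (κ i) = val v μ) :
    jSet e (v := v) vE neg Jp w wE bE h k ⊆ jSet e (v := v) vE neg Jp w wE bE h' k' := by
  rintro f ⟨j, jo, jp, hj, hjo, hjp, hf⟩
  refine ⟨fun p => (j p).shift (-val v μ / 2), fun i p => (jo i p).shift (-val v μ / 2),
    fun i p => (jp i p).shift (-val v μ / 2), hj.shift hμ hh rfl,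
    fun i => (hjo i).shift (hκ i) (hk i) (by rw [hκμ]), fun i => (hjp i).shift _, fun x => ?_⟩
  obtain ⟨Λ, h1, h2, h3, h4⟩ := hf x
  exact ⟨fun i => (Λ i).shift (-val v μ / 2), fun i => congrArg _ (h1 i),
    fun i => congrArg _ (h2 i),
    fun i => (h3 i).shift hvE hμ hh rfl, fun r y => h4 _ y⟩

end RescalingBlocks

/-! ### Duality between the blocks -/

section BlockDuality

variable {F : Type*} [Field F] {V : Type*} [AddCommGroup V] [Module F V]
  {β : Module.End F V} {ι : Type*} [DecidableEq ι] {E : ι → Type*}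
  [∀ i, Field (E i)] [∀ i, Algebra F (E i)]
  {e : Algebra.adjoin F {β} ≃ₐ[F] (∀ i, E i)}
  {v : AddValuation F (WithTop ℝ)} {vE : ∀ i, AddValuation (E i) (WithTop ℝ)}
  {τ : F →+* F} {ε : ℤˣ} {h : V →ₛₗ[τ] V →ₗ[F] F} {σ : Module.End F V → Module.End F V}
  {neg : ι → ι}

/-- A hermitian space over a complete discretely valued field, with an algebra `F[β]` whose summands
are permuted by the adjoint involution. -/
structure BlockSetting (e : Algebra.adjoin F {β} ≃ₐ[F] (∀ i, E i)) (v : AddValuation F (WithTop ℝ))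
    (vE : ∀ i, AddValuation (E i) (WithTop ℝ)) (ε : ℤˣ) (h : V →ₛₗ[τ] V →ₗ[F] F)
    (σ : Module.End F V → Module.End F V) (neg : ι → ι) : Prop where
  discrete : DiscreteValues v
  complete : CompleteVal v
  herm : HermitianSetting v ε h
  nondeg : h.SeparatingLeft
  adjoint : ∀ a x y, h (a x) y = h x (σ a y)
  image : ∀ i, σ '' Set.range (emb e i) = Set.range (emb e (neg i))
  extends_val : ∀ i a, vE i (algebraMap F (E i) a) = v a

namespace BlockSetting

variable (S : BlockSetting e v vE ε h σ neg)
include S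

theorem eq_zero_of_form_right {z : V} (hz : ∀ x, h x z = 0) : z = 0 :=
  S.nondeg z fun x => S.herm.herm.eq_zero (hz x)

theorem eq_adjoint {a T : Module.End F V} (hT : ∀ x y, h (a x) y = h x (T y)) : T = σ a := by
  ext y
  rw [← sub_eq_zero]
  exact S.eq_zero_of_form_right fun x => by rw [map_sub, ← hT, S.adjoint, sub_self]

theorem adjoint_mul (a b : Module.End F V) : σ (a * b) = σ b * σ a :=
  (S.eq_adjoint fun x y => by
    rw [Module.End.mul_apply, Module.End.mul_apply, S.adjoint, S.adjoint]).symm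

theorem adjoint_add (a b : Module.End F V) : σ (a + b) = σ a + σ b :=
  (S.eq_adjoint fun x y => by
    rw [LinearMap.add_apply, LinearMap.add_apply, map_add, map_add, LinearMap.add_apply,
      S.adjoint, S.adjoint]).symm

theorem adjoint_smul (c : F) (a : Module.End F V) : σ (c • a) = τ c • σ a :=
  (S.eq_adjoint fun x y => by
    rw [LinearMap.smul_apply, LinearMap.smul_apply, form_smul_left, map_smul, S.adjoint,
      smul_eq_mul]).symm

theorem adjoint_adjoint (a : Module.End F V) : σ (σ a) = a :=
  (S.eq_adjoint fun x y => by
    rw [S.herm.herm, ← S.adjoint, ← S.herm.herm]).symm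

/-- The involution induces isometric isomorphisms between the summands. -/
theorem exists_conj [FiniteDimensional F V] {i k : ι} (hik : neg i = k) :
    ∃ ρ : E i →+* E k, (∀ a, σ (emb e i a) = emb e k (ρ a)) ∧ ∀ a, vE k (ρ a) = vE i a := by
  subst hik
  have hex : ∀ a, ∃ a', emb e (neg i) a' = σ (emb e i a) := fun a => by
    have : σ (emb e i a) ∈ σ '' Set.range (emb e i) := ⟨_, ⟨a, rfl⟩, rfl⟩
    rw [S.image] at this
    exact this
  choose ρ hρ using hex
  have hinj := emb_injective e (neg i)
  have hmul : ∀ a b, ρ (a * b) = ρ a * ρ b := fun a b => hinj (by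
    rw [hρ, mul_comm a b, emb_mul, S.adjoint_mul, emb_mul, hρ, hρ])
  have hadd : ∀ a b, ρ (a + b) = ρ a + ρ b := fun a b => hinj (by
    rw [hρ, emb_add, S.adjoint_add, emb_add, hρ, hρ])
  have hzero : ρ 0 = 0 := by
    have := hadd 0 0
    rwa [add_zero, eq_comm, add_eq_left] at this
  have hone : ρ 1 = 1 := by
    have h1 := hmul 1 1
    rw [mul_one] at h1
    have h2 : ρ 1 ≠ 0 := fun h0 => by
      have h3 : σ (σ (emb e i 1)) = σ (σ (emb e i 0)) := by rw [← hρ, ← hρ, h0, hzero]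
      rw [S.adjoint_adjoint, S.adjoint_adjoint] at h3
      exact one_ne_zero (emb_injective e i h3)
    exact (mul_eq_left₀ h2).1 h1.symm
  let ρ' : E i →+* E (neg i) :=
    { toFun := ρ, map_one' := hone, map_mul' := hmul, map_zero' := hzero, map_add' := hadd }
  have := finiteDimensional_summand e i
  refine ⟨ρ', fun a => (hρ a).symm, fun a => ?_⟩
  refine val_comp_eq S.complete (S.extends_val i) (S.extends_val (neg i)) ρ' τ S.herm.isom
    (fun a => hinj ?_) a
  change emb e (neg i) (ρ _) = _
  rw [hρ, emb_algebraMap, emb_algebraMap, S.adjoint_smul, ← hρ, hone]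

variable [FiniteDimensional F V]

theorem adjoint_emb_one (i : ι) : σ (emb e i 1) = emb e (neg i) 1 := by
  obtain ⟨ρ, hρ, -⟩ := S.exists_conj (i := i) rfl
  rw [hρ, map_one]

theorem neg_neg (i : ι) : neg (neg i) = i := by
  by_contra hne
  have h1 := S.adjoint_adjoint (emb e i 1)
  rw [S.adjoint_emb_one, S.adjoint_emb_one] at h1
  have h2 := emb_mul_of_ne e hne 1 1
  rw [h1, ← emb_mul, mul_one, ← emb_zero e i] at h2
  exact one_ne_zero (emb_injective e i h2)

theorem form_comp_left (i : ι) (x y : V) :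
    h (comp e (neg i) x : V) y = h x (comp e i y : V) := by
  change h (emb e (neg i) 1 x) y = h x (emb e i 1 y)
  rw [S.adjoint, S.adjoint_emb_one, S.neg_neg]

theorem form_comp_coe (i : ι) (x : V) (y : block e i) :
    h (comp e (neg i) x : V) (y : V) = h x (y : V) := by
  rw [S.form_comp_left, comp_coe]

theorem discrete_summand (i : ι) : DiscreteValues (vE i) :=
  have := finiteDimensional_summand e i
  S.discrete.of_extends (S.extends_val i)

theorem complete_summand (i : ι) : CompleteVal (vE i) :=
  have := finiteDimensional_summand e i
  S.complete.of_extends (S.extends_val i)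

theorem boundedForms_block {i : ι} (L : LatticeFunction (vE i) (block e i)) :
    BoundedForms v fun r x => x ∈ L.toFun r :=
  (L.isFiltration_restrictScalars (S.extends_val i)).boundedForms S.complete _ rfl
    (separated_of_boundedForms (L.boundedForms (S.discrete_summand i)))

/-- A lattice function over `E i`, as a lattice function over `F`. -/
theorem exists_restrictScalars {i : ι} (L : LatticeFunction (vE i) (block e i)) :
    ∃ M : LatticeFunction v (block e i), ∀ r x, x ∈ M.toFun r ↔ x ∈ L.toFun r :=
  (L.isFiltration_restrictScalars (S.extends_val i)).exists_latticeFunction S.discrete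
    (S.boundedForms_block L)

/-- The dual of a lattice function in `V_i` is a lattice function in `V_{-i}`. -/
theorem exists_dual {i k : ι} (hik : neg i = k) (L : LatticeFunction (vE i) (block e i)) :
    ∃ M : LatticeFunction (vE k) (block e k), IsDualPair e v h L M := by
  subst hik
  obtain ⟨ρ, hρ, hρv⟩ := S.exists_conj (S.neg_neg i)
  let P : ℝ → block e (neg i) → Prop := fun r x => ∀ s > -r, ∀ y ∈ L.toFun s,
    0 < v (h (x : V) (y : V))
  have hLF := L.isFiltration
  have hP : IsFiltration (vE (neg i)) P :=
    { zero := fun r s _ y _ => by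
        rw [Submodule.coe_zero, map_zero, LinearMap.zero_apply, v.map_zero]
        exact WithTop.coe_lt_top (0 : ℝ)
      add := fun {r x x'} hx hx' s hs y hy => by
        rw [Submodule.coe_add, map_add, LinearMap.add_apply]
        exact v.map_lt_add (hx s hs y hy) (hx' s hs y hy)
      smul := fun {c t r x} hc hx s hs y hy => by
        have h1 := hx (s + t) (by linarith) (ρ c • y) (hLF.smul (by rwa [hρv]) hy)
        rwa [coe_smul_block, ← hρ, ← S.adjoint] at h1
      anti := fun hrs hx s hs => hx s (by linarith)
      left := fun {r x} hx s hs y hy => by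
        obtain ⟨q, h1, h2⟩ := exists_between (show -s < r by linarith)
        exact hx q h2 s (by linarith) y hy
      exh := fun x => by
        obtain ⟨M, hM⟩ := S.boundedForms_block L ((h (x : V)).comp (block e i).subtype)
        exact ⟨-M, fun s hs y hy => pos_of_le_val (by linarith) (hM s y hy)⟩ }
  have hsep : Separated P := fun x hx => by
    obtain ⟨y, hy⟩ : ∃ y : block e i, h (x : V) (y : V) ≠ 0 := by
      by_contra! hcon
      refine hx (Subtype.ext (S.nondeg _ fun y => ?_))
      rw [← hcon (comp e i y), ← S.form_comp_left, comp_coe]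
    obtain ⟨s, hs⟩ := hLF.exh y
    refine ⟨-(s - val v (h (x : V) (y : V))) + 1, fun hPx => ?_⟩
    have h1 := hPx (s - val v (h (x : V) (y : V))) (by linarith)
      ((h (x : V) (y : V))⁻¹ • y) (by
        rw [(L.isFiltration_restrictScalars (S.extends_val i)).smul_iff (inv_ne_zero hy),
          val_inv hy]
        exact hLF.anti (by linarith) hs)
    rw [Submodule.coe_smul, map_smul, smul_eq_mul, inv_mul_cancel₀ hy, v.map_one] at h1
    exact lt_irrefl _ h1
  have := finiteDimensional_block e (neg i)
  exact hP.exists_latticeFunction (S.discrete_summand _)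
    (hP.boundedForms (S.complete_summand _) _ rfl hsep)

/-- Duality of lattice functions is symmetric. -/
theorem dual_symm {i k : ι} (hik : neg i = k) {L : LatticeFunction (vE i) (block e i)}
    {M : LatticeFunction (vE k) (block e k)} (hLM : IsDualPair e v h L M) :
    IsDualPair e v h M L := by
  subst hik
  intro r y
  refine ⟨fun hy s hs x hx => ?_, fun hy => ?_⟩
  · rw [S.herm.val_swap]
    exact (hLM s x).1 hx r (by linarith) y hy
  · by_contra hcon
    obtain ⟨L', hL'⟩ := S.exists_restrictScalars L
    rw [← hL'] at hcon
    obtain ⟨s, φ, hs, hφy, hφ⟩ := L'.exists_form S.discrete hcon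
    obtain ⟨x, hx⟩ := exists_form_eq S.herm.invol S.nondeg (φ.comp (compLin e i))
    have hx' : ∀ z : block e i, h (comp e (neg i) x : V) (z : V) = φ z := fun z => by
      rw [S.form_comp_coe, hx, LinearMap.comp_apply, compLin_apply, comp_coe]
    have h1 : comp e (neg i) x ∈ M.toFun (-s) := (hLM _ _).2 fun q hq z hz => by
      rw [hx']
      exact pos_of_le_val (by linarith) (hφ q z ((hL' _ _).2 hz))
    have h2 := hy (-s) (by linarith) _ h1
    rw [S.herm.val_swap, hx', hφy, v.map_one] at h2
    exact lt_irrefl _ h2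

variable [Fintype ι]

theorem exists_isDirectSum (Λ : ∀ i, LatticeFunction (vE i) (block e i)) :
    ∃ L : LatticeFunction v V, IsDirectSum e Λ L := by
  classical
  have hF : ∀ i, IsFiltration v fun r x => x ∈ (Λ i).toFun r := fun i =>
    (Λ i).isFiltration_restrictScalars (S.extends_val i)
  have hP : IsFiltration v fun r x => ∀ i, compLin e i x ∈ (Λ i).toFun r :=
    { zero := fun r i => by rw [map_zero]; exact (hF i).zero r
      add := fun hx hy i => by rw [map_add]; exact (hF i).add (hx i) (hy i)
      smul := fun hc hx i => by rw [map_smul]; exact (hF i).smul hc (hx i)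
      anti := fun hrs hx i => (hF i).anti hrs (hx i)
      left := fun hx i => (hF i).left fun s hs => hx s hs i
      exh := fun x => by
        choose r hr using fun i => (hF i).exh (compLin e i x)
        obtain ⟨M, hM⟩ := (Finset.univ.image fun i => -r i).exists_le
        refine ⟨-M, fun i => (hF i).anti ?_ (hr i)⟩
        have := hM _ (Finset.mem_image_of_mem _ (Finset.mem_univ i))
        linarith }
  have hsep : Separated fun r x => ∀ i, compLin e i x ∈ (Λ i).toFun r := fun x hx => by
    obtain ⟨i, hi⟩ : ∃ i, compLin e i x ≠ 0 := by
      by_contra! hcon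
      refine hx ?_
      rw [← sum_comp e x]
      exact Finset.sum_eq_zero fun i _ => congrArg Subtype.val (hcon i)
    obtain ⟨r, hr⟩ := separated_of_boundedForms (S.boundedForms_block (Λ i)) _ hi
    exact ⟨r, fun hcon => hr (hcon i)⟩
  exact hP.exists_latticeFunction S.discrete (hP.boundedForms S.complete _ rfl hsep)

omit [Fintype ι] S [FiniteDimensional F V] in
theorem coe_mem_iff_of_isDirectSum {Λ : ∀ i, LatticeFunction (vE i) (block e i)}
    {L : LatticeFunction v V} (hL : IsDirectSum e Λ L) {i : ι} {r : ℝ} (y : block e i) :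
    (y : V) ∈ L.toFun r ↔ y ∈ (Λ i).toFun r := by
  rw [hL]
  refine ⟨fun hy => by simpa only [comp_coe] using hy i, fun hy k => ?_⟩
  by_cases hk : k = i
  · subst hk
    rwa [comp_coe]
  · rw [comp_coe_of_ne e hk]
    exact Submodule.zero_mem _

/-- The direct sum of lattice functions in the blocks which are dual in pairs is self-dual. -/
theorem isSelfDual_of_isDirectSum {Λ : ∀ i, LatticeFunction (vE i) (block e i)}
    {L : LatticeFunction v V} (hL : IsDirectSum e Λ L)
    (hΛ : ∀ i, IsDualPair e v h (Λ i) (Λ (neg i))) : IsSelfDual h L := by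
  intro r x
  have h1 : x ∈ L.toFun r ↔ ∀ i, comp e (neg i) x ∈ (Λ (neg i)).toFun r := by
    rw [hL]
    refine ⟨fun hx i => hx _, fun hx i => ?_⟩
    have := hx (neg i)
    rwa [S.neg_neg] at this
  rw [h1]
  constructor
  · intro hx s hs y hy
    rw [← sum_comp e y, map_sum]
    refine v.map_lt_sum (WithTop.coe_ne_top (a := (0 : ℝ))) fun i _ => ?_
    rw [← S.form_comp_coe]
    exact (hΛ i _ _).1 (hx i) s hs _ ((hL s y).1 hy i)
  · intro hx i
    rw [hΛ i]
    intro s hs y hy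
    rw [S.form_comp_coe]
    exact hx s hs _ ((coe_mem_iff_of_isDirectSum hL y).2 hy)

end BlockSetting

/-- Self-duality over `E i` for `h_i` is the duality with respect to `h`. -/
theorem isSelfDual_iff_isDualPair {i : ι} {τE : E i →+* E i}
    {hi : block e i →ₛₗ[τE] block e i →ₗ[E i] E i} {lam : E i →ₗ[F] F}
    (hlam : ∀ a, (∀ b, 0 ≤ vE i b → 0 < v (lam (a * b))) ↔ 0 < vE i a)
    (hh : ∀ x y : block e i, h (x : V) (y : V) = lam (hi x y))
    {L : LatticeFunction (vE i) (block e i)} : IsSelfDual hi L ↔ IsDualPair e v h L L := by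
  have key : ∀ s (x : block e i), (∀ y ∈ L.toFun s, 0 < vE i (hi x y)) ↔
      ∀ y ∈ L.toFun s, 0 < v (h (x : V) (y : V)) := fun s x => by
    constructor
    · intro hx y hy
      have := (hlam _).2 (hx y hy) 1 (vE i).map_one.ge
      rwa [mul_one, ← hh] at this
    · intro hx y hy
      refine (hlam _).1 fun b hb => ?_
      have h1 := hx (b • y) (by
        have := L.isFiltration.smul (t := 0) hb hy
        rwa [add_zero] at this)
      rwa [hh, map_smul, smul_eq_mul, mul_comm] at h1
  exact forall₂_congr fun r x => iff_congr Iff.rfl (forall₂_congr fun s _ => key s x)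

end BlockDuality

/-! ### The forms on the summands -/

section SummandForms

variable {F : Type*} [Field F] {V : Type*} [AddCommGroup V] [Module F V]
  {β : Module.End F V} {ι : Type*} [DecidableEq ι] {E : ι → Type*}
  [∀ i, Field (E i)] [∀ i, Algebra F (E i)]
  {e : Algebra.adjoin F {β} ≃ₐ[F] (∀ i, E i)}
  {v : AddValuation F (WithTop ℝ)} {vE : ∀ i, AddValuation (E i) (WithTop ℝ)}
  {τ : F →+* F} {ε : ℤˣ} {h h' : V →ₛₗ[τ] V →ₗ[F] F} {σ : Module.End F V → Module.End F V}
  {neg : ι → ι}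

theorem eq_zero_of_forall_form {K L : Type*} [Field K] [Field L] [Algebra K L] {lam : L →ₗ[K] K}
    (h0 : lam ≠ 0) {c : L} (hc : ∀ b, lam (c * b) = 0) : c = 0 := by
  by_contra hne
  refine h0 (LinearMap.ext fun b => ?_)
  have := hc (c⁻¹ * b)
  rwa [mul_inv_cancel_left₀ hne] at this

/-- A linear form `λ` on an extension of `K` with `{a | λ (a 𝔬) ⊆ 𝔭} = 𝔭`. -/
structure IsNormalizedForm {K L : Type*} [Field K] [Field L] [Algebra K L]
    (v : AddValuation K (WithTop ℝ)) (vL : AddValuation L (WithTop ℝ)) (lam : L →ₗ[K] K) :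
    Prop where
  ne_zero : lam ≠ 0
  pos_iff : ∀ a, (∀ b, 0 ≤ vL b → 0 < v (lam (a * b))) ↔ 0 < vL a

/-- Two normalized forms differ by a unit. -/
theorem IsNormalizedForm.exists_unit {K L : Type*} [Field K] [Field L] [Algebra K L]
    [FiniteDimensional K L] {v : AddValuation K (WithTop ℝ)} {vL : AddValuation L (WithTop ℝ)}
    {lam lam' : L →ₗ[K] K} (hlam : IsNormalizedForm v vL lam) (hlam' : IsNormalizedForm v vL lam') :
    ∃ κ : L, κ ≠ 0 ∧ val vL κ = 0 ∧ ∀ a, lam' a = lam (κ * a) := by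
  let T : L →ₗ[K] (L →ₗ[K] K) := (LinearMap.mul K L).compr₂ lam
  have hT : ∀ κ a, T κ a = lam (κ * a) := fun κ a => rfl
  have hinj : Function.Injective T := (injective_iff_map_eq_zero T).2 fun c hc =>
    eq_zero_of_forall_form hlam.ne_zero fun b => by rw [← hT, hc, LinearMap.zero_apply]
  obtain ⟨κ, hκ⟩ := (LinearMap.injective_iff_surjective_of_finrank_eq_finrank
    (by rw [Subspace.dual_finrank_eq])).1 hinj lam'
  have hκ' : ∀ a, lam' a = lam (κ * a) := fun a => by rw [← hκ, hT]
  have hpos : ∀ a, 0 < vL (κ * a) ↔ 0 < vL a := fun a => by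
    rw [← hlam.pos_iff, ← hlam'.pos_iff]
    simp only [hκ', mul_assoc]
  have h0 : κ ≠ 0 := fun h0 => hlam'.ne_zero (LinearMap.ext fun a => by
    rw [hκ', h0, zero_mul, map_zero, LinearMap.zero_apply])
  refine ⟨κ, h0, le_antisymm ?_ ?_, hκ'⟩
  · have := (hpos 1).1
    rw [mul_one, pos_iff_val h0, pos_iff_val one_ne_zero, val_one] at this
    exact not_lt.1 fun hlt => lt_irrefl _ (this hlt)
  · have := (hpos κ⁻¹).2
    rw [mul_inv_cancel₀ h0, pos_iff_val (inv_ne_zero h0), pos_iff_val one_ne_zero, val_one,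
      val_inv h0] at this
    exact not_lt.1 fun hlt => lt_irrefl _ (this (by linarith))

variable (e v vE ε h) in
/-- The conditions on the form `h_i` on a block with `-i = i`, with the normalization of the linear
form expressed on `E i`. -/
structure IsSummandForm {i : ι} {τE : E i →+* E i}
    (hi : block e i →ₛₗ[τE] block e i →ₗ[E i] E i) : Prop where
  herm : HermitianSetting (vE i) ε hi
  exists_form : ∃ lam : E i →ₗ[F] F, IsNormalizedForm v (vE i) lam ∧
    ∀ x y : block e i, h (x : V) (y : V) = lam (hi x y)

section Single

variable {i : ι} {τE : E i →+* E i} {hi hi' : block e i →ₛₗ[τE] block e i →ₗ[E i] E i}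

theorem IsSummandForm.isSelfDual_iff (hS : IsSummandForm e v vE ε h hi)
    {L : LatticeFunction (vE i) (block e i)} : IsSelfDual hi L ↔ IsDualPair e v h L L := by
  obtain ⟨lam, hlam, hh⟩ := hS.exists_form
  exact isSelfDual_iff_isDualPair hlam.pos_iff hh

/-- An automorphism of the block which preserves `h` preserves `h_i`. -/
theorem IsSummandForm.map_form (hS : IsSummandForm e v vE ε h hi)
    {G : block e i →ₗ[E i] block e i}
    (hG : ∀ x y : block e i, h (G x : V) (G y : V) = h (x : V) (y : V)) (x y : block e i) :
    hi (G x) (G y) = hi x y := by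
  obtain ⟨lam, hlam, hh⟩ := hS.exists_form
  rw [← sub_eq_zero]
  refine eq_zero_of_forall_form hlam.ne_zero fun b => ?_
  have h1 := hG x (b • y)
  rw [map_smul G, hh, hh, map_smul (hi (G x)), map_smul (hi x), smul_eq_mul, smul_eq_mul] at h1
  rw [sub_mul, map_sub, mul_comm, h1, mul_comm, sub_self]

variable [FiniteDimensional F V]

theorem IsSummandForm.separatingLeft (hS : IsSummandForm e v vE ε h hi)
    (S : BlockSetting e v vE ε h σ neg) (hneg : neg i = i) : hi.SeparatingLeft := fun x hx => by
  obtain ⟨lam, -, hh⟩ := hS.exists_form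
  refine Subtype.ext (S.nondeg _ fun y => ?_)
  have h1 : (comp e (neg i) (x : V) : V) = x := by rw [hneg, comp_coe]
  rw [← h1, S.form_comp_left, hh, hx, map_zero]

/-- If `h` is multiplied by `μ`, then `h_i` is multiplied by a scalar with the same valuation. -/
theorem IsSummandForm.exists_smul (hS : IsSummandForm e v vE ε h hi)
    (hS' : IsSummandForm e v vE ε h' hi')
    (hvE : ∀ i a, vE i (algebraMap F (E i) a) = v a) {μ : F} (hμ : μ ≠ 0)
    (hh : ∀ x y, h' x y = μ * h x y) :
    ∃ κ : E i, κ ≠ 0 ∧ val (vE i) κ = val v μ ∧ ∀ x y, hi' x y = κ * hi x y := by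
  obtain ⟨lam, hlam, hl⟩ := hS.exists_form
  obtain ⟨lam', hlam', hl'⟩ := hS'.exists_form
  have := finiteDimensional_summand e i
  obtain ⟨κ, hκ0, hκv, hκ⟩ := hlam.exists_unit hlam'
  have hμ' : algebraMap F (E i) μ ≠ 0 := (map_ne_zero _).2 hμ
  refine ⟨κ⁻¹ * algebraMap F (E i) μ, mul_ne_zero (inv_ne_zero hκ0) hμ', ?_, fun x y => ?_⟩
  · rw [val_mul (inv_ne_zero hκ0) hμ', val_inv hκ0, hκv, neg_zero, zero_add]
    exact val_eq_of (by rw [hvE, coe_val hμ])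
  · have h1 : κ * hi' x y - algebraMap F (E i) μ * hi x y = 0 := by
      refine eq_zero_of_forall_form hlam.ne_zero fun b => ?_
      have h2 := hh x (b • y : block e i)
      rw [hl, hl', hκ, map_smul, map_smul, smul_eq_mul, smul_eq_mul, ← smul_eq_mul μ, ← map_smul,
        Algebra.smul_def] at h2
      rw [sub_mul, map_sub, sub_eq_zero, mul_assoc, mul_assoc, mul_comm _ b, h2, mul_comm b]
    rw [mul_assoc, ← sub_eq_zero.1 h1, inv_mul_cancel_left₀ hκ0]

end Single

/-- Two forms with the same adjoint involution are proportional, as the center of `End_F(V)`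
consists of the scalars. -/
theorem exists_smul_of_adjoint_eq [FiniteDimensional F V] (hinv : ∀ a, τ (τ a) = a)
    (hnd : h.SeparatingLeft) (hnd' : h'.SeparatingLeft) (hσ : ∀ a x y, h (a x) y = h x (σ a y))
    (hσ' : ∀ a x y, h' (a x) y = h' x (σ a y)) :
    ∃ μ : F, μ ≠ 0 ∧ ∀ x y, h' x y = μ * h x y := by
  have hinj : ∀ {x y}, h x = h y → x = y := fun {x y} hxy => by
    rw [← sub_eq_zero]
    exact hnd _ fun z => by rw [map_sub, hxy, sub_self, LinearMap.zero_apply]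
  choose A hA using fun x => exists_form_eq hinv hnd (h' x)
  let A' : Module.End F V :=
    { toFun := A
      map_add' := fun x y => hinj (by rw [map_add, hA, hA, hA, map_add])
      map_smul' := fun c x => hinj (by
        rw [RingHom.id_apply, LinearMap.map_smulₛₗ, hA, hA, LinearMap.map_smulₛₗ]) }
  have hcen : A' ∈ Subsemiring.center (Module.End F V) := by
    rw [Subsemiring.mem_center_iff]
    intro a
    ext x
    refine hinj (LinearMap.ext fun y => ?_)
    change h (a (A x)) y = h (A (a x)) y
    rw [hσ, hA, hA, hσ']
  obtain ⟨α, hα', hα⟩ := Module.End.mem_subsemiringCenter_iff.1 hcen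
  have hAα : ∀ x, A x = α • x := fun x => congrArg (fun T : Module.End F V => T x) hα
  have hh : ∀ x y, h' x y = τ α * h x y := fun x y => by
    rw [← hA, hAα, form_smul_left]
  by_cases h0 : τ α = 0
  · refine ⟨1, one_ne_zero, fun x y => ?_⟩
    have : x = 0 := hnd' x fun y => by rw [hh, h0, zero_mul]
    rw [this, map_zero, map_zero, LinearMap.zero_apply, mul_zero]
  · exact ⟨_, h0, hh⟩

end SummandForms

/-! ### The maps between the buildings -/

section Maps

variable {F : Type*} [Field F] {V : Type*} [AddCommGroup V] [Module F V] [FiniteDimensional F V]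
  {β : Module.End F V} {ι : Type*} [Fintype ι] [DecidableEq ι] {E : ι → Type*}
  [∀ i, Field (E i)] [∀ i, Algebra F (E i)]
  {e : Algebra.adjoin F {β} ≃ₐ[F] (∀ i, E i)}
  {v : AddValuation F (WithTop ℝ)} {vE : ∀ i, AddValuation (E i) (WithTop ℝ)}
  {τ : F →+* F} {ε : ℤˣ} {h h' : V →ₛₗ[τ] V →ₗ[F] F} {σ : Module.End F V → Module.End F V}
  {neg : ι → ι} {Jp : Set ι}
  {τE : ∀ i : {i // neg i = i}, E i.1 →+* E i.1}
  {hE hE' : ∀ i : {i // neg i = i}, block e i.1 →ₛₗ[τE i] block e i.1 →ₗ[E i.1] E i.1}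
  {w : WittFrame h} {wE : ∀ i, WittFrame (hE i)} {n : Jp → ℕ}
  {bE : ∀ i : Jp, Module.Basis (Fin (n i)) (E i.1) (block e i.1)}
  (S : BlockSetting e v vE ε h σ neg)
  (hS : ∀ i : {i // neg i = i}, IsSummandForm e v vE ε h (hE i))
  (hJp' : ∀ i, neg i ≠ i → (i ∈ Jp ↔ neg i ∉ Jp))
include S

section Pairs

include hJp'

omit [Fintype ι] in
/-- A property of indices which holds for `-i = i`, for `J₊` and for `-J₊` holds everywhere. -/
theorem BlockSetting.index_cases {p : ι → Prop} (h0 : ∀ i : {i // neg i = i}, p i.1)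
    (h1 : ∀ i : Jp, p i.1) (h2 : ∀ i : Jp, ∀ k, neg i.1 = k → p k) (i : ι) : p i := by
  by_cases hi : neg i = i
  · exact h0 ⟨i, hi⟩
  by_cases hip : i ∈ Jp
  · exact h1 ⟨i, hip⟩
  · have : neg i ∈ Jp := by
      by_contra hcon
      exact hip ((hJp' i hi).2 hcon)
    exact h2 ⟨_, this⟩ i (S.neg_neg i)

include hS

omit [Fintype ι] in
theorem BlockSetting.isDualPair {Λ : ∀ i, LatticeFunction (vE i) (block e i)}
    (ho : ∀ i : {i // neg i = i}, IsSelfDual (hE i) (Λ i.1))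
    (hp : ∀ i : Jp, IsDualPair e v h (Λ i.1) (Λ (neg i.1))) (i : ι) :
    IsDualPair e v h (Λ i) (Λ (neg i)) := by
  refine S.index_cases hJp' (p := fun i => IsDualPair e v h (Λ i) (Λ (neg i))) (fun i => ?_) hp
    (fun i k hk => ?_) i
  · have h1 := (hS i).isSelfDual_iff.1 (ho i)
    rw [i.2]
    exact h1
  · subst hk
    have h1 := S.dual_symm rfl (hp i)
    rw [S.neg_neg]
    exact h1

end Pairs

omit S [FiniteDimensional F V] [Fintype ι] in
/-- The maps `j_β` are injective: the summands `Λ_i` are determined by their direct sum. -/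
theorem injective_of_mem_jSet {f : ProductBuilding e vE neg Jp wE bE → ClassicalBuilding v w}
    (hf : f ∈ jSet e (v := v) vE neg Jp w wE bE h hE) : Function.Injective f := by
  obtain ⟨j, jo, jp, hj, hjo, hjp, hf⟩ := hf
  intro x x' hxx
  obtain ⟨Λ, h1, h2, -, h4⟩ := hf x
  obtain ⟨Λ', h1', h2', -, h4'⟩ := hf x'
  rw [hxx] at h4
  have hΛ : ∀ i, Λ i = Λ' i := fun i => LatticeFunction.ext_mem fun r y => by
    rw [← BlockSetting.coe_mem_iff_of_isDirectSum h4,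
      ← BlockSetting.coe_mem_iff_of_isDirectSum h4']
  refine Prod.ext (funext fun i => ?_) (funext fun i => ?_)
  · exact (hjo i).1.injOn (Set.mem_univ _) (Set.mem_univ _) (by rw [← h1, ← h1', hΛ])
  · exact (hjp i).1.injective (by rw [← h2, ← h2', hΛ])

omit S [FiniteDimensional F V] [Fintype ι] in
/-- An isometry which commutes with `β` restricts to the blocks. -/
theorem exists_block_equiv {g : isometryGroup h} (hg : ∀ x, g.1 (β x) = β (g.1 x)) (i : ι) :
    ∃ G : block e i ≃ₗ[E i] block e i, ∀ x, (G x : V) = g.1 (x : V) := by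
  have hg' : ∀ x, g.1.symm (β x) = β (g.1.symm x) := fun x => by
    rw [LinearEquiv.symm_apply_eq, hg, g.1.apply_symm_apply]
  have hmem : ∀ {T : V →ₗ[F] V}, (∀ x, T (β x) = β (T x)) → ∀ x : block e i,
      T (x : V) ∈ block e i := fun {T} hT x =>
    ⟨T x, by rw [← apply_emb_of_commute e hT, emb_one_apply e x.2]⟩
  exact ⟨{ toFun := fun x => ⟨g.1 (x : V), hmem (T := g.1.toLinearMap) hg x⟩
           invFun := fun x => ⟨g.1.symm (x : V), hmem (T := g.1.symm.toLinearMap) hg' x⟩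
           map_add' := fun x y => Subtype.ext (map_add g.1 (x : V) (y : V))
           map_smul' := fun a x => Subtype.ext
             (apply_emb_of_commute e (g := g.1.toLinearMap) hg i a (x : V))
           left_inv := fun x => Subtype.ext (g.1.symm_apply_apply _)
           right_inv := fun x => Subtype.ext (g.1.apply_symm_apply _) }, fun x => rfl⟩

include hS hJp'

omit [Fintype ι] in
/-- The maps `j_β` are equivariant for the centralizer of `β`. -/
theorem equivariant_of_mem_jSet {f : ProductBuilding e vE neg Jp wE bE → ClassicalBuilding v w}
    (hf : f ∈ jSet e (v := v) vE neg Jp w wE bE h hE) : IsCentralizerEquivariant e f := by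
  intro g hg
  obtain ⟨j, jo, jp, hj, hjo, hjp, hf⟩ := hf
  choose G hG using exists_block_equiv (e := e) hg
  have hGh : ∀ {i k} (x : block e i) (y : block e k), h (G i x : V) (G k y : V) =
      h (x : V) (y : V) := fun x y => by rw [hG, hG, g.2]
  let go : ∀ i : {i // neg i = i}, isometryGroup (hE i) := fun i =>
    ⟨G i.1, fun x y => (hS i).map_form (G := (G i.1).toLinearMap) hGh x y⟩
  refine ⟨go, fun i => G i.1, fun i x => hG _ x, fun i x => hG _ x, fun x => ?_⟩
  obtain ⟨Λ, h1, h2, h3, h4⟩ := hf x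
  obtain ⟨Λ', h1', h2', h3', h4'⟩ := hf (fun i => go i • x.1 i, fun i => G i.1 • x.2 i)
  have h0 : ∀ i : Jp, ∀ r z, G i.1 z ∈ (Λ' i.1).toFun r ↔ z ∈ (Λ i.1).toFun r := fun i r z => by
    rw [h2, h2']
    exact (hjp i).2.1 (G i.1) (x.2 i) r z
  have key := S.index_cases hJp'
    (p := fun i => ∀ r z, G i z ∈ (Λ' i).toFun r ↔ z ∈ (Λ i).toFun r) (fun i r z => by
      rw [h1, h1']
      exact (hjo i).2.1 (go i) (x.1 i) r z) h0 (fun i k hk r z => by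
      subst hk
      rw [h3 i, h3' i]
      refine forall₂_congr fun s _ => ⟨fun hz y hy => ?_, fun hz y hy => ?_⟩
      · rw [← hGh]
        exact hz _ ((h0 i s y).2 hy)
      · obtain ⟨y, rfl⟩ := (G i.1).surjective y
        rw [hGh]
        exact hz _ ((h0 i s y).1 hy))
  refine hj.1.injOn (Set.mem_univ _) (Set.mem_univ _) (LatticeFunction.ext_mem fun r z => ?_)
  obtain ⟨y, rfl⟩ := g.1.surjective z
  rw [hj.2.1, h4', h4]
  refine forall_congr' fun i => ?_
  rw [← key i]
  have : comp e i (g.1 y) = G i (comp e i y) := Subtype.ext (by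
    rw [hG]
    exact (apply_emb_of_commute e (g := g.1.toLinearMap) hg i 1 y).symm)
  rw [this]

/-- Given identifications of all the buildings, there is a map `j_β`. -/
theorem exists_map_of_idents {j : ClassicalBuilding v w → LatticeFunction v V}
    {jo : ∀ i : {i // neg i = i}, ClassicalBuilding (vE i.1) (wE i) →
      LatticeFunction (vE i.1) (block e i.1)}
    {jp : ∀ i : Jp, LinearBuilding (vE i.1) (bE i) → LatticeFunction (vE i.1) (block e i.1)}
    (hJp : ∀ i ∈ Jp, neg i ≠ i)
    (hj : IsClassicalIdent w h j) (hjo : ∀ i, IsClassicalIdent (wE i) (hE i) (jo i))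
    (hjp : ∀ i, IsLinearIdent (bE i) (jp i)) :
    (jSet e (v := v) vE neg Jp w wE bE h hE).Nonempty := by
  have hex : ∀ x : ProductBuilding e vE neg Jp wE bE, ∃ p : ClassicalBuilding v w,
      ∃ Λ : ∀ i, LatticeFunction (vE i) (block e i),
        (∀ i : {i // neg i = i}, Λ i.1 = jo i (x.1 i)) ∧ (∀ i : Jp, Λ i.1 = jp i (x.2 i)) ∧
        (∀ i : Jp, IsDualPair e v h (Λ i.1) (Λ (neg i.1))) ∧ IsDirectSum e Λ (j p) := by
    intro x
    have hM : ∀ k, ∃ M : LatticeFunction (vE k) (block e k),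
        (∀ hk : neg k = k, M = jo ⟨k, hk⟩ (x.1 ⟨k, hk⟩)) ∧
        (∀ hk : k ∈ Jp, M = jp ⟨k, hk⟩ (x.2 ⟨k, hk⟩)) ∧
        ∀ i : Jp, neg i.1 = k → IsDualPair e v h (jp i (x.2 i)) M := by
      refine S.index_cases hJp' (fun i => ?_) (fun i => ?_) fun i k hk => ?_
      · refine ⟨jo i (x.1 i), fun _ => rfl, fun hi => absurd i.2 (hJp _ hi), fun i' hi' => ?_⟩
        have h1 := S.neg_neg i'.1
        rw [hi', i.2] at h1
        exact absurd hi' (by rw [h1]; exact hJp _ i'.2)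
      · refine ⟨jp i (x.2 i), fun hi => absurd hi (hJp _ i.2), fun _ => rfl, fun i' hi' => ?_⟩
        have h1 := (hJp' i'.1 (hJp _ i'.2)).1 i'.2
        rw [hi'] at h1
        exact absurd i.2 h1
      · obtain ⟨M, hM⟩ := S.exists_dual hk (jp i (x.2 i))
        refine ⟨M, fun hk' => ?_, fun hk' => ?_, fun i' hi' => ?_⟩
        · have h1 := S.neg_neg i.1
          rw [hk, hk'] at h1
          exact absurd hk (by rw [h1]; exact hJp _ i.2)
        · have h1 := (hJp' i.1 (hJp _ i.2)).1 i.2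
          rw [hk] at h1
          exact absurd hk' h1
        · have h1 : i' = i := Subtype.ext (by rw [← S.neg_neg i'.1, hi', ← hk, S.neg_neg])
          rwa [h1]
    choose Λ h1 h2 h3 using hM
    have h1' : ∀ i : {i // neg i = i}, Λ i.1 = jo i (x.1 i) := fun i => h1 i.1 i.2
    have h2' : ∀ i : Jp, Λ i.1 = jp i (x.2 i) := fun i => h2 i.1 i.2
    have h3' : ∀ i : Jp, IsDualPair e v h (Λ i.1) (Λ (neg i.1)) := fun i => by
      rw [h2']
      exact h3 (neg i.1) i rfl
    obtain ⟨L, hL⟩ := S.exists_isDirectSum Λ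
    have hLd : IsSelfDual h L := S.isSelfDual_of_isDirectSum hL
      (S.isDualPair hS hJp' (fun i => by
        rw [h1']
        exact (hjo i).1.mapsTo (Set.mem_univ _)) h3')
    obtain ⟨p, -, rfl⟩ := hj.1.surjOn hLd
    exact ⟨p, Λ, h1', h2', h3', hL⟩
  choose f hf using hex
  exact ⟨f, j, jo, jp, hj, hjo, hjp, hf⟩

theorem jSet_nonempty (hJp : ∀ i ∈ Jp, neg i ≠ i) :
    (jSet e (v := v) vE neg Jp w wE bE h hE).Nonempty := by
  obtain ⟨j, hj⟩ := exists_isClassicalIdent S.discrete S.complete S.herm S.nondeg w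
  choose jo hjo using fun i : {i // neg i = i} =>
    have := finiteDimensional_block e i.1
    exists_isClassicalIdent (S.discrete_summand i.1) (S.complete_summand i.1) (hS i).herm
      ((hS i).separatingLeft S i.2) (wE i)
  choose jp hjp using fun i : Jp => exists_isLinearIdent (S.discrete_summand i.1) (bE i)
  exact exists_map_of_idents S hS hJp' hJp hj hjo hjp

omit hJp' [Fintype ι] in
/-- If `J` is empty, all the identifications are unique, and so is the map `j_β`. -/
theorem eq_of_mem_jSet (hneg : ∀ i, neg i = i)
    {f f' : ProductBuilding e vE neg Jp wE bE → ClassicalBuilding v w}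
    (hf : f ∈ jSet e (v := v) vE neg Jp w wE bE h hE)
    (hf' : f' ∈ jSet e (v := v) vE neg Jp w wE bE h hE) : f = f' := by
  obtain ⟨j, jo, jp, hj, hjo, -, hf⟩ := hf
  obtain ⟨j', jo', jp', hj', hjo', -, hf'⟩ := hf'
  have h1 : j = j' := IsClassicalIdent.unique S.herm S.discrete S.nondeg S.complete hj hj'
  have h2 : ∀ i, jo i = jo' i := fun i =>
    have := finiteDimensional_block e i.1
    IsClassicalIdent.unique (hS i).herm (S.discrete_summand i.1)
      ((hS i).separatingLeft S i.2) (S.complete_summand i.1) (hjo i) (hjo' i)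
  subst h1
  funext x
  obtain ⟨Λ, a1, -, -, a4⟩ := hf x
  obtain ⟨Λ', a1', -, -, a4'⟩ := hf' x
  have hΛ : Λ = Λ' := funext fun i => by
    rw [a1 ⟨i, hneg i⟩, a1' ⟨i, hneg i⟩, h2]
  subst hΛ
  exact hj.1.injOn (Set.mem_univ _) (Set.mem_univ _) (LatticeFunction.ext_mem fun r y => by
    rw [a4, a4'])

omit hJp' [Fintype ι] in
/-- The maps `j_β` only depend on the adjoint involution. -/
theorem jSet_eq_of_adjoint_eq (S' : BlockSetting e v vE ε h' σ neg)
    (hS' : ∀ i : {i // neg i = i}, IsSummandForm e v vE ε h' (hE' i)) :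
    jSet e (v := v) vE neg Jp w wE bE h' hE' = jSet e (v := v) vE neg Jp w wE bE h hE := by
  obtain ⟨μ, hμ, hh⟩ := exists_smul_of_adjoint_eq S.herm.invol S.nondeg S'.nondeg S.adjoint
    S'.adjoint
  choose κ hκ0 hκv hκ using fun i => (hS i).exists_smul (hS' i) S.extends_val hμ hh
  refine Set.Subset.antisymm ?_ (jSet_subset_of_smul S.extends_val hμ hh hκ0 hκ hκv)
  exact jSet_subset_of_smul S.extends_val (inv_ne_zero hμ)
    (fun x y => by rw [hh, inv_mul_cancel_left₀ hμ]) (fun i => inv_ne_zero (hκ0 i))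
    (fun i x y => by rw [hκ, inv_mul_cancel_left₀ (hκ0 i)])
    (fun i => by rw [val_inv (hκ0 i), val_inv hμ, hκv])

end Maps

/-! ### The setting given by a local field -/

section Bridge

variable {Fo F : Type*} [Field Fo] [Field F] [Algebra Fo F] [IsGalois Fo F] [FiniteDimensional Fo F]
  {v : AddValuation F (WithTop ℝ)}

/-- A generator of a Galois group of order at most two is an involution (or the identity). -/
theorem apply_apply_of_finrank_le_two (hdeg : Module.finrank Fo F ≤ 2) {ρ : F ≃ₐ[Fo] F}
    (hρ : ∀ ρ' : F ≃ₐ[Fo] F, ρ' ∈ Subgroup.zpowers ρ) (a : F) : ρ (ρ a) = a := by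
  have h1 : orderOf ρ ≤ 2 := by
    rwa [orderOf_eq_card_of_forall_mem_zpowers hρ, IsGalois.card_aut_eq_finrank]
  have h2 : ρ ^ 2 = 1 := orderOf_dvd_iff_pow_eq_one.1 (by
    have := orderOf_pos ρ
    interval_cases orderOf ρ <;> norm_num)
  rw [sq] at h2
  exact congrArg (fun s : F ≃ₐ[Fo] F => s a) h2

omit [IsGalois Fo F] in
theorem val_algEquiv_eq (hc : CompleteVal (v.comap (algebraMap Fo F))) (ρ : F ≃ₐ[Fo] F) (x : F) :
    v (ρ x) = v x :=
  val_comp_eq (E := F) (E' := F) (vE := v) (vE' := v) hc (fun _ => rfl) (fun _ => rfl)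
    (ρ : F →+* F) id (fun _ => rfl) (fun a => ρ.commutes a) x

variable {V : Type*} [AddCommGroup V] [Module F V] [FiniteDimensional F V]
  {β : Module.End F V} {ι : Type*} [DecidableEq ι] {E : ι → Type*}
  [∀ i, Field (E i)] [∀ i, Algebra F (E i)]
  {e : Algebra.adjoin F {β} ≃ₐ[F] (∀ i, E i)} {vE : ∀ i, AddValuation (E i) (WithTop ℝ)}
  {τ : F →+* F} {ε : ℤˣ} {h : V →ₛₗ[τ] V →ₗ[F] F} {σ : Module.End F V → Module.End F V}
  {neg : ι → ι}

/-- The forms attached to `h` satisfy the conditions over `E i`, since the involution of `E i` is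
isometric. -/
theorem BlockSetting.isSummandForm (S : BlockSetting e v vE ε h σ neg)
    (hFo : ∀ (ρ : F ≃ₐ[Fo] F) x, v (ρ x) = v x) (hdeg : Module.finrank Fo F ≤ 2) {i : ι}
    (hi : neg i = i) {τE : E i →+* E i} (hτE : ∀ a, σ (emb e i a) = emb e i (τE a))
    {hE : block e i →ₛₗ[τE] block e i →ₗ[E i] E i}
    (hhE : IsAdmissibleForm e Fo ε v h i (vE i) τE hE) : IsSummandForm e v vE ε h hE := by
  obtain ⟨hherm, lam, hlam, -, ⟨lamo, hlamo, hnorm⟩, hh⟩ := hhE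
  have hinv : ∀ a, τE (τE a) = a := fun a => emb_injective e i (by
    rw [← hτE, ← hτE, S.adjoint_adjoint])
  obtain ⟨ρ, hρ, hρv⟩ := S.exists_conj hi
  have hisom : ∀ a, vE i (τE a) = vE i a := fun a => by
    rw [← hρv a]
    exact congrArg (vE i) (emb_injective e i (by rw [← hτE, hρ]))
  have h2 : vE i 2 = 0 := by
    have := S.extends_val i 2
    rwa [map_ofNat, S.herm.two] at this
  exact ⟨⟨hherm, hinv, hisom, h2⟩, lam, ⟨hlam, forall_pos_form_iff (S.extends_val i) hdeg
    S.herm.two hFo hinv hisom hlamo hnorm⟩, hh⟩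

end Bridge

end ClassicalBuildings

end

open ClassicalBuildings in
theorem theorem6p3
    -- the ground field, of residual characteristic not 2
    {Fo : Type*} [Field Fo] [ValuativeRel Fo] [TopologicalSpace Fo] [IsNonarchimedeanLocalField Fo]
    (hres : ringChar 𝓀[Fo] ≠ 2)
    -- the extension, its involution and the valuation
    {F : Type*} [Field F] [Algebra Fo F] [IsGalois Fo F] [FiniteDimensional Fo F]
    (hdeg : Module.finrank Fo F ≤ 2)
    (σF : F ≃ₐ[Fo] F) (hσF : ∀ ρ : F ≃ₐ[Fo] F, ρ ∈ Subgroup.zpowers σF)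
    (v : AddValuation F (WithTop ℝ))
    (hv : ∀ a b : Fo, a ≤ᵥ b ↔ v (algebraMap Fo F b) ≤ v (algebraMap Fo F a))
    (hvZ : ∀ a : Fo, a ≠ 0 → ∃ m : ℤ, v (algebraMap Fo F a) = (((m : ℤ) : ℝ) : WithTop ℝ))
    (hv1 : ∃ a : Fo, v (algebraMap Fo F a) = ((1 : ℝ) : WithTop ℝ))
    -- the hermitian space and the adjoint involution
    {V : Type*} [AddCommGroup V] [Module F V] [FiniteDimensional F V]
    (ε : ℤˣ) (h : V →ₛₗ[(σF : F →+* F)] V →ₗ[F] F)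
    (hherm : IsEpsHermitian ε h) (hnd : h.SeparatingLeft)
    (σ : Module.End F V → Module.End F V) (hσ : ∀ a x y, h (a x) y = h x (σ a y))
    -- the element of the Lie algebra and the decomposition of `F[β]` into fields
    (β : Module.End F V) (hβ : β + σ β = 0)
    {ι : Type*} [Fintype ι] [DecidableEq ι] {E : ι → Type*}
    [∀ i, Field (E i)] [∀ i, Algebra F (E i)]
    (e : Algebra.adjoin F {β} ≃ₐ[F] (∀ i, E i))
    (neg : ι → ι)
    (hneg : ∀ i, σ '' Set.range (emb e i) = Set.range (emb e (neg i)))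
    (Jp : Set ι) (hJp : ∀ i ∈ Jp, neg i ≠ i) (hJp' : ∀ i, neg i ≠ i → (i ∈ Jp ↔ neg i ∉ Jp))
    (vE : ∀ i, AddValuation (E i) (WithTop ℝ)) (hvE : ∀ i a, vE i (algebraMap F (E i) a) = v a)
    (σE : ∀ i : {i // neg i = i}, E i.1 →+* E i.1)
    (hσE : ∀ i a, σ (emb e i.1 a) = emb e i.1 (σE i a))
    -- the forms on the blocks with `-i = i`
    (hE : ∀ i : {i // neg i = i}, block e i.1 →ₛₗ[σE i] block e i.1 →ₗ[E i.1] E i.1)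
    (hhE : ∀ i, IsAdmissibleForm e Fo ε v h i.1 (vE i.1) (σE i) (hE i))
    -- the Witt decompositions and bases from which the buildings are constructed
    (w : WittFrame h) (wE : ∀ i, WittFrame (hE i)) {n : Jp → ℕ}
    (bE : ∀ i : Jp, Module.Basis (Fin (n i)) (E i.1) (block e i.1)) :
    -- every map `j_β` is injective and `H`-equivariant, and such maps exist
    (∀ f ∈ jSet e (v := v) vE neg Jp w wE bE h hE,
      Function.Injective f ∧ IsCentralizerEquivariant e f) ∧
    (jSet e (v := v) vE neg Jp w wE bE h hE).Nonempty ∧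
    -- the set of these maps depends only on the involution
    (∀ (h' : V →ₛₗ[(σF : F →+* F)] V →ₗ[F] F)
      (hE' : ∀ i : {i // neg i = i}, block e i.1 →ₛₗ[σE i] block e i.1 →ₗ[E i.1] E i.1),
      IsEpsHermitian ε h' → h'.SeparatingLeft → (∀ a x y, h' (a x) y = h' x (σ a y)) →
      (∀ i, IsAdmissibleForm e Fo ε v h' i.1 (vE i.1) (σE i) (hE' i)) →
      jSet e (v := v) vE neg Jp w wE bE h' hE' = jSet e (v := v) vE neg Jp w wE bE h hE) ∧
    -- the map is unique if `J` is empty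
    ((∀ i, neg i = i) → ∃! f, f ∈ jSet e (v := v) vE neg Jp w wE bE h hE) := by
  obtain ⟨hd, hc⟩ : DiscreteValues v ∧ CompleteVal (v.comap (algebraMap Fo F)) := by
    have hdo := discreteValues_of_int (v := v.comap (algebraMap Fo F)) hvZ hv1
    exact ⟨hdo.of_extends fun _ => rfl, completeVal_of_isNonarchimedeanLocalField hv hdo⟩
  have hFo := fun ρ : F ≃ₐ[Fo] F => val_algEquiv_eq hc ρ
  have h2 : v 2 = 0 := by
    have h3 : v (algebraMap Fo F 2) = 0 :=
      val_two_eq_zero (v := v.comap (algebraMap Fo F)) hv hres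
    rwa [map_ofNat] at h3
  have hset : ∀ h' : V →ₛₗ[(σF : F →+* F)] V →ₗ[F] F, IsEpsHermitian ε h' → h'.SeparatingLeft →
      (∀ a x y, h' (a x) y = h' x (σ a y)) → BlockSetting e v vE ε h' σ neg :=
    fun h' hherm' hnd' hσ' =>
      { discrete := hd
        complete := hc.of_extends fun _ => rfl
        herm := ⟨hherm', apply_apply_of_finrank_le_two hdeg hσF, hFo σF, h2⟩
        nondeg := hnd'
        adjoint := hσ'
        image := hneg
        extends_val := hvE }
  have S := hset h hherm hnd hσ
  have hS := fun i : {i // neg i = i} => S.isSummandForm hFo hdeg i.2 (hσE i) (hhE i)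
  have hne : (jSet e (v := v) vE neg Jp w wE bE h hE).Nonempty := jSet_nonempty S hS hJp' hJp
  refine ⟨fun f hf => ⟨injective_of_mem_jSet hf, equivariant_of_mem_jSet S hS hJp' hf⟩, hne,
    fun h' hE' hherm' hnd' hσ' hhE' => ?_, fun hJ => ?_⟩
  · have S' := hset h' hherm' hnd' hσ'
    exact jSet_eq_of_adjoint_eq S hS S' fun i =>
      S'.isSummandForm hFo hdeg i.2 (hσE i) (hhE' i)
  · obtain ⟨f, hf⟩ := hne
    exact ⟨f, hf, fun f' hf' => eq_of_mem_jSet S hS hJ hf' hf⟩
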